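/- Let $N=\mathbb Z^d$ ($d\ge 1$) and let $\mathcal A=\{a_1,\dots,a_n\}\subset N$ be the set of all lattice points of a polytope with vertices in $N$ that lies in the hyperplane of $N\otimes\mathbb R$ where the first coordinate is $1$; assume that $\mathcal A$ generates $N$. Let $M=\operatorname{Hom}(N,\mathbb Z)$, let $D=\operatorname{coker}(M\to\mathbb Z^n)$ be the cokernel of the map dual to $\mathbb Z^n\to N$, $e_i\mapsto a_i$, and let $S=\mathbb C[x_1,\dots,x_n]$ be graded by $D$ with $\deg x_i$ the image of $e_i$. For a $D$-graded module $U$ and $\alpha\in D$ write $U(\alpha)_\beta=U_{\alpha+\beta}$. Let $\mathbf D(\mathrm{gr}\text{-}S)$ be the bounded derived category of the abelian category of finitely generated $D$-graded $S$-modules and degree-zero homomorphisms. Let $\Sigma$ be a regular triangulation of $\mathcal A$ (not every point of $\mathcal A$ has to be a vertex), with Cox ideal $B_\Sigma=\bigl(\prod_{i\notin\sigma}x_i : \sigma\in\Sigma\bigr)$. Let $T_\Sigma\subset\mathbf D(\mathrm{gr}\text{-}S)$ be the smallest full triangulated subcategory, closed under isomorphisms, containing all finitely generated graded modules killed by some power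 of $B_\Sigma$, and let $\mathbf D(X_\Sigma)=\mathbf D(\mathrm{gr}\text{-}S)/T_\Sigma$ be the quotient triangulated category; the images $\widetilde S(\alpha)$ of the $S(\alpha)$ are called line bundles. Then $B_\Sigma$ can be written as a finite intersection $B_\Sigma=\bigcap_{k=1}^t\mathfrak m_k$ of ideals $\mathfrak m_k=(x_i : i\in J_k)$ generated by variables, and for every such expression the following hold. 1. $T_\Sigma$ is the smallest full triangulated subcategory of $\mathbf D(\mathrm{gr}\text{-}S)$, closed under isomorphisms, that contains $(S/\mathfrak m_k)(\alpha)$ for all $k$ and all $\alpha\in D$. 2. All relations among line bundles in $\mathbf D(X_\Sigma)$ come from the Koszul complexes of the $\mathfrak m_k$. Precisely, let $$K_k(\alpha)=\Bigl(S\bigl(\alpha-\textstyle\sum_{i\in J_k}\deg x_i\bigr)\to\cdots\to\bigoplus_{j\in J_k}S(\alpha-\deg x_j)\to S(\alpha)\Bigr)$$ be the grade-shifted Koszul complex on the variables $x_i$, $i\in J_k$, with its last term in degree $0$. Let $\mathcal L$ be the triangulated subcategory generated by all $S(\alpha)$ in the homotopy category of complexes of finitely generated graded $S$-modules (that is, the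 bounded homotopy category of finite direct sums of modules $S(\alpha)$), and let $\mathcal K$ be the triangulated subcategory of that homotopy category generated by all $K_k(\alpha)$ (subcategories being full and closed under isomorphisms). Then: (a) for all $k$ and $\alpha$ there is a quasi-isomorphism $K_k(\alpha)\to(S/\mathfrak m_k)(\alpha)$; (b) $\mathcal K\subset\mathcal L$, and an object of $\mathcal L$ becomes zero in $\mathbf D(X_\Sigma)$ if and only if it lies in $\mathcal K$; (c) the natural functor $\mathcal L\to\mathbf D(X_\Sigma)$ is a localization functor for the morphisms of $\mathcal L$ whose cone lies in $\mathcal K$; that is, it exhibits $\mathbf D(X_\Sigma)$ as the Verdier quotient $\mathcal L/\mathcal K$. -/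

import Mathlib

open CategoryTheory CategoryTheory.Limits

/-! ### Finitely generated multigraded modules -/

section Internal

variable {D M : Type} [AddCommGroup M]

open scoped Classical in
lemma isInternal_iff_finsupp (gr : D → AddSubgroup M) :
    DirectSum.IsInternal gr ↔
      (∀ x : M, ∃ f : D →₀ M, (∀ a, f a ∈ gr a) ∧ (f.sum fun _ m => m) = x) ∧
      (∀ f : D →₀ M, (∀ a, f a ∈ gr a) → (f.sum fun _ m => m) = 0 → f = 0) := by
  have key : ∀ g : DirectSum D (fun a => gr a),
      DirectSum.coeAddMonoidHom gr g = ∑ a ∈ g.support, (g a : M) := fun g => by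
    rw [DirectSum.coeAddMonoidHom_eq_dfinsuppSum]; rfl
  have conv : ∀ f : D →₀ M, ∀ hf : (∀ a, f a ∈ gr a), ∃ g : DirectSum D (fun a => gr a),
      (∀ a, (g a : M) = f a) ∧ DirectSum.coeAddMonoidHom gr g = f.sum fun _ m => m := by
    intro f hf
    let g : DirectSum D (fun a => gr a) := DirectSum.mk _ f.support (fun a => ⟨f a, hf a⟩)
    have hg : ∀ a, (g a : M) = f a := by
      intro a
      by_cases h : a ∈ f.support
      · simp only [g, DirectSum.mk_apply_of_mem h]
      · simp only [g, DirectSum.mk_apply_of_notMem h]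
        simpa using (Finsupp.notMem_support_iff.mp h).symm
    refine ⟨g, hg, ?_⟩
    rw [key, Finsupp.sum]
    have hs : g.support = f.support := by
      ext a
      rw [DFinsupp.mem_support_toFun, Finsupp.mem_support_iff, ← hg a]
      simp
    rw [hs]
    exact Finset.sum_congr rfl fun a _ => hg a
  constructor
  · intro h
    refine ⟨fun x => ?_, fun f hf h0 => ?_⟩
    · obtain ⟨g, rfl⟩ := h.2 x
      refine ⟨Finsupp.onFinset g.support (fun a => (g a : M)) (fun a ha => ?_), fun a => (g a).2, ?_⟩
      · rw [DFinsupp.mem_support_toFun]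
        intro h'
        exact ha (by rw [h']; rfl)
      · rw [key, Finsupp.sum_of_support_subset _ Finsupp.support_onFinset_subset _ (fun _ _ => rfl)]
        rfl
    · obtain ⟨g, hg, hs⟩ := conv f hf
      have : g = 0 := h.1 (by rw [hs, h0, map_zero])
      ext a
      rw [← hg a, this]
      rfl
  · rintro ⟨h1, h2⟩
    refine ⟨(injective_iff_map_eq_zero _).mpr fun g hg => ?_, fun x => ?_⟩
    · have := h2 (Finsupp.onFinset g.support (fun a => (g a : M)) (fun a ha => by
        rw [DFinsupp.mem_support_toFun]
        intro h'
        exact ha (by rw [h']; rfl))) (fun a => (g a).2) (by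
          rw [Finsupp.sum_of_support_subset _ Finsupp.support_onFinset_subset _ (fun _ _ => rfl)]
          rw [key] at hg
          exact hg)
      refine DFinsupp.ext fun a => Subtype.ext ?_
      exact DFunLike.congr_fun this a
    · obtain ⟨f, hf, rfl⟩ := h1 x
      obtain ⟨g, -, hg⟩ := conv f hf
      exact ⟨g, hg⟩

end Internal

open scoped Classical in
/-- A finitely generated module over `S = ℂ[x₁, …, xₙ]`, multigraded by the abelian group `D`,
where the variable `xᵢ` has degree `deg i`. -/
structure GrMod {D : Type} [AddCommGroup D] {n : ℕ} (deg : Fin n → D) where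
  carrier : Type
  [addCommGroup : AddCommGroup carrier]
  [module : Module (MvPolynomial (Fin n) ℂ) carrier]
  gr : D → AddSubgroup carrier
  isInternal : DirectSum.IsInternal gr
  smul_mem' : ∀ {a b : D} {s : MvPolynomial (Fin n) ℂ} {m : carrier},
    s ∈ MvPolynomial.weightedHomogeneousSubmodule ℂ deg a → m ∈ gr b → s • m ∈ gr (a + b)
  finite : Module.Finite (MvPolynomial (Fin n) ℂ) carrier

noncomputable section

namespace GrMod

variable {D : Type} [AddCommGroup D] {n : ℕ} {deg : Fin n → D}

instance : CoeSort (GrMod deg) Type := ⟨GrMod.carrier⟩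
instance (M : GrMod deg) : AddCommGroup M := M.addCommGroup
instance (M : GrMod deg) : Module (MvPolynomial (Fin n) ℂ) M := M.module
instance (M : GrMod deg) : Module.Finite (MvPolynomial (Fin n) ℂ) M := M.finite

lemma exists_decomp (M : GrMod deg) (x : M) :
    ∃ f : D →₀ M, (∀ a, f a ∈ M.gr a) ∧ (f.sum fun _ m => m) = x :=
  ((isInternal_iff_finsupp M.gr).mp M.isInternal).1 x

lemma decomp_eq_zero (M : GrMod deg) (f : D →₀ M) (hf : ∀ a, f a ∈ M.gr a)
    (h0 : (f.sum fun _ m => m) = 0) : f = 0 :=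
  ((isInternal_iff_finsupp M.gr).mp M.isInternal).2 f hf h0

/-- A morphism of multigraded modules: an `S`-linear map of degree zero. -/
@[ext]
structure Hom (M N : GrMod deg) where
  toLin : M →ₗ[MvPolynomial (Fin n) ℂ] N
  map_gr : ∀ a, ∀ x ∈ M.gr a, toLin x ∈ N.gr a

instance : Category (GrMod deg) where
  Hom := Hom
  id M := ⟨LinearMap.id, fun _ _ h => h⟩
  comp f g := ⟨g.toLin ∘ₗ f.toLin, fun a x h => g.map_gr a _ (f.map_gr a x h)⟩

@[ext]
lemma hom_ext {M N : GrMod deg} {f g : M ⟶ N} (h : ∀ x, f.toLin x = g.toLin x) : f = g :=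
  Hom.ext (LinearMap.ext h)

@[simp] lemma id_toLin (M : GrMod deg) : Hom.toLin (𝟙 M) = LinearMap.id := rfl
@[simp] lemma comp_toLin {M N P : GrMod deg} (f : M ⟶ N) (g : N ⟶ P) :
    (f ≫ g).toLin = g.toLin ∘ₗ f.toLin := rfl

section Additive

variable {M N : GrMod deg}

instance : Zero (M ⟶ N) := ⟨⟨0, fun a _ _ => (N.gr a).zero_mem⟩⟩
instance : Add (M ⟶ N) :=
  ⟨fun f g => ⟨f.toLin + g.toLin, fun a x h =>
    (N.gr a).add_mem (f.map_gr a x h) (g.map_gr a x h)⟩⟩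
instance : Neg (M ⟶ N) :=
  ⟨fun f => ⟨-f.toLin, fun a x h => (N.gr a).neg_mem (f.map_gr a x h)⟩⟩
instance : Sub (M ⟶ N) :=
  ⟨fun f g => ⟨f.toLin - g.toLin, fun a x h =>
    (N.gr a).sub_mem (f.map_gr a x h) (g.map_gr a x h)⟩⟩
instance : SMul ℕ (M ⟶ N) :=
  ⟨fun k f => ⟨k • f.toLin, fun a x h => (N.gr a).nsmul_mem (f.map_gr a x h) k⟩⟩
instance : SMul ℤ (M ⟶ N) :=
  ⟨fun k f => ⟨k • f.toLin, fun a x h => (N.gr a).zsmul_mem (f.map_gr a x h) k⟩⟩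

lemma toLin_injective :
    Function.Injective (fun f : M ⟶ N => f.toLin) := fun _ _ h => Hom.ext h

instance : AddCommGroup (M ⟶ N) :=
  toLin_injective.addCommGroup _ rfl (fun _ _ => rfl) (fun _ => rfl) (fun _ _ => rfl)
    (fun _ _ => rfl) (fun _ _ => rfl)

@[simp] lemma zero_toLin : (0 : M ⟶ N).toLin = 0 := rfl
@[simp] lemma add_toLin (f g : M ⟶ N) : (f + g).toLin = f.toLin + g.toLin := rfl
@[simp] lemma neg_toLin (f : M ⟶ N) : (-f).toLin = -f.toLin := rfl
@[simp] lemma sub_toLin (f g : M ⟶ N) : (f - g).toLin = f.toLin - g.toLin := rfl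

end Additive

instance : Preadditive (GrMod deg) where
  add_comp _ _ _ f g h := by ext x; simp
  comp_add _ _ _ f g h := by ext x; simp

/-- A submodule is homogeneous if it contains the homogeneous components of its elements. -/
def IsHomog (M : GrMod deg) (N : Submodule (MvPolynomial (Fin n) ℂ) M) : Prop :=
  ∀ f : D →₀ M, (∀ a, f a ∈ M.gr a) → (f.sum fun _ m => m) ∈ N → ∀ a, f a ∈ N

lemma isHomog_ker {M N : GrMod deg} (φ : M ⟶ N) : M.IsHomog (LinearMap.ker φ.toLin) := by
  intro f hf h a
  have := N.decomp_eq_zero (f.mapRange φ.toLin (map_zero _))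
    (fun a => by simpa using φ.map_gr a _ (hf a))
    (by rw [Finsupp.sum_mapRange_index (fun _ => rfl)]
        rw [LinearMap.mem_ker, map_finsuppSum] at h
        exact h)
  simpa using DFunLike.congr_fun this a

lemma isHomog_range {M N : GrMod deg} (φ : M ⟶ N) : N.IsHomog (LinearMap.range φ.toLin) := by
  rintro f hf ⟨x, hx⟩ a
  obtain ⟨g, hg, rfl⟩ := M.exists_decomp x
  have := N.decomp_eq_zero (g.mapRange φ.toLin (map_zero _) - f)
    (fun a => by
      rw [Finsupp.sub_apply, Finsupp.mapRange_apply]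
      exact (N.gr a).sub_mem (φ.map_gr a _ (hg a)) (hf a))
    (by rw [Finsupp.sum_sub_index (fun _ _ _ => rfl), Finsupp.sum_mapRange_index (fun _ => rfl)]
        rw [map_finsuppSum] at hx
        rw [← hx, sub_self])
  have h2 := DFunLike.congr_fun this a
  rw [Finsupp.sub_apply, Finsupp.mapRange_apply, Finsupp.coe_zero, Pi.zero_apply, sub_eq_zero] at h2
  exact ⟨g a, h2⟩

/-- A homogeneous submodule with the induced grading. -/
def sub (M : GrMod deg) (N : Submodule (MvPolynomial (Fin n) ℂ) M) (hN : M.IsHomog N) :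
    GrMod deg where
  carrier := N
  gr a := (M.gr a).comap N.subtype.toAddMonoidHom
  isInternal := by
    rw [isInternal_iff_finsupp]
    refine ⟨fun x => ?_, fun f hf h0 => ?_⟩
    · obtain ⟨f, hf, hx⟩ := M.exists_decomp x
      have hm := hN f hf (hx ▸ x.2)
      refine ⟨Finsupp.onFinset f.support (fun a => ⟨f a, hm a⟩) (fun a ha => ?_), fun a => hf a, ?_⟩
      · rw [Finsupp.mem_support_iff]
        intro h
        exact ha (Subtype.ext h)
      · rw [Finsupp.sum_of_support_subset _ Finsupp.support_onFinset_subset _ (fun _ _ => rfl)]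
        refine Subtype.ext ?_
        rw [← hx, AddSubmonoidClass.coe_finsetSum]
        rfl
    · have := M.decomp_eq_zero (f.mapRange N.subtype (map_zero _))
        (fun a => by simpa using hf a)
        (by rw [Finsupp.sum_mapRange_index (fun _ => rfl)]
            have := congrArg N.subtype h0
            rwa [map_finsuppSum, map_zero] at this)
      ext a
      simpa using DFunLike.congr_fun this a
  smul_mem' hs hm := M.smul_mem' hs hm
  finite := inferInstance

/-- The quotient by a homogeneous submodule with the induced grading. -/
def quot (M : GrMod deg) (N : Submodule (MvPolynomial (Fin n) ℂ) M) (hN : M.IsHomog N) :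
    GrMod deg where
  carrier := M ⧸ N
  gr a := (M.gr a).map N.mkQ.toAddMonoidHom
  isInternal := by
    rw [isInternal_iff_finsupp]
    refine ⟨fun x => ?_, fun f hf h0 => ?_⟩
    · obtain ⟨x, rfl⟩ := N.mkQ_surjective x
      obtain ⟨f, hf, rfl⟩ := M.exists_decomp x
      refine ⟨f.mapRange N.mkQ (map_zero _), fun a => ⟨f a, hf a, by simp⟩, ?_⟩
      rw [Finsupp.sum_mapRange_index (fun _ => rfl), map_finsuppSum]
    · choose g hg hgf using hf
      classical
      let g' : D →₀ M := Finsupp.onFinset f.support (fun a => if f a = 0 then 0 else g a)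
        (fun a ha => by
          rw [Finsupp.mem_support_iff]
          intro h
          exact ha (by simp [h]))
      have hg' : ∀ a, g' a ∈ M.gr a := fun a => by
        simp only [g', Finsupp.onFinset_apply]
        split_ifs
        · exact (M.gr a).zero_mem
        · exact hg a
      have hgf' : g'.mapRange N.mkQ (map_zero _) = f := by
        ext a
        simp only [g', Finsupp.mapRange_apply, Finsupp.onFinset_apply]
        split_ifs with h
        · rw [h, map_zero]
        · exact hgf a
      have hmem : (g'.sum fun _ m => m) ∈ N := by
        rw [← N.ker_mkQ, LinearMap.mem_ker, map_finsuppSum, ← h0, ← hgf',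
          Finsupp.sum_mapRange_index (fun _ => rfl)]
      ext a
      rw [← hgf', Finsupp.mapRange_apply, Finsupp.coe_zero, Pi.zero_apply, Submodule.mkQ_apply,
        Submodule.Quotient.mk_eq_zero]
      exact hN g' hg' hmem a
  smul_mem' := by
    rintro a b s _ hs ⟨m, hm, rfl⟩
    exact ⟨s • m, M.smul_mem' hs hm, by simp⟩
  finite := inferInstance

/-- The inclusion of a homogeneous submodule. -/
def subι (M : GrMod deg) (N : Submodule (MvPolynomial (Fin n) ℂ) M) (hN : M.IsHomog N) :
    M.sub N hN ⟶ M := ⟨N.subtype, fun _ _ h => h⟩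

/-- The projection onto the quotient by a homogeneous submodule. -/
def quotπ (M : GrMod deg) (N : Submodule (MvPolynomial (Fin n) ℂ) M) (hN : M.IsHomog N) :
    M ⟶ M.quot N hN := ⟨N.mkQ, fun _ x h => ⟨x, h, rfl⟩⟩

/-- Factoring a morphism through a homogeneous submodule. -/
def subLift {M P : GrMod deg} (N : Submodule (MvPolynomial (Fin n) ℂ) M) (hN : M.IsHomog N)
    (f : P ⟶ M) (hf : ∀ x, f.toLin x ∈ N) : P ⟶ M.sub N hN :=
  ⟨f.toLin.codRestrict N hf, fun a x h => f.map_gr a x h⟩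

/-- Factoring a morphism through a quotient. -/
def quotDesc {M P : GrMod deg} (N : Submodule (MvPolynomial (Fin n) ℂ) M) (hN : M.IsHomog N)
    (f : M ⟶ P) (hf : N ≤ LinearMap.ker f.toLin) : M.quot N hN ⟶ P :=
  ⟨N.liftQ f.toLin hf, by
    rintro a _ ⟨x, hx, rfl⟩
    exact f.map_gr a x hx⟩

lemma comp_apply_eq_zero {M N P : GrMod deg} {f : M ⟶ N} {g : N ⟶ P} (h : f ≫ g = 0) (x : M) :
    g.toLin (f.toLin x) = 0 :=
  LinearMap.congr_fun (congrArg Hom.toLin h) x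

/-- The kernel of a morphism of multigraded modules. -/
def kernelIsLimit {M N : GrMod deg} (φ : M ⟶ N) :
    IsLimit (KernelFork.ofι (f := φ) (subι M _ (isHomog_ker φ)) (by ext x; exact x.2)) :=
  KernelFork.IsLimit.ofι _ _ (fun g hg => subLift _ _ g (comp_apply_eq_zero hg))
    (fun g hg => rfl)
    (fun g hg m hm => by
      ext x
      exact Subtype.ext (LinearMap.congr_fun (congrArg Hom.toLin hm) x))

/-- The cokernel of a morphism of multigraded modules. -/
def cokernelIsColimit {M N : GrMod deg} (φ : M ⟶ N) :
    IsColimit (CokernelCofork.ofπ (f := φ) (quotπ N _ (isHomog_range φ)) (by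
      ext x
      exact (Submodule.Quotient.mk_eq_zero _).mpr ⟨x, rfl⟩)) :=
  CokernelCofork.IsColimit.ofπ _ _
    (fun g hg => quotDesc _ _ g (by
      rintro _ ⟨x, rfl⟩
      exact comp_apply_eq_zero hg x))
    (fun g hg => rfl)
    (fun g hg m hm => by
      ext x
      obtain ⟨x, rfl⟩ := Submodule.mkQ_surjective _ x
      exact LinearMap.congr_fun (congrArg Hom.toLin hm) x)

instance : HasKernels (GrMod deg) := ⟨fun φ => ⟨⟨⟨_, kernelIsLimit φ⟩⟩⟩⟩
instance : HasCokernels (GrMod deg) := ⟨fun φ => ⟨⟨⟨_, cokernelIsColimit φ⟩⟩⟩⟩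

lemma injective_of_mono {M N : GrMod deg} (φ : M ⟶ N) [Mono φ] :
    Function.Injective φ.toLin := by
  rw [← LinearMap.ker_eq_bot, eq_bot_iff]
  intro x hx
  have h : subι M _ (isHomog_ker φ) = 0 := by
    rw [← cancel_mono φ, zero_comp]
    ext y
    exact y.2
  exact LinearMap.congr_fun (congrArg Hom.toLin h) ⟨x, hx⟩

lemma surjective_of_epi {M N : GrMod deg} (φ : M ⟶ N) [Epi φ] :
    Function.Surjective φ.toLin := by
  rw [← LinearMap.range_eq_top, eq_top_iff]
  intro x _
  have h : quotπ N _ (isHomog_range φ) = 0 := by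
    rw [← cancel_epi φ, comp_zero]
    ext y
    exact (Submodule.Quotient.mk_eq_zero _).mpr ⟨y, rfl⟩
  exact (Submodule.Quotient.mk_eq_zero _).mp (LinearMap.congr_fun (congrArg Hom.toLin h) x)

/-- If `φ x` is homogeneous of degree `a`, it is the image of the component of `x` of degree `a`. -/
lemma apply_eq_of_mem_gr {M N : GrMod deg} (φ : M ⟶ N) {a : D} (f : D →₀ M)
    (hf : ∀ a, f a ∈ M.gr a) (hx : φ.toLin (f.sum fun _ m => m) ∈ N.gr a) :
    φ.toLin (f a) = φ.toLin (f.sum fun _ m => m) := by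
  classical
  have := N.decomp_eq_zero (f.mapRange φ.toLin (map_zero _) -
      Finsupp.single a (φ.toLin (f.sum fun _ m => m)))
    (fun b => by
      rw [Finsupp.sub_apply, Finsupp.mapRange_apply]
      refine (N.gr b).sub_mem (φ.map_gr b _ (hf b)) ?_
      by_cases hb : a = b
      · subst hb
        simpa using hx
      · rw [Finsupp.single_eq_of_ne' hb]
        exact (N.gr b).zero_mem)
    (by rw [Finsupp.sum_sub_index (fun _ _ _ => rfl), Finsupp.sum_mapRange_index (fun _ => rfl),
          Finsupp.sum_single_index rfl, map_finsuppSum, sub_self])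
  have h2 := DFunLike.congr_fun this a
  rwa [Finsupp.sub_apply, Finsupp.mapRange_apply, Finsupp.single_eq_same, Finsupp.coe_zero,
    Pi.zero_apply, sub_eq_zero] at h2

lemma mem_gr_of_injective {M N : GrMod deg} (φ : M ⟶ N) (h : Function.Injective φ.toLin)
    {a : D} {x : M} (hx : φ.toLin x ∈ N.gr a) : x ∈ M.gr a := by
  obtain ⟨f, hf, rfl⟩ := M.exists_decomp x
  rw [← h (apply_eq_of_mem_gr φ f hf hx)]
  exact hf a

/-- The zero module. -/
def zeroObj (deg : Fin n → D) : GrMod deg where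
  carrier := PUnit
  gr _ := ⊤
  isInternal := by
    rw [isInternal_iff_finsupp]
    exact ⟨fun x => ⟨0, fun _ => trivial, rfl⟩, fun f _ _ => Subsingleton.elim _ _⟩
  smul_mem' _ _ := trivial
  finite := inferInstance

instance : HasZeroObject (GrMod deg) :=
  ⟨zeroObj deg, ⟨fun _ => ⟨⟨⟨0⟩, fun f => by
    ext x
    obtain rfl : x = 0 := Subsingleton.elim (α := PUnit) _ _
    simp⟩⟩, fun _ => ⟨⟨⟨0⟩, fun f => by
    ext x
    exact Subsingleton.elim (α := PUnit) _ _⟩⟩⟩⟩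

/-- The direct sum of two multigraded modules. -/
def prod (M N : GrMod deg) : GrMod deg where
  carrier := M × N
  gr a := (M.gr a).prod (N.gr a)
  isInternal := by
    rw [isInternal_iff_finsupp]
    refine ⟨fun x => ?_, fun f hf h0 => ?_⟩
    · obtain ⟨f, hf, hx⟩ := M.exists_decomp x.1
      obtain ⟨g, hg, hy⟩ := N.exists_decomp x.2
      refine ⟨f.mapRange (LinearMap.inl (MvPolynomial (Fin n) ℂ) M N) (map_zero _) +
        g.mapRange (LinearMap.inr (MvPolynomial (Fin n) ℂ) M N) (map_zero _), fun a => ?_, ?_⟩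
      · exact ⟨by simpa using hf a, by simpa using hg a⟩
      · classical
        rw [Finsupp.sum_add_index' (fun _ => rfl) (fun _ _ _ => rfl),
          Finsupp.sum_mapRange_index (fun _ => rfl), Finsupp.sum_mapRange_index (fun _ => rfl),
          ← map_finsuppSum, ← map_finsuppSum, hx, hy]
        simp
    · have h1 := M.decomp_eq_zero (f.mapRange (LinearMap.fst (MvPolynomial (Fin n) ℂ) M N)
          (map_zero _)) (fun a => by simpa using (hf a).1)
        (by rw [Finsupp.sum_mapRange_index (fun _ => rfl), ← map_finsuppSum, h0, map_zero])
      have h2 := N.decomp_eq_zero (f.mapRange (LinearMap.snd (MvPolynomial (Fin n) ℂ) M N)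
          (map_zero _)) (fun a => by simpa using (hf a).2)
        (by rw [Finsupp.sum_mapRange_index (fun _ => rfl), ← map_finsuppSum, h0, map_zero])
      ext a
      · simpa using DFunLike.congr_fun h1 a
      · simpa using DFunLike.congr_fun h2 a
  smul_mem' hs hm := ⟨M.smul_mem' hs hm.1, N.smul_mem' hs hm.2⟩
  finite := inferInstance

instance : HasBinaryBiproducts (GrMod deg) := ⟨fun M N => hasBinaryBiproduct_of_total
  { pt := prod M N
    fst := ⟨LinearMap.fst _ M N, fun _ _ h => h.1⟩
    snd := ⟨LinearMap.snd _ M N, fun _ _ h => h.2⟩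
    inl := ⟨LinearMap.inl _ M N, fun a _ h => ⟨h, (N.gr a).zero_mem⟩⟩
    inr := ⟨LinearMap.inr _ M N, fun a _ h => ⟨(M.gr a).zero_mem, h⟩⟩
    inl_fst := rfl
    inl_snd := rfl
    inr_fst := rfl
    inr_snd := rfl }
  (by
    ext (x : M × N)
    exact Prod.ext (add_zero x.1) (zero_add x.2))⟩

instance : Abelian (GrMod deg) where
  toIsNormalMonoCategory := ⟨fun φ _ => ⟨{
    Z := _
    g := quotπ _ _ (isHomog_range φ)
    w := by
      ext x
      exact (Submodule.Quotient.mk_eq_zero _).mpr ⟨x, rfl⟩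
    isLimit :=
      have hinj := injective_of_mono φ
      have hmem : ∀ {P : GrMod deg} (g : P ⟶ _) (_ : g ≫ quotπ _ _ (isHomog_range φ) = 0) (x : P),
          ∃ y, φ.toLin y = g.toLin x := fun g hg x =>
        (Submodule.Quotient.mk_eq_zero _).mp (comp_apply_eq_zero hg x)
      KernelFork.IsLimit.ofι _ _
        (fun {P} g hg => ⟨(LinearEquiv.ofInjective φ.toLin hinj).symm.toLinearMap ∘ₗ
            g.toLin.codRestrict (LinearMap.range φ.toLin) (hmem g hg), fun a x hx => by
          refine mem_gr_of_injective φ hinj ?_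
          have : φ.toLin ((LinearEquiv.ofInjective φ.toLin hinj).symm
              (g.toLin.codRestrict (LinearMap.range φ.toLin) (hmem g hg) x)) = g.toLin x :=
            congrArg Subtype.val (LinearEquiv.apply_symm_apply
              (LinearEquiv.ofInjective φ.toLin hinj) _)
          exact this ▸ g.map_gr a x hx⟩)
        (fun {P} g hg => by
          ext x
          exact congrArg Subtype.val (LinearEquiv.apply_symm_apply
              (LinearEquiv.ofInjective φ.toLin hinj) _))
        (fun {P} g hg m hm => by
          rw [← cancel_mono φ]
          refine hm.trans ?_
          ext x
          exact (congrArg Subtype.val (LinearEquiv.apply_symm_apply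
              (LinearEquiv.ofInjective φ.toLin hinj)
              (g.toLin.codRestrict (LinearMap.range φ.toLin) (hmem g hg) x))).symm) }⟩⟩
  toIsNormalEpiCategory := ⟨fun {M N} φ _ => ⟨{
    W := _
    g := subι _ _ (isHomog_ker φ)
    w := by
      ext x
      exact x.2
    isColimit :=
      have hsurj := surjective_of_epi φ
      have hker : ∀ {P : GrMod deg} (g : M ⟶ P) (_ : subι _ _ (isHomog_ker φ) ≫ g = 0),
          LinearMap.ker φ.toLin ≤ LinearMap.ker g.toLin := fun g hg x hx =>
        comp_apply_eq_zero hg ⟨x, hx⟩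
      have hval : ∀ {P : GrMod deg} (g : M ⟶ P) (hg : subι _ _ (isHomog_ker φ) ≫ g = 0) (x : M),
          ((LinearMap.ker φ.toLin).liftQ g.toLin (hker g hg) ∘ₗ
            (φ.toLin.quotKerEquivOfSurjective hsurj).symm.toLinearMap) (φ.toLin x) =
              g.toLin x := fun g hg x => by
        have : (φ.toLin.quotKerEquivOfSurjective hsurj).symm (φ.toLin x) =
            Submodule.Quotient.mk x := by
          rw [LinearEquiv.symm_apply_eq]
          rfl
        rw [LinearMap.comp_apply, LinearEquiv.coe_coe, this, Submodule.liftQ_apply]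
      CokernelCofork.IsColimit.ofπ _ _
        (fun {P} g hg => ⟨(LinearMap.ker φ.toLin).liftQ g.toLin (hker g hg) ∘ₗ
            (φ.toLin.quotKerEquivOfSurjective hsurj).symm.toLinearMap, fun a y hy => by
          obtain ⟨x, rfl⟩ := hsurj y
          obtain ⟨f, hf, rfl⟩ := M.exists_decomp x
          have h2 := apply_eq_of_mem_gr φ f hf hy
          rw [← h2, hval g hg]
          exact g.map_gr a _ (hf a)⟩)
        (fun {P} g hg => by
          ext x
          exact hval g hg x)
        (fun {P} g hg m hm => by
          rw [← cancel_epi φ, hm]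
          ext x
          exact (hval g hg x).symm) }⟩⟩
  has_finite_products := by
    have : HasTerminal (GrMod deg) := HasZeroObject.hasTerminal
    exact hasFiniteProducts_of_has_binary_and_terminal

end GrMod

end

/-! ### The ring `S`, its grade shifts, monomial primes, Koszul complexes -/

noncomputable section

namespace GrMod

variable {D : Type} [AddCommGroup D] {n : ℕ} (deg : Fin n → D)

/-- The ring `S` as a multigraded module over itself. -/
def unit : GrMod deg where
  carrier := MvPolynomial (Fin n) ℂ
  gr a := (MvPolynomial.weightedHomogeneousSubmodule ℂ deg a).toAddSubgroup
  isInternal := by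
    classical
    exact (MvPolynomial.weightedDecomposition ℂ deg).isInternal
  smul_mem' hs hm := MvPolynomial.IsWeightedHomogeneous.mul hs hm
  finite := inferInstance

variable {deg}

/-- The grade shift `M(α)`, where `M(α)_β = M_{α + β}`. -/
def twist (M : GrMod deg) (α : D) : GrMod deg where
  carrier := M
  gr b := M.gr (α + b)
  isInternal := by
    rw [isInternal_iff_finsupp]
    refine ⟨fun x => ?_, fun f hf h0 => ?_⟩
    · obtain ⟨f, hf, rfl⟩ := M.exists_decomp x
      refine ⟨f.equivMapDomain (Equiv.addLeft (-α)), fun b => ?_, ?_⟩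
      · rw [Finsupp.equivMapDomain_apply]
        simpa using hf (α + b)
      · rw [Finsupp.sum_equivMapDomain]
    · have := M.decomp_eq_zero (f.equivMapDomain (Equiv.addLeft α))
        (fun a => by
          rw [Finsupp.equivMapDomain_apply]
          simpa using hf (-α + a))
        (by rw [Finsupp.sum_equivMapDomain]; exact h0)
      ext b
      simpa using DFunLike.congr_fun this (α + b)
  smul_mem' {a b s m} hs hm := by
    have := M.smul_mem' hs hm
    rwa [add_left_comm] at this
  finite := M.finite

/-- The direct sum of finitely many multigraded modules. -/
def pi {ι : Type} [Finite ι] (M : ι → GrMod deg) : GrMod deg where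
  carrier := ∀ i, M i
  gr a := AddSubgroup.pi Set.univ fun i => (M i).gr a
  isInternal := by
    classical
    have := Fintype.ofFinite ι
    rw [isInternal_iff_finsupp]
    refine ⟨fun x => ?_, fun f hf h0 => ?_⟩
    · choose f hf hx using fun i => (M i).exists_decomp (x i)
      refine ⟨∑ i, (f i).mapRange
        (LinearMap.single (MvPolynomial (Fin n) ℂ) (fun i => (M i : Type)) i) (map_zero _),
        fun a => ?_, ?_⟩
      · rw [Finsupp.finsetSum_apply]
        refine sum_mem fun i _ => ?_
        intro j _
        rw [Finsupp.mapRange_apply]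
        by_cases h : j = i
        · subst h
          simpa using hf j a
        · simp [h]
      · rw [← Finsupp.sum_finsetSum_index (fun _ => rfl) (fun _ _ _ => rfl)]
        have : ∀ i, (((f i).mapRange (LinearMap.single (MvPolynomial (Fin n) ℂ)
            (fun i => (M i : Type)) i) (map_zero _)).sum fun _ m => m) = Pi.single i (x i) := by
          intro i
          rw [Finsupp.sum_mapRange_index (fun _ => rfl), ← map_finsuppSum, hx]
          rfl
        rw [Finset.sum_congr rfl fun i _ => this i, Finset.univ_sum_single]
    · have h : ∀ i, f.mapRange (LinearMap.proj (R := MvPolynomial (Fin n) ℂ)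
          (φ := fun i => (M i : Type)) i) (map_zero _) = 0 := fun i =>
        (M i).decomp_eq_zero _ (fun a => by simpa using hf a i trivial)
          (by rw [Finsupp.sum_mapRange_index (fun _ => rfl), ← map_finsuppSum, h0, map_zero])
      ext a i
      simpa using DFunLike.congr_fun (h i) a
  smul_mem' hs hm i hi := (M i).smul_mem' hs (hm i hi)
  finite := inferInstance

variable (deg) in
/-- The free module of rank one `S(α)`. -/
def line (α : D) : GrMod deg := (unit deg).twist α

/-- The ideal `(xᵢ : i ∈ J)`. -/
def _root_.linearPrime {n : ℕ} (J : Finset (Fin n)) : Ideal (MvPolynomial (Fin n) ℂ) :=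
  Ideal.span (MvPolynomial.X '' (J : Set (Fin n)))

lemma isHomog_linearPrime (J : Finset (Fin n)) : (unit deg).IsHomog (linearPrime J) := by
  intro (f : D →₀ MvPolynomial (Fin n) ℂ) hf h a
  change f a ∈ linearPrime J
  change (f.sum fun _ m => m) ∈ linearPrime J at h
  rw [linearPrime, MvPolynomial.mem_ideal_span_X_image] at h ⊢
  intro m hm
  apply h m
  rw [MvPolynomial.mem_support_iff] at hm ⊢
  have ha : Finsupp.weight deg m = a := hf a hm
  have : MvPolynomial.coeff m (f.sum fun _ p => p) = MvPolynomial.coeff m (f a) := by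
    rw [Finsupp.sum, MvPolynomial.coeff_sum]
    refine Finset.sum_eq_single a (fun b _ hb => ?_) (fun h0 => ?_)
    · by_contra hne
      exact hb ((hf b hne).symm.trans ha)
    · rw [Finsupp.notMem_support_iff.mp h0, MvPolynomial.coeff_zero]
  rwa [this]

variable (deg) in
/-- The module `(S/𝔪)(α)` for `𝔪 = (xᵢ : i ∈ J)`. -/
def primeQuot (J : Finset (Fin n)) (α : D) : GrMod deg :=
  ((unit deg).quot (linearPrime J) (isHomog_linearPrime J)).twist α

/-- The basis of the term of cohomological degree `q` of the Koszul complex on `(xᵢ)_{i ∈ J}`: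
the subsets of `J` with `-q` elements. -/
abbrev KoszulIndex (J : Finset (Fin n)) (q : ℤ) : Type :=
  {I : Finset (Fin n) // I ⊆ J ∧ (I.card : ℤ) = -q}

variable (deg) in
/-- The term `⨁_I S(α - ∑_{i ∈ I} deg i)`, over the subsets `I ⊆ J` with `-q` elements, of the
Koszul complex. -/
def koszulX (J : Finset (Fin n)) (α : D) (q : ℤ) : GrMod deg :=
  pi fun I : KoszulIndex J q => line deg (α - ∑ i ∈ I.1, deg i)

open scoped Classical in
/-- The `S`-linear map underlying the Koszul differential,
`e_K ↦ ∑_{j ∈ K} (-1)^{#{i ∈ K | i < j}} x_j e_{K ∖ {j}}`, where `f` stands for `∑_K f_K e_K`. -/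
def koszulLin (J : Finset (Fin n)) (p q : ℤ) :
    (KoszulIndex J p → MvPolynomial (Fin n) ℂ) →ₗ[MvPolynomial (Fin n) ℂ]
      (KoszulIndex J q → MvPolynomial (Fin n) ℂ) where
  toFun f I := ∑ j : Fin n,
    if h : j ∉ I.1 ∧ insert j I.1 ⊆ J ∧ ((insert j I.1).card : ℤ) = -p then
      (-1) ^ (I.1.filter (· < j)).card * MvPolynomial.X j * f ⟨insert j I.1, h.2⟩
    else 0
  map_add' f g := by
    ext1 I
    simp only [Pi.add_apply, ← Finset.sum_add_distrib]
    refine Finset.sum_congr rfl fun j _ => ?_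
    split_ifs <;> ring
  map_smul' s f := by
    ext1 I
    simp only [Pi.smul_apply, smul_eq_mul, RingHom.id_apply, Finset.mul_sum]
    refine Finset.sum_congr rfl fun j _ => ?_
    split_ifs <;> ring

open scoped Classical in
lemma koszulLin_apply (J : Finset (Fin n)) (p q : ℤ)
    (f : KoszulIndex J p → MvPolynomial (Fin n) ℂ) (I : KoszulIndex J q) :
    koszulLin J p q f I = ∑ j : Fin n,
      if h : j ∉ I.1 ∧ insert j I.1 ⊆ J ∧ ((insert j I.1).card : ℤ) = -p then
        (-1) ^ (I.1.filter (· < j)).card * MvPolynomial.X j * f ⟨insert j I.1, h.2⟩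
      else 0 := rfl

open scoped Classical in
variable (deg) in
/-- The Koszul differential as a map of degree zero. -/
def koszulD (J : Finset (Fin n)) (α : D) (p q : ℤ) : koszulX deg J α p ⟶ koszulX deg J α q where
  toLin := koszulLin J p q
  map_gr a (f : KoszulIndex J p → MvPolynomial (Fin n) ℂ) hf I _ := by
    change koszulLin J p q f I ∈
      MvPolynomial.weightedHomogeneousSubmodule ℂ deg (α - ∑ i ∈ I.1, deg i + a)
    rw [koszulLin_apply]
    refine Submodule.sum_mem _ fun j _ => ?_
    split_ifs with h
    · have h1 : MvPolynomial.IsWeightedHomogeneous deg (f ⟨insert j I.1, h.2⟩)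
          (α - ∑ i ∈ insert j I.1, deg i + a) := hf ⟨insert j I.1, h.2⟩ trivial
      have h2 := (MvPolynomial.isWeightedHomogeneous_X ℂ deg j).mul h1
      have h3 : deg j + (α - ∑ i ∈ insert j I.1, deg i + a) = α - ∑ i ∈ I.1, deg i + a := by
        rw [Finset.sum_insert h.1]
        abel
      rw [h3] at h2
      have h4 : (-1 : MvPolynomial (Fin n) ℂ) ^ (I.1.filter (· < j)).card *
          MvPolynomial.X j * f ⟨insert j I.1, h.2⟩ =
          ((-1 : ℂ) ^ (I.1.filter (· < j)).card) • (MvPolynomial.X j * f ⟨insert j I.1, h.2⟩) := by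
        rw [MvPolynomial.smul_eq_C_mul]
        simp [mul_assoc]
      rw [h4]
      exact Submodule.smul_mem (MvPolynomial.weightedHomogeneousSubmodule ℂ deg _) _ h2
    · exact Submodule.zero_mem _

lemma koszul_sign (I : Finset (Fin n)) {j k : Fin n} (hjk : j < k) (hj : j ∉ I) :
    (-1 : MvPolynomial (Fin n) ℂ) ^ (I.filter (· < j)).card *
      (-1) ^ ((insert j I).filter (· < k)).card =
    -((-1) ^ (I.filter (· < k)).card * (-1) ^ ((insert k I).filter (· < j)).card) := by
  rw [Finset.filter_insert, if_pos hjk, Finset.filter_insert, if_neg hjk.not_gt,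
    Finset.card_insert_of_notMem (by simp [hj])]
  ring

open scoped Classical in
lemma koszulLin_comp (J : Finset (Fin n)) (p q r : ℤ)
    (f : KoszulIndex J p → MvPolynomial (Fin n) ℂ) :
    koszulLin J q r (koszulLin J p q f) = 0 := by
  ext1 I
  let g : Fin n → Fin n → MvPolynomial (Fin n) ℂ := fun j k =>
    if h : (j ∉ I.1 ∧ k ∉ I.1 ∧ j ≠ k ∧ ((I.1.card : ℤ) + 1 = -q)) ∧
      (insert k (insert j I.1) ⊆ J ∧ ((insert k (insert j I.1)).card : ℤ) = -p) then
      ((-1) ^ (I.1.filter (· < j)).card * (-1) ^ ((insert j I.1).filter (· < k)).card) *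
        (MvPolynomial.X j * MvPolynomial.X k) * f ⟨insert k (insert j I.1), h.2⟩
    else 0
  have hg : koszulLin J q r (koszulLin J p q f) I = ∑ j, ∑ k, g j k := by
    rw [koszulLin_apply]
    refine Finset.sum_congr rfl fun j _ => ?_
    split_ifs with h
    · rw [koszulLin_apply, Finset.mul_sum]
      refine Finset.sum_congr rfl fun k _ => ?_
      have hc := h.2.2
      rw [Finset.card_insert_of_notMem h.1] at hc
      simp only [g]
      by_cases hk : k ∉ insert j I.1 ∧ insert k (insert j I.1) ⊆ J ∧
          ((insert k (insert j I.1)).card : ℤ) = -p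
      · have hk1 := hk.1
        rw [Finset.mem_insert, not_or] at hk1
        rw [dif_pos hk, dif_pos ⟨⟨h.1, hk1.2, Ne.symm hk1.1, by exact_mod_cast hc⟩, hk.2⟩]
        ring
      · rw [dif_neg hk, dif_neg, mul_zero]
        rintro ⟨⟨_, h2, h3, _⟩, h5⟩
        exact hk ⟨by rw [Finset.mem_insert, not_or]; exact ⟨Ne.symm h3, h2⟩, h5⟩
    · symm
      refine Finset.sum_eq_zero fun k _ => dif_neg ?_
      rintro ⟨⟨h1, h2, h3, h4⟩, h5, h6⟩
      refine h ⟨h1, (Finset.subset_insert _ _).trans h5, ?_⟩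
      rw [Finset.card_insert_of_notMem h1]
      exact_mod_cast h4
  have hanti : ∀ j k, g j k = -g k j := by
    have key : ∀ j k, j < k → g j k = -g k j := by
      intro j k hjk
      simp only [g]
      by_cases h : (j ∉ I.1 ∧ k ∉ I.1 ∧ j ≠ k ∧ ((I.1.card : ℤ) + 1 = -q)) ∧
        (insert k (insert j I.1) ⊆ J ∧ ((insert k (insert j I.1)).card : ℤ) = -p)
      · have h' : (k ∉ I.1 ∧ j ∉ I.1 ∧ k ≠ j ∧ ((I.1.card : ℤ) + 1 = -q)) ∧
          (insert j (insert k I.1) ⊆ J ∧ ((insert j (insert k I.1)).card : ℤ) = -p) := by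
          rw [Finset.insert_comm j k]
          exact ⟨⟨h.1.2.1, h.1.1, h.1.2.2.1.symm, h.1.2.2.2⟩, h.2⟩
        rw [dif_pos h, dif_pos h', koszul_sign I.1 hjk h.1.1]
        have : (⟨insert k (insert j I.1), h.2⟩ : KoszulIndex J p) =
          ⟨insert j (insert k I.1), h'.2⟩ := Subtype.ext (Finset.insert_comm k j _)
        rw [this]
        ring
      · rw [dif_neg h, dif_neg, neg_zero]
        rw [Finset.insert_comm j k]
        rintro ⟨⟨h1, h2, h3, h4⟩, h5⟩
        exact h ⟨⟨h2, h1, h3.symm, h4⟩, h5⟩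
    intro j k
    rcases lt_trichotomy j k with h | rfl | h
    · exact key j k h
    · have : g j j = 0 := dif_neg (fun h => h.1.2.2.1 rfl)
      rw [this, neg_zero]
    · rw [key k j h, neg_neg]
  rw [hg]
  have h2 : ∑ j, ∑ k, g j k = -∑ j, ∑ k, g j k := by
    conv_lhs => rw [Finset.sum_comm]
    rw [← Finset.sum_neg_distrib]
    refine Finset.sum_congr rfl fun j _ => ?_
    rw [← Finset.sum_neg_distrib]
    exact Finset.sum_congr rfl fun k _ => hanti k j
  exact self_eq_neg.mp h2

variable (deg) in
/-- The Koszul complex `S(α - ∑_{i ∈ J} deg i) ⟶ ⋯ ⟶ ⨁_{j ∈ J} S(α - deg j) ⟶ S(α)` on the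
variables `xᵢ`, `i ∈ J`, with last term in degree zero. -/
def koszul (J : Finset (Fin n)) (α : D) : CochainComplex (GrMod deg) ℤ where
  X q := koszulX deg J α q
  d p q := koszulD deg J α p q
  shape p q hpq := by
    ext (f : KoszulIndex J p → MvPolynomial (Fin n) ℂ)
    change koszulLin J p q f = 0
    ext1 I
    rw [koszulLin_apply]
    refine Finset.sum_eq_zero fun j _ => dif_neg ?_
    rintro ⟨h1, _, h3⟩
    rw [Finset.card_insert_of_notMem h1, Nat.cast_add, I.2.2] at h3
    exact hpq (show p + 1 = q by push_cast at h3; omega)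
  d_comp_d' p q r _ _ := by
    ext f
    exact koszulLin_comp J p q r f

end GrMod

end

/-! ### Triangulated subcategories and the derived category -/

namespace CategoryTheory

open Pretriangulated

/-- The smallest full triangulated subcategory, closed under isomorphisms, containing the objects
satisfying `P`. -/
def triangulatedHull {C : Type*} [Category* C] [HasZeroObject C] [HasShift C ℤ] [Preadditive C]
    [∀ k : ℤ, (shiftFunctor C k).Additive] [Pretriangulated C] (P : ObjectProperty C) :
    ObjectProperty C :=
  fun X => ∀ Q : ObjectProperty C, Q.IsTriangulated → Q.IsClosedUnderIsomorphisms → P ≤ Q → Q X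

section

variable {C : Type*} [Category* C] [HasZeroObject C] [HasShift C ℤ] [Preadditive C]
    [∀ k : ℤ, (shiftFunctor C k).Additive] [Pretriangulated C] (P : ObjectProperty C)

instance : (triangulatedHull P).IsClosedUnderIsomorphisms where
  of_iso e h Q hQ hQ' hPQ := Q.prop_of_iso e (h Q hQ hQ' hPQ)

instance : (triangulatedHull P).IsTriangulated where
  exists_zero := ⟨_, isZero_zero C, fun Q _ _ _ => Q.prop_zero⟩
  isStableUnderShiftBy a := ⟨fun X h Q hQ hQ' hPQ => Q.le_shift a X (h Q hQ hQ' hPQ)⟩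
  toIsTriangulatedClosed₂ := .mk' fun T hT h₁ h₃ Q hQ hQ' hPQ =>
    Q.ext_of_isTriangulatedClosed₂ T hT (h₁ Q hQ hQ' hPQ) (h₃ Q hQ hQ' hPQ)

end

end CategoryTheory

universe w

noncomputable section

namespace GrMod

variable {D : Type} [AddCommGroup D] {n : ℕ} (deg : Fin n → D)

section Derived

variable [HasDerivedCategory.{w} (GrMod deg)]

/-- The bounded derived category of finitely generated multigraded `S`-modules. -/
abbrev Db := DerivedCategory.Bounded (GrMod deg)

variable {deg} in
/-- A module as an object of the bounded derived category, concentrated in degree zero. -/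
def single (M : GrMod deg) : Db deg :=
  ⟨(DerivedCategory.singleFunctor (GrMod deg) 0).obj M, ⟨0, inferInstance⟩, ⟨0, inferInstance⟩⟩

/-- The subcategory of the derived category generated by the modules killed by a power of `B`. -/
def torsion (B : Ideal (MvPolynomial (Fin n) ℂ)) : ObjectProperty (Db deg) :=
  triangulatedHull fun X => ∃ M : GrMod deg, (∃ N : ℕ, ∀ b ∈ B ^ N, ∀ m : M, b • m = 0) ∧
    X = single M

/-- The quotient of triangulated categories `D(gr-S) / T`, where `T` is generated by the modules
killed by a power of `B`. -/
abbrev DX (B : Ideal (MvPolynomial (Fin n) ℂ)) := (torsion deg B).trW.Localization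

/-- The quotient functor. -/
abbrev toDX (B : Ideal (MvPolynomial (Fin n) ℂ)) : Db deg ⥤ DX deg B := (torsion deg B).trW.Q

end Derived

/-- The bounded homotopy category of finite direct sums of the `S(α)`: the triangulated subcategory
of the homotopy category of complexes generated by the `S(α)`. -/
def lineComplexes : ObjectProperty (HomotopyCategory (GrMod deg) (ComplexShape.up ℤ)) :=
  triangulatedHull fun X => ∃ α : D, X = (HomotopyCategory.singleFunctor (GrMod deg) 0).obj (line deg α)

instance : (lineComplexes deg).IsTriangulated := by
  unfold lineComplexes
  infer_instance

variable [HasDerivedCategory.{w} (GrMod deg)]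

lemma bounded_of_lineComplexes (X : HomotopyCategory (GrMod deg) (ComplexShape.up ℤ))
    (hX : lineComplexes deg X) :
    (DerivedCategory.TStructure.t (C := GrMod deg)).bounded (DerivedCategory.Qh.obj X) := by
  refine hX ((DerivedCategory.TStructure.t (C := GrMod deg)).bounded.inverseImage
    DerivedCategory.Qh) inferInstance inferInstance ?_
  rintro _ ⟨α, rfl⟩
  exact (single (line deg α)).property

/-- The functor from bounded complexes of sums of line bundles, up to homotopy, to `D(gr-S) / T`. -/
def lineComplexesToDX (B : Ideal (MvPolynomial (Fin n) ℂ)) :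
    (lineComplexes deg).FullSubcategory ⥤ DX deg B :=
  (DerivedCategory.TStructure.t (C := GrMod deg)).bounded.lift
    ((lineComplexes deg).ι ⋙ DerivedCategory.Qh)
    (fun X => bounded_of_lineComplexes deg X.obj X.property) ⋙ toDX deg B

end GrMod

end

/-! ### Toric data -/

/-- The set of lattice points of a polytope with lattice vertices, lying in the hyperplane of
`N ⊗ ℝ` on which the first coordinate is one, where `N = ℤᵈ`. The points are numbered by `Fin n`,
and they are assumed to generate `N`. -/
structure PointConfiguration (d n : ℕ) [NeZero d] where
  pt : Fin n → Fin d → ℤ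
  injective : Function.Injective pt
  height_one : ∀ i, pt i 0 = 1
  span_eq_top : Submodule.span ℤ (Set.range pt) = ⊤
  lattice_points : ∀ v : Fin d → ℤ,
    (fun k => (v k : ℝ)) ∈ convexHull ℝ (Set.range fun i k => (pt i k : ℝ)) → ∃ i, pt i = v

noncomputable section

namespace PointConfiguration

variable {d n : ℕ} [NeZero d] (A : PointConfiguration d n)

/-- The points as elements of `N ⊗ ℝ`. -/
def realPt (i : Fin n) : Fin d → ℝ := fun k => (A.pt i k : ℝ)

/-- The grading group: the cokernel of the map `M → ℤⁿ` dual to `ℤⁿ → N`. -/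
abbrev DegGroup : Type :=
  (Fin n → ℤ) ⧸ LinearMap.range (Matrix.mulVecLin (Matrix.of A.pt))

/-- The degree of the variable `xᵢ`: the image of the `i`-th basis vector of `ℤⁿ`. -/
def deg (i : Fin n) : A.DegGroup := Submodule.Quotient.mk (Pi.single i 1)

/-- `Sig` is the set of maximal simplices, given by their sets of vertices, of a regular
triangulation of the point configuration. Not every point has to be a vertex of a simplex. -/
structure IsRegularTriangulation (Sig : Finset (Finset (Fin n))) : Prop where
  card_eq : ∀ σ ∈ Sig, σ.card = d
  linearIndependent : ∀ σ ∈ Sig, LinearIndependent ℝ fun i : σ => A.realPt i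
  covers : ⋃ σ ∈ Sig, convexHull ℝ (A.realPt '' (σ : Set (Fin n))) =
    convexHull ℝ (Set.range A.realPt)
  inter : ∀ σ ∈ Sig, ∀ τ ∈ Sig,
    convexHull ℝ (A.realPt '' (σ : Set (Fin n))) ∩ convexHull ℝ (A.realPt '' (τ : Set (Fin n))) =
      convexHull ℝ (A.realPt '' ((σ ∩ τ : Finset (Fin n)) : Set (Fin n)))
  /-- There are heights such that the lifts of the simplices are lower faces of the convex hull of
  the lifted points. -/
  regular : ∃ h : Fin n → ℝ, ∀ σ ∈ Sig, ∃ l : (Fin d → ℝ) →ₗ[ℝ] ℝ,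
    (∀ i ∈ σ, l (A.realPt i) = h i) ∧ ∀ i ∉ σ, l (A.realPt i) < h i

end PointConfiguration

/-- The Cox ideal, generated by the monomials `∏_{i ∉ σ} xᵢ` for the simplices `σ`. -/
def coxIdeal {n : ℕ} (Sig : Finset (Finset (Fin n))) : Ideal (MvPolynomial (Fin n) ℂ) :=
  Ideal.span ((fun σ : Finset (Fin n) => ∏ i ∈ σᶜ, MvPolynomial.X i) ''
    (Sig : Set (Finset (Fin n))))

namespace GrMod

variable {D : Type} [AddCommGroup D] {n : ℕ} (deg : Fin n → D)

/-- The objects `(S/𝔪ₖ)(α)` of the bounded derived category. -/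
def primeQuotients [HasDerivedCategory.{w} (GrMod deg)] {t : ℕ} (J : Fin t → Finset (Fin n)) :
    ObjectProperty (Db deg) :=
  fun X => ∃ (k : Fin t) (α : D), X = single (primeQuot deg (J k) α)

/-- The subcategory of the homotopy category of complexes generated by the grade shifts of the
Koszul complexes of the `𝔪ₖ`. -/
def koszulRelations {t : ℕ} (J : Fin t → Finset (Fin n)) :
    ObjectProperty (HomotopyCategory (GrMod deg) (ComplexShape.up ℤ)) :=
  triangulatedHull fun X => ∃ (k : Fin t) (α : D),
    X = (HomotopyCategory.quotient _ _).obj (koszul deg (J k) α)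

end GrMod

end

/-!
The ideal `B_Σ` is generated by squarefree monomials, and a monomial lies in it as soon as it is
divisible by a variable from each set `J` that meets the complements of all simplices. This writes
`B_Σ` as an intersection of ideals generated by variables (`exists_coxIdeal_eq_iInf_linearPrime`).
The rest of the argument needs only such an expression `B = ⋂ 𝔪ₖ` with `𝔪ₖ = (xᵢ : i ∈ Jₖ)`, not the
triangulation.

*Generation.* The main point is that a class of modules with the two-out-of-three property for short
exact sequences which contains the `(S/𝔪)(α)`, where `𝔪 = (xᵢ : i ∈ J)`, contains all multigraded
modules annihilated by `𝔪` (`GrMod.IsTwoOfThree.of_killedBy_linearPrime`). A filtration with cyclic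
quotients reduces this to submodules `W` of `(S/𝔪)(α)`. If `x` is a variable not in `J`, then
`(S/𝔪)(α) = P[x]` for `P = (S/(𝔪 + x))(α)`. The elements of `W` of degree less than `N` in `x` form
a module `W_{<N}` over the polynomial ring in the other variables, and for large `N` there is an exact
sequence `0 → W_{<N}(-deg x)[x] → W_{<N+1}[x] → W → 0` (`GrMod.isSES_truncDiff_truncEv`). Since
`P ↦ P[x]` is exact, induction on the number of variables not in `J` applies. For `J = ∅` this is a
form of the syzygy theorem: every module is generated by the `S(α)`.

A module annihilated by a power of `B` is annihilated by a power of `∏ 𝔪ₖ`, and so it has a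
filtration whose quotients are annihilated by one of the `𝔪ₖ`. Hence `T_Σ` is generated by the
`(S/𝔪ₖ)(α)` (`GrMod.torsion_eq_triangulatedHull_primeQuotients`).

*Koszul complexes.* The Koszul complex on the variables `xⱼ`, `j ∈ J`, is a resolution of `(S/𝔪)(α)`
(`GrMod.quasiIso_koszulε`). If an element of the Koszul complex is viewed as a differential form, then
the differential is the contraction with the Euler vector field. By Cartan's formula, the exterior
derivative is a homotopy from zero to an operator that multiplies each monomial form by its degree in these variables
(`Koszul.diff_extDeriv_add_extDeriv_diff`), and this can be inverted in characteristic zero.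

*Complexes of line bundles.* The complexes in `𝓛` have no nonzero maps to acyclic complexes up to
homotopy, because the `S(α)` are projective. So `𝓛` embeds fully faithfully into `D(gr-S)`. The
embedding is an equivalence: a bounded object is generated by its homology modules
(`DerivedCategory.prop_of_prop_homology`), and these are generated by the `S(α)`. Under the equivalence
the Koszul complexes correspond to the `(S/𝔪ₖ)(α)`, so `𝓚` corresponds to `T_Σ`
(`GrMod.torsion_lineComplexesToDb_iff`), and the quotient of `𝓛` by `𝓚` is `D(X_Σ)`. Finally, an
object vanishes in the quotient by `T_Σ` only if it lies in `T_Σ` (`GrMod.isZero_toDX_obj_iff`), because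
`T_Σ` consists of the objects whose homology modules are annihilated by powers of `B`
(`GrMod.torsion_iff_isPowTorsion_homology`), and so is closed under direct summands.
-/

noncomputable section

/-! ### Exact sequences and projective objects -/

namespace GrMod

variable {D : Type} [AddCommGroup D] {n : ℕ} {deg : Fin n → D}

lemma mono_of_injective {M N : GrMod deg} (φ : M ⟶ N) (h : Function.Injective φ.toLin) :
    Mono φ := ⟨fun a b hab => by
  ext x
  exact h (LinearMap.congr_fun (congrArg Hom.toLin hab) x)⟩

lemma epi_of_surjective {M N : GrMod deg} (φ : M ⟶ N) (h : Function.Surjective φ.toLin) :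
    Epi φ := ⟨fun a b hab => by
  ext x
  obtain ⟨x, rfl⟩ := h x
  exact LinearMap.congr_fun (congrArg Hom.toLin hab) x⟩

/-- Exactness in the abelian category of multigraded modules is exactness of the underlying
maps. -/
lemma shortComplex_exact_iff (T : ShortComplex (GrMod deg)) :
    T.Exact ↔ ∀ x, T.g.toLin x = 0 → ∃ y, T.f.toLin y = x := by
  let e := IsLimit.conePointUniqueUpToIso (kernelIsKernel T.g) (kernelIsLimit T.g)
  have he : e.hom ≫ subι T.X₂ _ (isHomog_ker T.g) = kernel.ι T.g :=
    IsLimit.conePointUniqueUpToIso_hom_comp _ _ WalkingParallelPair.zero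
  have hfac : (kernel.lift T.g T.f T.zero ≫ e.hom) ≫ subι T.X₂ _ (isHomog_ker T.g) = T.f := by
    rw [Category.assoc, he, kernel.lift_ι]
  rw [T.exact_iff_epi_kernel_lift]
  constructor
  · intro h x hx
    have : Epi (kernel.lift T.g T.f T.zero ≫ e.hom) := inferInstance
    obtain ⟨y, hy⟩ := surjective_of_epi (kernel.lift T.g T.f T.zero ≫ e.hom)
      (show T.X₂.sub _ (isHomog_ker T.g) from ⟨x, hx⟩)
    refine ⟨y, ?_⟩
    rw [← LinearMap.congr_fun (congrArg Hom.toLin hfac) y, comp_toLin, LinearMap.comp_apply, hy]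
    rfl
  · intro h
    have : Epi (kernel.lift T.g T.f T.zero ≫ e.hom) := epi_of_surjective _ fun x => by
      obtain ⟨y, hy⟩ := h x.1 x.2
      exact ⟨y, Subtype.ext ((LinearMap.congr_fun (congrArg Hom.toLin hfac) y).trans hy)⟩
    rw [show kernel.lift T.g T.f T.zero = (kernel.lift T.g T.f T.zero ≫ e.hom) ≫ e.inv by simp]
    infer_instance

/-- A short exact sequence `0 ⟶ A ⟶ B ⟶ C ⟶ 0`, in terms of elements. -/
structure IsSES {A B C : GrMod deg} (f : A ⟶ B) (g : B ⟶ C) : Prop where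
  injective : Function.Injective f.toLin
  surjective : Function.Surjective g.toLin
  exact : ∀ x, g.toLin x = 0 ↔ ∃ y, f.toLin y = x

namespace IsSES

variable {A B C : GrMod deg} {f : A ⟶ B} {g : B ⟶ C}

lemma comp_eq_zero (h : IsSES f g) : f ≫ g = 0 := by
  ext x
  exact (h.exact _).mpr ⟨x, rfl⟩

lemma shortExact (h : IsSES f g) : (ShortComplex.mk f g h.comp_eq_zero).ShortExact where
  exact := (shortComplex_exact_iff _).mpr fun x hx => (h.exact x).mp hx
  mono_f := mono_of_injective _ h.injective
  epi_g := epi_of_surjective _ h.surjective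

end IsSES

lemma isSES_sub_quot (M : GrMod deg) (N : Submodule (MvPolynomial (Fin n) ℂ) M)
    (hN : M.IsHomog N) : IsSES (subι M N hN) (quotπ M N hN) where
  injective := N.injective_subtype
  surjective := N.mkQ_surjective
  exact x := by
    change N.mkQ x = 0 ↔ _
    rw [Submodule.mkQ_apply, Submodule.Quotient.mk_eq_zero]
    exact ⟨fun h => ⟨⟨x, h⟩, rfl⟩, by rintro ⟨y, rfl⟩; exact y.2⟩

lemma isSES_of_surjective {M P : GrMod deg} (φ : M ⟶ P) (h : Function.Surjective φ.toLin) :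
    IsSES (subι M _ (isHomog_ker φ)) φ where
  injective := Submodule.injective_subtype _
  surjective := h
  exact x := ⟨fun hx => ⟨⟨x, hx⟩, rfl⟩, by rintro ⟨y, rfl⟩; exact y.2⟩

/-! ### Elements, generators and direct sums -/

/-- A family of subgroups is exhaustive as soon as homogeneous elements generate. -/
lemma exists_decomp_of_closure {D M : Type} [AddCommGroup M] (gr : D → AddSubgroup M) (T : Set M)
    (hT : ∀ t ∈ T, ∃ a, t ∈ gr a) {x : M} (hx : x ∈ AddSubgroup.closure T) :
    ∃ f : D →₀ M, (∀ a, f a ∈ gr a) ∧ (f.sum fun _ m => m) = x := by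
  classical
  induction hx using AddSubgroup.closure_induction with
  | mem x hx =>
    obtain ⟨a, ha⟩ := hT x hx
    refine ⟨Finsupp.single a x, fun b => ?_, by simp⟩
    by_cases h : a = b
    · subst h; simpa using ha
    · rw [Finsupp.single_eq_of_ne' h]; exact (gr b).zero_mem
  | zero => exact ⟨0, fun _ => (gr _).zero_mem, by simp⟩
  | add x y _ _ hx hy =>
    obtain ⟨f, hf, rfl⟩ := hx
    obtain ⟨g, hg, rfl⟩ := hy
    exact ⟨f + g, fun a => (gr a).add_mem (hf a) (hg a),
      Finsupp.sum_add_index' (fun _ => rfl) fun _ _ _ => rfl⟩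
  | neg x _ hx =>
    obtain ⟨f, hf, rfl⟩ := hx
    refine ⟨-f, fun a => (gr a).neg_mem (hf a), ?_⟩
    rw [Finsupp.sum_neg_index (fun _ => rfl), Finsupp.sum, Finsupp.sum, Finset.sum_neg_distrib]

lemma one_mem_weightedHomogeneousSubmodule :
    (1 : MvPolynomial (Fin n) ℂ) ∈ MvPolynomial.weightedHomogeneousSubmodule ℂ deg 0 :=
  MvPolynomial.isWeightedHomogeneous_one ℂ deg

lemma C_smul_mem_gr (M : GrMod deg) (c : ℂ) {b : D} {m : M} (hm : m ∈ M.gr b) :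
    (MvPolynomial.C c : MvPolynomial (Fin n) ℂ) • m ∈ M.gr b := by
  have := M.smul_mem' (MvPolynomial.isWeightedHomogeneous_C deg c) hm
  rwa [zero_add] at this

lemma X_smul_mem_gr (M : GrMod deg) (i : Fin n) {b : D} {m : M} (hm : m ∈ M.gr b) :
    (MvPolynomial.X i : MvPolynomial (Fin n) ℂ) • m ∈ M.gr (deg i + b) :=
  M.smul_mem' (MvPolynomial.isWeightedHomogeneous_X ℂ deg i) hm

lemma X_pow_smul_mem_gr (M : GrMod deg) (i : Fin n) (k : ℕ) {b : D} {m : M} (hm : m ∈ M.gr b) :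
    (MvPolynomial.X i ^ k : MvPolynomial (Fin n) ℂ) • m ∈ M.gr (k • deg i + b) :=
  M.smul_mem' ((MvPolynomial.isWeightedHomogeneous_X ℂ deg i).pow k) hm

/-- A module is multigraded if the constants and the variables act with the right degrees. -/
lemma smul_mem_of_X_smul_mem {M : Type} [AddCommGroup M] [Module (MvPolynomial (Fin n) ℂ) M]
    (gr : D → AddSubgroup M)
    (hC : ∀ (c : ℂ) (b : D) (m : M), m ∈ gr b → (MvPolynomial.C c : MvPolynomial (Fin n) ℂ) • m ∈ gr b)
    (hX : ∀ (i : Fin n) (b : D) (m : M), m ∈ gr b →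
      (MvPolynomial.X i : MvPolynomial (Fin n) ℂ) • m ∈ gr (deg i + b))
    {a b : D} {s : MvPolynomial (Fin n) ℂ} {m : M}
    (hs : s ∈ MvPolynomial.weightedHomogeneousSubmodule ℂ deg a) (hm : m ∈ gr b) :
    s • m ∈ gr (a + b) := by
  have mono : ∀ (e : Fin n →₀ ℕ) (c : ℂ) (b : D) (m : M), m ∈ gr b →
      MvPolynomial.monomial e c • m ∈ gr (Finsupp.weight deg e + b) := by
    intro e
    induction e using Finsupp.induction_linear with
    | zero => intro c b m hm; simpa using hC c b m hm
    | add e e' he he' =>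
      intro c b m hm
      rw [show MvPolynomial.monomial (e + e') c = MvPolynomial.monomial e c *
        MvPolynomial.monomial e' 1 by rw [MvPolynomial.monomial_mul, mul_one], mul_smul,
        map_add, add_assoc]
      exact he _ _ _ (he' _ _ _ hm)
    | single i k =>
      intro c b m hm
      rw [← MvPolynomial.C_mul_X_pow_eq_monomial, mul_smul]
      refine hC _ _ _ ?_
      rw [Finsupp.weight_single]
      induction k with
      | zero => simpa using hm
      | succ k ih =>
        rw [pow_succ', mul_smul, succ_nsmul', add_assoc]
        exact hX _ _ _ ih
  rw [s.as_sum, Finset.sum_smul]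
  refine sum_mem fun e he => ?_
  have : Finsupp.weight deg e = a := hs (MvPolynomial.mem_support_iff.mp he)
  exact this ▸ mono e _ b m hm

/-- An additive map is linear over the polynomial ring if it commutes with constants and
variables. -/
def linearMapOfX {M N : Type} [AddCommGroup M] [Module (MvPolynomial (Fin n) ℂ) M]
    [AddCommGroup N] [Module (MvPolynomial (Fin n) ℂ) N] (f : M →+ N)
    (hC : ∀ (c : ℂ) (m : M), f ((MvPolynomial.C c : MvPolynomial (Fin n) ℂ) • m) =
      (MvPolynomial.C c : MvPolynomial (Fin n) ℂ) • f m)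
    (hX : ∀ (i : Fin n) (m : M), f ((MvPolynomial.X i : MvPolynomial (Fin n) ℂ) • m) =
      (MvPolynomial.X i : MvPolynomial (Fin n) ℂ) • f m) :
    M →ₗ[MvPolynomial (Fin n) ℂ] N where
  toFun := f
  map_add' := f.map_add
  map_smul' s m := by
    induction s using MvPolynomial.induction_on generalizing m with
    | C c => exact hC c m
    | add p q hp hq => simp only [add_smul, map_add, hp, hq]
    | mul_X p i hp => simp only [mul_smul, hp, hX, RingHom.id_apply]

/-- The morphism `S(a) ⟶ M` given by an element of degree `-a`. -/
def fromLine (M : GrMod deg) (a : D) {m : M} (hm : m ∈ M.gr (-a)) : line deg a ⟶ M where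
  toLin := LinearMap.toSpanSingleton (MvPolynomial (Fin n) ℂ) M m
  map_gr b s hs := by
    have := M.smul_mem' (show s ∈ MvPolynomial.weightedHomogeneousSubmodule ℂ deg (a + b) from hs)
      hm
    rw [add_comm a b, add_neg_cancel_right] at this
    exact this

/-- A morphism from a free module of rank one is determined by the image of the generator. -/
lemma line_hom_ext {M : GrMod deg} {a : D} {f g : line deg a ⟶ M}
    (h : f.toLin (1 : MvPolynomial (Fin n) ℂ) = g.toLin (1 : MvPolynomial (Fin n) ℂ)) : f = g :=
  Hom.ext (LinearMap.ext_ring h)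

lemma one_mem_line_gr (a : D) : (1 : MvPolynomial (Fin n) ℂ) ∈ (line deg a).gr (-a) := by
  change (1 : MvPolynomial (Fin n) ℂ) ∈ MvPolynomial.weightedHomogeneousSubmodule ℂ deg (a + -a)
  rw [add_neg_cancel]
  exact one_mem_weightedHomogeneousSubmodule

lemma exists_homogeneous_preimage {M N : GrMod deg} (φ : M ⟶ N)
    (hφ : Function.Surjective φ.toLin) {a : D} {y : N} (hy : y ∈ N.gr a) :
    ∃ x ∈ M.gr a, φ.toLin x = y := by
  obtain ⟨x, rfl⟩ := hφ y
  obtain ⟨f, hf, rfl⟩ := M.exists_decomp x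
  exact ⟨f a, hf a, apply_eq_of_mem_gr φ f hf hy⟩

/-- The functor represented by `S(a)` takes the homogeneous component of degree `-a`, which is
exact. -/
instance projective_line (a : D) : Projective (line deg a) where
  factors {E X} f e _ := by
    obtain ⟨x, hx, hxy⟩ := exists_homogeneous_preimage e (surjective_of_epi e)
      (f.map_gr _ _ (one_mem_line_gr a))
    refine ⟨fromLine E a hx, line_hom_ext ?_⟩
    change e.toLin ((1 : MvPolynomial (Fin n) ℂ) • x) = _
    rw [one_smul, hxy]

lemma sum_toLin {ι : Type} {A B : GrMod deg} (s : Finset ι) (f : ι → (A ⟶ B)) (x : A) :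
    (∑ i ∈ s, f i).toLin x = ∑ i ∈ s, (f i).toLin x := by
  classical
  induction s using Finset.induction_on with
  | empty => rfl
  | insert i s hi ih => rw [Finset.sum_insert hi, Finset.sum_insert hi, ← ih]; rfl

section Pi

variable {ι : Type} [Fintype ι] (M : ι → GrMod deg)

/-- The projection from a finite direct sum. -/
def piProj (i : ι) : pi M ⟶ M i := ⟨LinearMap.proj i, fun _ _ h => h i trivial⟩

open scoped Classical in
/-- The inclusion into a finite direct sum. -/
def piSingle (i : ι) : M i ⟶ pi M where
  toLin := LinearMap.single _ (fun i => (M i : Type)) i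
  map_gr a x hx j _ := by
    change (Pi.single i x : ∀ j, M j) j ∈ _
    by_cases h : j = i
    · subst h; rwa [Pi.single_eq_same]
    · rw [Pi.single_eq_of_ne h]; exact ((M j).gr a).zero_mem

lemma sum_piProj_piSingle : ∑ i, piProj M i ≫ piSingle M i = 𝟙 (pi M) := by
  classical
  ext x
  rw [sum_toLin]
  exact Finset.univ_sum_single (M := fun i => (M i : Type)) x

instance projective_pi [∀ i, Projective (M i)] : Projective (pi M) where
  factors {E X} f e _ := by
    refine ⟨∑ i, piProj M i ≫ Projective.factorThru (piSingle M i ≫ f) e, ?_⟩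
    simp only [Preadditive.sum_comp, Category.assoc, Projective.factorThru_comp]
    simp only [← Category.assoc]
    rw [← Preadditive.sum_comp, sum_piProj_piSingle, Category.id_comp]

end Pi

end GrMod

/-! ### Modules annihilated by an ideal -/

namespace GrMod

variable {D : Type} [AddCommGroup D] {n : ℕ} {deg : Fin n → D}

/-- The module `M` is annihilated by the ideal `I`. -/
def KilledBy (I : Ideal (MvPolynomial (Fin n) ℂ)) (M : GrMod deg) : Prop :=
  ∀ s ∈ I, ∀ m : M, s • m = 0

lemma KilledBy.of_injective {I : Ideal (MvPolynomial (Fin n) ℂ)} {A B : GrMod deg} {f : A ⟶ B}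
    (hf : Function.Injective f.toLin) (h : KilledBy I B) : KilledBy I A := fun s hs m =>
  hf (by rw [map_smul, h s hs, map_zero])

lemma KilledBy.of_surjective {I : Ideal (MvPolynomial (Fin n) ℂ)} {A B : GrMod deg} {f : A ⟶ B}
    (hf : Function.Surjective f.toLin) (h : KilledBy I A) : KilledBy I B := fun s hs m => by
  obtain ⟨m, rfl⟩ := hf m
  rw [← map_smul, h s hs, map_zero]

/-- A module is annihilated by `(xᵢ : i ∈ J)` if it is annihilated by the generators. -/
lemma killedBy_linearPrime_iff {J : Finset (Fin n)} {M : GrMod deg} :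
    KilledBy (linearPrime J) M ↔
      ∀ i ∈ J, ∀ m : M, (MvPolynomial.X i : MvPolynomial (Fin n) ℂ) • m = 0 := by
  refine ⟨fun h i hi m => h _ (Ideal.subset_span ⟨i, hi, rfl⟩) m, fun h s hs m => ?_⟩
  have : linearPrime J ≤ LinearMap.ker (LinearMap.toSpanSingleton (MvPolynomial (Fin n) ℂ) M m) := by
    refine Ideal.span_le.mpr ?_
    rintro _ ⟨i, hi, rfl⟩
    exact h i hi m
  exact this hs

lemma killedBy_primeQuot (J : Finset (Fin n)) (α : D) :
    KilledBy (linearPrime J) (primeQuot deg J α) := fun s hs m => by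
  obtain ⟨m, rfl⟩ := (linearPrime J).mkQ_surjective m
  exact (Submodule.Quotient.mk_eq_zero (linearPrime J)).mpr (Ideal.mul_mem_right m _ hs)

/-- For each short exact sequence of modules annihilated by `I`, the class `𝒞` contains all three
terms if it contains two of them. -/
structure IsTwoOfThree (I : Ideal (MvPolynomial (Fin n) ℂ)) (𝒞 : GrMod deg → Prop) : Prop where
  left {A B C : GrMod deg} {f : A ⟶ B} {g : B ⟶ C} : IsSES f g → KilledBy I B → 𝒞 B → 𝒞 C → 𝒞 A
  middle {A B C : GrMod deg} {f : A ⟶ B} {g : B ⟶ C} : IsSES f g → KilledBy I B → 𝒞 A → 𝒞 C → 𝒞 B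
  right {A B C : GrMod deg} {f : A ⟶ B} {g : B ⟶ C} : IsSES f g → KilledBy I B → 𝒞 A → 𝒞 B → 𝒞 C

lemma isSES_zero_right {A B C : GrMod deg} (f : A ⟶ B) (hf : Function.Bijective f.toLin)
    (hC : Subsingleton C) : IsSES f (0 : B ⟶ C) where
  injective := hf.1
  surjective _ := ⟨0, Subsingleton.elim _ _⟩
  exact x := ⟨fun _ => hf.2 x, fun _ => rfl⟩

lemma isSES_zero_left {A B C : GrMod deg} (g : B ⟶ C) (hg : Function.Bijective g.toLin)
    (hA : Subsingleton A) : IsSES (0 : A ⟶ B) g where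
  injective _ _ _ := Subsingleton.elim _ _
  surjective := hg.2
  exact x := ⟨fun h => ⟨0, (hg.1 (h.trans (map_zero _).symm)).symm⟩,
    by rintro ⟨y, rfl⟩; exact map_zero _⟩

namespace IsTwoOfThree

variable {I : Ideal (MvPolynomial (Fin n) ℂ)} {𝒞 : GrMod deg → Prop}

lemma of_subsingleton (h : IsTwoOfThree I 𝒞) {A Z : GrMod deg} (hI : KilledBy I A) (hA : 𝒞 A)
    (hZ : Subsingleton Z) : 𝒞 Z :=
  h.right (isSES_zero_right (𝟙 A) Function.bijective_id hZ) hI hA hA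

lemma of_bijective (h : IsTwoOfThree I 𝒞) {A B : GrMod deg} (f : A ⟶ B)
    (hf : Function.Bijective f.toLin) (hI : KilledBy I B) (hA : 𝒞 A) : 𝒞 B := by
  have hZ : Subsingleton (zeroObj deg) := inferInstanceAs (Subsingleton PUnit)
  exact h.middle (isSES_zero_right f hf hZ) hI hA
    (h.of_subsingleton (hI.of_injective hf.1) hA hZ)

lemma of_bijective' (h : IsTwoOfThree I 𝒞) {A B : GrMod deg} (f : A ⟶ B)
    (hf : Function.Bijective f.toLin) (hI : KilledBy I B) (hB : 𝒞 B) : 𝒞 A := by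
  have hZ : Subsingleton (zeroObj deg) := inferInstanceAs (Subsingleton PUnit)
  exact h.middle (isSES_zero_left f hf hZ) (hI.of_injective hf.1)
    (h.of_subsingleton hI hB hZ) hB

end IsTwoOfThree

lemma exists_homogeneous_generators (M : GrMod deg) :
    ∃ l : List M, (∀ m ∈ l, ∃ a, m ∈ M.gr a) ∧
      Submodule.span (MvPolynomial (Fin n) ℂ) {m | m ∈ l} = ⊤ := by
  classical
  obtain ⟨T, hT⟩ := (Module.finite_def (R := MvPolynomial (Fin n) ℂ) (M := M)).mp inferInstance
  choose f hf hs using M.exists_decomp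
  refine ⟨(T.biUnion fun t => (f t).support.image (f t)).toList, fun m hm => ?_, ?_⟩
  · simp only [Finset.mem_toList, Finset.mem_biUnion, Finset.mem_image] at hm
    obtain ⟨t, _, a, _, rfl⟩ := hm
    exact ⟨a, hf t a⟩
  · rw [eq_top_iff, ← hT, Submodule.span_le]
    intro t ht
    rw [← hs t]
    refine Submodule.sum_mem _ fun a ha => Submodule.subset_span ?_
    simp only [Set.mem_ofPred_eq, Finset.mem_toList, Finset.mem_biUnion, Finset.mem_image]
    exact ⟨t, ht, a, ha, rfl⟩

lemma range_fromLine (M : GrMod deg) (a : D) {m : M} (hm : m ∈ M.gr (-a)) :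
    LinearMap.range (fromLine M a hm).toLin = Submodule.span (MvPolynomial (Fin n) ℂ) {m} :=
  (LinearMap.span_singleton_eq_range _ _ m).symm

/-- Every module has a finite filtration with cyclic quotients, so a class that is closed under
extensions is determined by its cyclic modules. -/
lemma IsTwoOfThree.of_cyclic {I : Ideal (MvPolynomial (Fin n) ℂ)} {𝒞 : GrMod deg → Prop}
    (h : IsTwoOfThree I 𝒞)
    (hcyc : ∀ (M : GrMod deg), KilledBy I M → ∀ (a : D) (m : M), m ∈ M.gr (-a) →
      Submodule.span (MvPolynomial (Fin n) ℂ) {m} = ⊤ → 𝒞 M)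
    (M : GrMod deg) (hM : KilledBy I M) : 𝒞 M := by
  obtain ⟨l, hl, hspan⟩ := M.exists_homogeneous_generators
  obtain ⟨k, hk⟩ : ∃ k, l.length = k := ⟨_, rfl⟩
  induction k generalizing M with
  | zero =>
    obtain rfl := List.length_eq_zero_iff.mp hk
    refine hcyc M hM 0 0 (zero_mem _) ?_
    simpa using hspan
  | succ k ih =>
    obtain ⟨m, l, rfl⟩ := List.exists_cons_of_length_eq_add_one hk
    obtain ⟨a, ha⟩ := hl m (by simp)
    rw [← neg_neg a] at ha
    have hN := isHomog_range (fromLine M (-a) ha)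
    have hses := isSES_sub_quot M _ hN
    refine h.middle hses hM (hcyc _ (hM.of_injective hses.injective) (-a)
      (⟨m, by rw [range_fromLine]; exact Submodule.mem_span_singleton_self m⟩) ha ?_) ?_
    · rw [eq_top_iff]
      rintro ⟨_, s, rfl⟩ _
      exact Submodule.mem_span_singleton.mpr ⟨s, rfl⟩
    · refine ih _ (hM.of_surjective hses.surjective)
        (l.map (quotπ M _ hN).toLin) (fun x hx => ?_) ?_ (by simpa using hk)
      · obtain ⟨y, hy, rfl⟩ := List.mem_map.mp hx
        obtain ⟨b, hb⟩ := hl y (List.mem_cons_of_mem _ hy)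
        exact ⟨b, (quotπ M _ hN).map_gr b y hb⟩
      · rw [eq_top_iff]
        rintro x -
        obtain ⟨x, rfl⟩ := hses.surjective x
        have hx : x ∈ Submodule.span (MvPolynomial (Fin n) ℂ) {y | y ∈ m :: l} := by
          rw [hspan]; trivial
        induction hx using Submodule.span_induction with
        | mem y hy =>
          rcases List.mem_cons.mp hy with rfl | hy
          · rw [(hses.exact y).mpr ⟨⟨y, by
              rw [range_fromLine]; exact Submodule.mem_span_singleton_self y⟩, rfl⟩]
            exact zero_mem _
          · exact Submodule.subset_span (List.mem_map.mpr ⟨y, hy, rfl⟩)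
        | zero => rw [map_zero]; exact zero_mem _
        | add x y _ _ hx hy => rw [map_add]; exact add_mem hx hy
        | smul s x _ hx => rw [map_smul]; exact Submodule.smul_mem _ _ hx

/-- The surjection from `(S/𝔪)(a)` onto a module annihilated by `𝔪` and generated by an element of
degree `-a`. -/
def fromPrimeQuot (J : Finset (Fin n)) (M : GrMod deg) (hM : KilledBy (linearPrime J) M) (a : D)
    {m : M} (hm : m ∈ M.gr (-a)) : primeQuot deg J a ⟶ M where
  toLin := (linearPrime J).liftQ (fromLine M a hm).toLin fun s hs => hM s hs m
  map_gr b := by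
    rintro _ ⟨s, hs, rfl⟩
    exact (fromLine M a hm).map_gr b s hs

lemma fromPrimeQuot_mk (J : Finset (Fin n)) (M : GrMod deg) (hM : KilledBy (linearPrime J) M)
    (a : D) {m : M} (hm : m ∈ M.gr (-a)) (s : MvPolynomial (Fin n) ℂ) :
    (fromPrimeQuot J M hM a hm).toLin ((linearPrime J).mkQ s) = s • m := rfl

lemma one_mem_primeQuot_gr (J : Finset (Fin n)) (a : D) :
    (linearPrime J).mkQ (1 : MvPolynomial (Fin n) ℂ) ∈ (primeQuot deg J a).gr (-a) :=
  ⟨(1 : MvPolynomial (Fin n) ℂ), one_mem_line_gr a, rfl⟩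

/-- To prove that a class contains all modules annihilated by `𝔪 = (xᵢ : i ∈ J)`, it is enough to
look at the modules `(S/𝔪)(a)` and their submodules. -/
lemma IsTwoOfThree.of_primeQuot {J : Finset (Fin n)} {𝒞 : GrMod deg → Prop}
    (h : IsTwoOfThree (linearPrime J) 𝒞) (hJ : ∀ a, 𝒞 (primeQuot deg J a))
    (hsub : ∀ (a : D) (K : GrMod deg) (φ : K ⟶ primeQuot deg J a),
      Function.Injective φ.toLin → 𝒞 K)
    (M : GrMod deg) (hM : KilledBy (linearPrime J) M) : 𝒞 M := by
  refine h.of_cyclic (fun M hM a m hm hspan => ?_) M hM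
  have hs : Function.Surjective (fromPrimeQuot J M hM a hm).toLin := fun x => by
    have hx : x ∈ Submodule.span (MvPolynomial (Fin n) ℂ) {m} := by rw [hspan]; trivial
    obtain ⟨s, rfl⟩ := Submodule.mem_span_singleton.mp hx
    exact ⟨(linearPrime J).mkQ s, rfl⟩
  have hses := isSES_of_surjective _ hs
  exact h.right hses (killedBy_primeQuot J a) (hsub a _ _ hses.injective) (hJ a)

end GrMod

/-! ### Adjoining a variable -/

/-- `S = ℂ[x₁, …, xₙ]` as a polynomial ring in `x`: the map `S → S[X]` that sends `x` to `X` and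
the other variables to constants. -/
def toPolynomialIn {n : ℕ} (x : Fin n) :
    MvPolynomial (Fin n) ℂ →ₐ[ℂ] Polynomial (MvPolynomial (Fin n) ℂ) :=
  MvPolynomial.aeval fun i => if i = x then Polynomial.X else Polynomial.C (MvPolynomial.X i)

/-- The substitution `x ↦ 0`. -/
def killVar {n : ℕ} (x : Fin n) : MvPolynomial (Fin n) ℂ →ₐ[ℂ] MvPolynomial (Fin n) ℂ :=
  MvPolynomial.aeval fun i => if i = x then 0 else MvPolynomial.X i

section Substitution

variable {n : ℕ} (x : Fin n)

lemma toPolynomialIn_C (c : ℂ) :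
    toPolynomialIn x (MvPolynomial.C c) = Polynomial.C (MvPolynomial.C c) :=
  MvPolynomial.aeval_C _ _

lemma toPolynomialIn_X_self : toPolynomialIn x (MvPolynomial.X x) = Polynomial.X := by
  simp [toPolynomialIn]

lemma toPolynomialIn_X_of_ne {i : Fin n} (h : i ≠ x) :
    toPolynomialIn x (MvPolynomial.X i) = Polynomial.C (MvPolynomial.X i) := by
  simp [toPolynomialIn, h]

lemma killVar_X_self : killVar x (MvPolynomial.X x) = 0 := by simp [killVar]

lemma killVar_X_of_ne {i : Fin n} (h : i ≠ x) :
    killVar x (MvPolynomial.X i) = MvPolynomial.X i := by simp [killVar, h]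

lemma killVar_C (c : ℂ) : killVar x (MvPolynomial.C c) = MvPolynomial.C c :=
  MvPolynomial.aeval_C _ _

lemma toPolynomialIn_killVar (s : MvPolynomial (Fin n) ℂ) :
    toPolynomialIn x (killVar x s) = Polynomial.C (killVar x s) := by
  have : (toPolynomialIn x).comp (killVar x) =
      ((Polynomial.CAlgHom (R := MvPolynomial (Fin n) ℂ) (A := MvPolynomial (Fin n) ℂ)).restrictScalars
        ℂ).comp (killVar x) := by
    refine MvPolynomial.algHom_ext fun i => ?_
    by_cases h : i = x
    · subst h; simp [killVar_X_self]
    · simp [killVar_X_of_ne x h, toPolynomialIn_X_of_ne x h]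
  exact DFunLike.congr_fun this s

/-- The coefficients of `s` as a polynomial in `x` do not involve `x`. -/
lemma killVar_coeff_toPolynomialIn (s : MvPolynomial (Fin n) ℂ) (k : ℕ) :
    killVar x ((toPolynomialIn x s).coeff k) = (toPolynomialIn x s).coeff k := by
  have : (Polynomial.mapAlgHom (killVar x)).comp (toPolynomialIn x) = toPolynomialIn x := by
    refine MvPolynomial.algHom_ext fun i => ?_
    by_cases h : i = x
    · subst h; simp [toPolynomialIn_X_self]
    · simp [killVar_X_of_ne x h, toPolynomialIn_X_of_ne x h]
  conv_rhs => rw [← this]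
  simp [Polynomial.coeff_map]

lemma eval_toPolynomialIn (s : MvPolynomial (Fin n) ℂ) :
    (toPolynomialIn x s).eval (MvPolynomial.X x) = s := by
  have : ((Polynomial.aeval (R := MvPolynomial (Fin n) ℂ)
      (MvPolynomial.X x : MvPolynomial (Fin n) ℂ)).restrictScalars ℂ).comp (toPolynomialIn x) =
      AlgHom.id ℂ _ := by
    refine MvPolynomial.algHom_ext fun i => ?_
    by_cases h : i = x
    · subst h; simp [toPolynomialIn_X_self]
    · simp [toPolynomialIn_X_of_ne x h]
  have := DFunLike.congr_fun this s
  simpa [Polynomial.aeval_def, Polynomial.eval₂_eq_eval_map] using this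

lemma killVar_mem_linearPrime {J : Finset (Fin n)} {s : MvPolynomial (Fin n) ℂ}
    (hs : s ∈ linearPrime (insert x J)) : killVar x s ∈ linearPrime J := by
  have : linearPrime (insert x J) ≤ (linearPrime J).comap (killVar x) := by
    refine Ideal.span_le.mpr ?_
    rintro _ ⟨i, hi, rfl⟩
    rw [SetLike.mem_coe, Ideal.mem_comap]
    by_cases h : i = x
    · subst h; rw [killVar_X_self]; exact zero_mem _
    · rw [killVar_X_of_ne x h]
      rcases Finset.mem_insert.mp hi with hi | hi
      · exact absurd hi h
      · exact Ideal.subset_span ⟨i, hi, rfl⟩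
  exact this hs

/-- If all coefficients of `s` as a polynomial in `x` lie in `(x, xᵢ : i ∈ J)`, then
`s` lies in `(xᵢ : i ∈ J)`. -/
lemma mem_linearPrime_of_coeff {J : Finset (Fin n)} {s : MvPolynomial (Fin n) ℂ}
    (hs : ∀ k, (toPolynomialIn x s).coeff k ∈ linearPrime (insert x J)) : s ∈ linearPrime J := by
  rw [← eval_toPolynomialIn x s, Polynomial.eval_eq_sum]
  refine Ideal.sum_mem _ fun k _ => Ideal.mul_mem_right _ _ ?_
  rw [← killVar_coeff_toPolynomialIn]
  exact killVar_mem_linearPrime x (hs k)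

/-- On a module annihilated by `x`, a polynomial acts as its value at `x = 0`. -/
lemma killVar_smul {M : Type} [AddCommGroup M] [Module (MvPolynomial (Fin n) ℂ) M]
    (hM : ∀ m : M, (MvPolynomial.X x : MvPolynomial (Fin n) ℂ) • m = 0)
    (s : MvPolynomial (Fin n) ℂ) (m : M) : killVar x s • m = s • m := by
  induction s using MvPolynomial.induction_on generalizing m with
  | C c => rw [killVar_C]
  | add p q hp hq => rw [map_add, add_smul, add_smul, hp, hq]
  | mul_X p i hp =>
    rw [map_mul, mul_smul, mul_smul]
    by_cases h : i = x
    · subst h; rw [killVar_X_self, zero_smul, smul_zero, hM, smul_zero]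
    · rw [killVar_X_of_ne x h, hp]

end Substitution

/-- The module `P[x] = S ⊗_A P`, where `A` is the polynomial ring in the variables other than
`x`. It consists of the polynomials `∑ pₖ xᵏ` with coefficients in `P`. The action of `S` comes from
`toPolynomialIn x`; thus the action of `x` on `P` itself, which is zero in the applications, is not
used. -/
def AdjoinVar {n : ℕ} (_ : Fin n) (P : Type) [AddCommGroup P] [Module (MvPolynomial (Fin n) ℂ) P] :
    Type :=
  PolynomialModule (MvPolynomial (Fin n) ℂ) P

namespace AdjoinVar

variable {n : ℕ} {x : Fin n} {P : Type} [AddCommGroup P] [Module (MvPolynomial (Fin n) ℂ) P]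

instance : AddCommGroup (AdjoinVar x P) :=
  inferInstanceAs (AddCommGroup (PolynomialModule (MvPolynomial (Fin n) ℂ) P))

instance : Module (MvPolynomial (Fin n) ℂ) (AdjoinVar x P) :=
  Module.compHom (PolynomialModule (MvPolynomial (Fin n) ℂ) P) (toPolynomialIn x).toRingHom

lemma smul_def (s : MvPolynomial (Fin n) ℂ) (f : AdjoinVar x P) :
    s • f = (toPolynomialIn x s •
      (show PolynomialModule (MvPolynomial (Fin n) ℂ) P from f) : PolynomialModule _ P) := rfl

/-- The coefficient of `xᵏ`. -/
def coeff (k : ℕ) : AdjoinVar x P →+ P where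
  toFun f := PolynomialModule.coeff f k
  map_zero' := rfl
  map_add' _ _ := rfl

variable (x) in
/-- The monomial `p xᵏ`. -/
def single (k : ℕ) : P →+ AdjoinVar x P where
  toFun p := PolynomialModule.single (MvPolynomial (Fin n) ℂ) k p
  map_zero' := PolynomialModule.single_zero k
  map_add' := PolynomialModule.single_add k

lemma ext {f g : AdjoinVar x P} (h : ∀ k, coeff k f = coeff k g) : f = g :=
  PolynomialModule.coeff_injective (Finsupp.ext h)

lemma coeff_single (k l : ℕ) (p : P) : coeff l (single x k p) = if k = l then p else 0 :=
  Finsupp.single_apply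

lemma coeff_single_of_ne {k l : ℕ} (h : k ≠ l) (p : P) : coeff l (single x k p) = 0 := by
  rw [coeff_single, if_neg h]

/-- A bound for the degree of a polynomial with coefficients in a module. -/
lemma exists_coeff_eq_zero (f : AdjoinVar x P) : ∃ N, ∀ k, N ≤ k → coeff k f = 0 := by
  obtain ⟨N, hN⟩ := (PolynomialModule.coeff f).support.bddAbove
  refine ⟨N + 1, fun k hk => ?_⟩
  by_contra h
  have := hN (Finset.mem_coe.mpr (Finsupp.mem_support_iff.mpr h))
  omega

lemma eq_sum_single (f : AdjoinVar x P) {N : ℕ} (hN : ∀ k, N ≤ k → coeff k f = 0) :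
    f = ∑ k ∈ Finset.range N, single x k (coeff k f) := by
  refine ext fun l => ?_
  simp only [map_sum, coeff_single, Finset.sum_ite_eq', Finset.mem_range]
  split_ifs with h
  · rfl
  · exact hN l (not_lt.mp h)

lemma induction_on {p : AdjoinVar x P → Prop} (f : AdjoinVar x P)
    (add : ∀ f g, p f → p g → p (f + g)) (h : ∀ k q, p (single x k q)) : p f := by
  obtain ⟨N, hN⟩ := f.exists_coeff_eq_zero
  rw [f.eq_sum_single hN]
  have h0 : p 0 := by simpa using h 0 0
  exact Finset.sum_induction _ p add h0 fun k _ => h k _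

lemma C_smul_single (c : ℂ) (k : ℕ) (p : P) :
    (MvPolynomial.C c : MvPolynomial (Fin n) ℂ) • single x k p =
      single x k ((MvPolynomial.C c : MvPolynomial (Fin n) ℂ) • p) := by
  rw [smul_def, toPolynomialIn_C, ← Polynomial.monomial_zero_left]
  exact (PolynomialModule.monomial_smul_single _ _ _ _).trans (by rw [zero_add]; rfl)

lemma X_smul_single_of_ne {i : Fin n} (h : i ≠ x) (k : ℕ) (p : P) :
    (MvPolynomial.X i : MvPolynomial (Fin n) ℂ) • single x k p =
      single x k ((MvPolynomial.X i : MvPolynomial (Fin n) ℂ) • p) := by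
  rw [smul_def, toPolynomialIn_X_of_ne x h, ← Polynomial.monomial_zero_left]
  exact (PolynomialModule.monomial_smul_single _ _ _ _).trans (by rw [zero_add]; rfl)

lemma X_smul_single (k : ℕ) (p : P) :
    (MvPolynomial.X x : MvPolynomial (Fin n) ℂ) • single x k p = single x (k + 1) p := by
  rw [smul_def, toPolynomialIn_X_self, ← Polynomial.monomial_one_one_eq_X]
  exact (PolynomialModule.monomial_smul_single _ _ _ _).trans (by rw [add_comm, one_smul]; rfl)

lemma X_pow_smul_single (j k : ℕ) (p : P) :
    (MvPolynomial.X x ^ j : MvPolynomial (Fin n) ℂ) • single x k p = single x (k + j) p := by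
  induction j with
  | zero => simp
  | succ j ih => rw [pow_succ', mul_smul, ih, X_smul_single]; rfl

lemma single_eq_smul (k : ℕ) (p : P) :
    single x k p = (MvPolynomial.X x ^ k : MvPolynomial (Fin n) ℂ) • single x 0 p := by
  rw [X_pow_smul_single, zero_add]

lemma killVar_smul_single (s : MvPolynomial (Fin n) ℂ) (k : ℕ) (p : P) :
    killVar x s • single x k p = single x k (killVar x s • p) := by
  rw [smul_def, toPolynomialIn_killVar, ← Polynomial.monomial_zero_left]
  exact (PolynomialModule.monomial_smul_single _ _ _ _).trans (by rw [zero_add]; rfl)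

lemma coeff_smul_single_zero (s : MvPolynomial (Fin n) ℂ) (k : ℕ) (p : P) :
    coeff k (s • single x 0 p) = (toPolynomialIn x s).coeff k • p :=
  (PolynomialModule.smul_single_apply 0 (toPolynomialIn x s) p k).trans (by simp)

/-- A map on coefficients that is linear over the polynomial ring in the other variables extends
to an `S`-linear map. -/
def lift {M : Type} [AddCommGroup M] [Module (MvPolynomial (Fin n) ℂ) M] (j : P →+ M)
    (hC : ∀ (c : ℂ) (p : P), j ((MvPolynomial.C c : MvPolynomial (Fin n) ℂ) • p) =
      (MvPolynomial.C c : MvPolynomial (Fin n) ℂ) • j p)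
    (hX : ∀ i ≠ x, ∀ p : P, j ((MvPolynomial.X i : MvPolynomial (Fin n) ℂ) • p) =
      (MvPolynomial.X i : MvPolynomial (Fin n) ℂ) • j p) :
    AdjoinVar x P →ₗ[MvPolynomial (Fin n) ℂ] M :=
  let F : AdjoinVar x P →+ M :=
    (Finsupp.liftAddHom fun k => (DistribSMul.toAddMonoidHom M
      (MvPolynomial.X x ^ k : MvPolynomial (Fin n) ℂ)).comp j).comp
      (PolynomialModule.coeffAddEquiv (R := MvPolynomial (Fin n) ℂ) (M := P)).toAddMonoidHom
  have hF : ∀ k p, F (single x k p) = (MvPolynomial.X x ^ k : MvPolynomial (Fin n) ℂ) • j p :=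
    fun k p => Finsupp.liftAddHom_apply_single _ _ _
  GrMod.linearMapOfX F
    (fun c f => by
      induction f using induction_on with
      | add f g hf hg => rw [smul_add, map_add, map_add, hf, hg, smul_add]
      | h k p => rw [C_smul_single, hF, hF, hC, smul_comm])
    (fun i f => by
      induction f using induction_on with
      | add f g hf hg => rw [smul_add, map_add, map_add, hf, hg, smul_add]
      | h k p =>
        by_cases h : i = x
        · subst h
          rw [X_smul_single, hF, hF, pow_succ', mul_smul]
        · rw [X_smul_single_of_ne h, hF, hF, hX i h, smul_comm])

lemma lift_single {M : Type} [AddCommGroup M] [Module (MvPolynomial (Fin n) ℂ) M] (j : P →+ M)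
    (hC) (hX) (k : ℕ) (p : P) :
    lift (x := x) j hC hX (single x k p) =
      (MvPolynomial.X x ^ k : MvPolynomial (Fin n) ℂ) • j p :=
  Finsupp.liftAddHom_apply_single _ _ _

variable {Q : Type} [AddCommGroup Q] [Module (MvPolynomial (Fin n) ℂ) Q]

variable (x) in
/-- The functoriality of `P[x]` in `P`. -/
def map (φ : P →ₗ[MvPolynomial (Fin n) ℂ] Q) :
    AdjoinVar x P →ₗ[MvPolynomial (Fin n) ℂ] AdjoinVar x Q :=
  lift ((single x 0).comp φ.toAddMonoidHom)
    (fun c p => by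
      rw [AddMonoidHom.comp_apply, AddMonoidHom.comp_apply, C_smul_single]
      exact congrArg _ (map_smul φ _ p))
    (fun i hi p => by
      rw [AddMonoidHom.comp_apply, AddMonoidHom.comp_apply, X_smul_single_of_ne hi]
      exact congrArg _ (map_smul φ _ p))

lemma coeff_map (φ : P →ₗ[MvPolynomial (Fin n) ℂ] Q) (f : AdjoinVar x P) (k : ℕ) :
    coeff k (map x φ f) = φ (coeff k f) := by
  induction f using induction_on with
  | add f g hf hg => rw [map_add, map_add, map_add, map_add, hf, hg]
  | h l p =>
    rw [map, lift_single, AddMonoidHom.comp_apply, X_pow_smul_single, coeff_single, coeff_single,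
      zero_add]
    split_ifs
    · rfl
    · rw [map_zero]

/-- A polynomial with prescribed coefficients in a module. -/
lemma exists_coeff_eq (s : ℕ → P) (N : ℕ) (hs : ∀ k, N ≤ k → s k = 0) :
    ∃ f : AdjoinVar x P, ∀ k, coeff k f = s k := by
  refine ⟨∑ k ∈ Finset.range N, single x k (s k), fun k => ?_⟩
  simp only [map_sum, coeff_single, Finset.sum_ite_eq', Finset.mem_range]
  split_ifs with h
  · rfl
  · exact (hs k (not_lt.mp h)).symm

lemma map_injective {φ : P →ₗ[MvPolynomial (Fin n) ℂ] Q} (hφ : Function.Injective φ) :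
    Function.Injective (map x φ) := fun f g h => ext fun k => hφ (by
  rw [← coeff_map, ← coeff_map, h])

/-- A lift of polynomials along a map on coefficients can be chosen coefficientwise. -/
lemma exists_map_eq {φ : P →ₗ[MvPolynomial (Fin n) ℂ] Q} (f : AdjoinVar x Q)
    (hf : ∀ k, ∃ p, φ p = coeff k f) : ∃ g : AdjoinVar x P, map x φ g = f := by
  classical
  obtain ⟨N, hN⟩ := f.exists_coeff_eq_zero
  choose s hs using hf
  obtain ⟨g, hg⟩ := exists_coeff_eq (x := x) (fun k => if N ≤ k then 0 else s k) N
    fun k hk => if_pos hk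
  refine ⟨g, ext fun k => ?_⟩
  rw [coeff_map, hg]
  split_ifs with h
  · rw [map_zero, hN k h]
  · exact hs k

end AdjoinVar

namespace GrMod

variable {D : Type} [AddCommGroup D] {n : ℕ} {deg : Fin n → D} (x : Fin n)

/-- The multigraded module `P[x]`, for a module `P` annihilated by `x`. -/
def adjoin (P : GrMod deg) (hP : ∀ p : P, (MvPolynomial.X x : MvPolynomial (Fin n) ℂ) • p = 0) :
    GrMod deg where
  carrier := AdjoinVar x P
  gr a := ⨅ k : ℕ, (P.gr (a - k • deg x)).comap (AdjoinVar.coeff k)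
  isInternal := by
    rw [isInternal_iff_finsupp]
    refine ⟨fun f => ?_, fun f hf h0 => ?_⟩
    · refine exists_decomp_of_closure _
        {f | ∃ (k : ℕ) (a : D) (p : P), p ∈ P.gr a ∧ f = AdjoinVar.single x k p} ?_ ?_
      · rintro _ ⟨k, a, p, hp, rfl⟩
        refine ⟨a + k • deg x, AddSubgroup.mem_iInf.mpr fun l => ?_⟩
        rw [AddSubgroup.mem_comap, AdjoinVar.coeff_single]
        split_ifs with h
        · subst h; rwa [add_sub_cancel_right]
        · exact zero_mem _
      · induction f using AdjoinVar.induction_on with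
        | add f g hf hg => exact add_mem hf hg
        | h k q =>
          obtain ⟨f, hf, rfl⟩ := P.exists_decomp q
          rw [Finsupp.sum, map_sum]
          exact sum_mem fun a _ => AddSubgroup.subset_closure ⟨k, a, f a, hf a, rfl⟩
    -- The coefficients of `xᵏ` in the components are the components of an element of `P`, up to a
    -- shift of the degrees.
    · have h1 : ∀ k, (f.mapRange (AdjoinVar.coeff k) (map_zero _)).equivMapDomain
          (Equiv.subRight (k • deg x)) = 0 := fun k => P.decomp_eq_zero _
        (fun a => by
          have := AddSubgroup.mem_iInf.mp (hf (a + k • deg x)) k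
          rw [AddSubgroup.mem_comap, add_sub_cancel_right] at this
          simpa using this)
        (by
          rw [Finsupp.sum_equivMapDomain, Finsupp.sum_mapRange_index (fun _ => rfl),
            ← map_finsuppSum, h0, map_zero])
      ext a
      refine AdjoinVar.ext fun k => ?_
      simpa using DFunLike.congr_fun (h1 k) (a - k • deg x)
  smul_mem' := by
    intro a b s m
    refine smul_mem_of_X_smul_mem (deg := deg) (fun a => ⨅ k : ℕ, (P.gr (a - k • deg x)).comap
      (AdjoinVar.coeff (x := x) k)) (fun c b f hf => ?_) (fun i b f hf => ?_)
    · obtain ⟨N, hN⟩ := f.exists_coeff_eq_zero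
      rw [f.eq_sum_single hN, Finset.smul_sum]
      refine sum_mem fun k _ => AddSubgroup.mem_iInf.mpr fun l => ?_
      rw [AddSubgroup.mem_comap, AdjoinVar.C_smul_single, AdjoinVar.coeff_single]
      split_ifs with h
      · subst h; exact P.C_smul_mem_gr c (AddSubgroup.mem_iInf.mp hf k)
      · exact zero_mem _
    · obtain ⟨N, hN⟩ := f.exists_coeff_eq_zero
      rw [f.eq_sum_single hN, Finset.smul_sum]
      refine sum_mem fun k _ => AddSubgroup.mem_iInf.mpr fun l => ?_
      by_cases h : i = x
      · subst h
        rw [AddSubgroup.mem_comap, AdjoinVar.X_smul_single, AdjoinVar.coeff_single]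
        split_ifs with h
        · subst h
          rw [succ_nsmul', add_sub_add_left_eq_sub]
          exact AddSubgroup.mem_iInf.mp hf k
        · exact zero_mem _
      · rw [AddSubgroup.mem_comap, AdjoinVar.X_smul_single_of_ne h, AdjoinVar.coeff_single]
        split_ifs with h
        · subst h
          rw [add_sub_assoc]
          exact P.X_smul_mem_gr i (AddSubgroup.mem_iInf.mp hf k)
        · exact zero_mem _
  finite := by
    obtain ⟨T, hT⟩ := (Module.finite_def (R := MvPolynomial (Fin n) ℂ) (M := P)).mp inferInstance
    classical
    refine ⟨⟨T.image (AdjoinVar.single x 0), eq_top_iff.mpr fun f => ?_⟩⟩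
    rintro -
    induction f using AdjoinVar.induction_on with
    | add f g hf hg => exact add_mem hf hg
    | h k q =>
      rw [AdjoinVar.single_eq_smul]
      refine Submodule.smul_mem _ _ ?_
      have hq : q ∈ Submodule.span (MvPolynomial (Fin n) ℂ) (T : Set P) := by rw [hT]; trivial
      induction hq using Submodule.span_induction with
      | mem p hp => exact Submodule.subset_span (by simpa using ⟨p, hp, rfl⟩)
      | zero => rw [map_zero]; exact zero_mem _
      | add p q _ _ hp hq => rw [map_add]; exact add_mem hp hq
      | smul s p _ hp =>
        -- On `P` the polynomial `s` acts as `s` with `x = 0`, which commutes with `single`.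
        rw [← killVar_smul x hP, ← AdjoinVar.killVar_smul_single]
        exact Submodule.smul_mem _ _ hp

variable {x}

lemma mem_adjoin_gr {P : GrMod deg}
    {hP : ∀ p : P, (MvPolynomial.X x : MvPolynomial (Fin n) ℂ) • p = 0} {a : D}
    {f : adjoin x P hP} :
    f ∈ (adjoin x P hP).gr a ↔
      ∀ k : ℕ, AdjoinVar.coeff (x := x) (P := P) k f ∈ P.gr (a - k • deg x) :=
  AddSubgroup.mem_iInf

lemma single_mem_adjoin_gr {P : GrMod deg}
    {hP : ∀ p : P, (MvPolynomial.X x : MvPolynomial (Fin n) ℂ) • p = 0} {a : D} {k : ℕ} {p : P}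
    (hp : p ∈ P.gr (a - k • deg x)) :
    (show adjoin x P hP from AdjoinVar.single x k p) ∈ (adjoin x P hP).gr a := by
  rw [mem_adjoin_gr]
  intro l
  change AdjoinVar.coeff l (AdjoinVar.single x k p) ∈ _
  rw [AdjoinVar.coeff_single]
  split_ifs with h
  · subst h; exact hp
  · exact zero_mem _

/-- The extension to `P[x]` of a map of degree zero on `P`. -/
def adjoinLift {P M : GrMod deg}
    (hP : ∀ p : P, (MvPolynomial.X x : MvPolynomial (Fin n) ℂ) • p = 0) (j : P →+ M)
    (hC : ∀ (c : ℂ) (p : P), j ((MvPolynomial.C c : MvPolynomial (Fin n) ℂ) • p) =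
      (MvPolynomial.C c : MvPolynomial (Fin n) ℂ) • j p)
    (hX : ∀ i ≠ x, ∀ p : P, j ((MvPolynomial.X i : MvPolynomial (Fin n) ℂ) • p) =
      (MvPolynomial.X i : MvPolynomial (Fin n) ℂ) • j p)
    (hj : ∀ a, ∀ p ∈ P.gr a, j p ∈ M.gr a) : adjoin x P hP ⟶ M where
  toLin := AdjoinVar.lift j hC hX
  map_gr a f hf := by
    rw [mem_adjoin_gr] at hf
    change AdjoinVar x P at f
    obtain ⟨N, hN⟩ := f.exists_coeff_eq_zero
    change AdjoinVar.lift j hC hX f ∈ M.gr a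
    rw [f.eq_sum_single hN, map_sum]
    refine sum_mem fun k _ => ?_
    rw [AdjoinVar.lift_single]
    have := M.X_pow_smul_mem_gr x k (hj _ _ (hf k))
    rwa [add_sub_cancel] at this

/-- The functoriality of `P[x]` in the multigraded module `P`. -/
def adjoinMap {P Q : GrMod deg}
    (hP : ∀ p : P, (MvPolynomial.X x : MvPolynomial (Fin n) ℂ) • p = 0)
    (hQ : ∀ q : Q, (MvPolynomial.X x : MvPolynomial (Fin n) ℂ) • q = 0) (φ : P ⟶ Q) :
    adjoin x P hP ⟶ adjoin x Q hQ where
  toLin := AdjoinVar.map x φ.toLin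
  map_gr a f hf := by
    rw [mem_adjoin_gr] at hf ⊢
    intro k
    exact (congrArg (· ∈ Q.gr (a - k • deg x)) (AdjoinVar.coeff_map (x := x) φ.toLin f k)).mpr
      (φ.map_gr _ _ (hf k))

/-- The functor `P ↦ P[x]` is exact. -/
lemma IsSES.adjoin {A B C : GrMod deg} {f : A ⟶ B} {g : B ⟶ C} (h : IsSES f g)
    (hA : ∀ p : A, (MvPolynomial.X x : MvPolynomial (Fin n) ℂ) • p = 0)
    (hB : ∀ p : B, (MvPolynomial.X x : MvPolynomial (Fin n) ℂ) • p = 0)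
    (hC : ∀ p : C, (MvPolynomial.X x : MvPolynomial (Fin n) ℂ) • p = 0) :
    IsSES (adjoinMap hA hB f) (adjoinMap hB hC g) where
  injective := AdjoinVar.map_injective h.injective
  surjective p := AdjoinVar.exists_map_eq p fun _ => h.surjective _
  exact (p : AdjoinVar x B) := by
    constructor
    · intro hp
      refine AdjoinVar.exists_map_eq p fun k => (h.exact _).mp ?_
      have hp : AdjoinVar.map x g.toLin p = 0 := hp
      rw [← AdjoinVar.coeff_map, hp, map_zero]
    · rintro ⟨q, rfl⟩
      change AdjoinVar x A at q
      refine AdjoinVar.ext (x := x) fun k => ?_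
      change AdjoinVar.coeff k (AdjoinVar.map x g.toLin (AdjoinVar.map x f.toLin q)) =
        AdjoinVar.coeff k 0
      rw [AdjoinVar.coeff_map, AdjoinVar.coeff_map, map_zero]
      exact (h.exact _).mpr ⟨_, rfl⟩

end GrMod

/-! ### The resolution of a module of polynomials -/

namespace AdjoinVar

variable {n : ℕ} {x : Fin n} {P : Type} [AddCommGroup P] [Module (MvPolynomial (Fin n) ℂ) P]

lemma coeff_killVar_smul (hP : ∀ p : P, (MvPolynomial.X x : MvPolynomial (Fin n) ℂ) • p = 0)
    (s : MvPolynomial (Fin n) ℂ) (f : AdjoinVar x P) (k : ℕ) :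
    coeff k (killVar x s • f) = s • coeff k f := by
  induction f using induction_on with
  | add f g hf hg => rw [smul_add, map_add, map_add, smul_add, hf, hg]
  | h l p =>
    rw [killVar_smul_single, killVar_smul x hP, coeff_single, coeff_single]
    split_ifs
    · rfl
    · rw [smul_zero]

lemma coeff_X_pow_smul (l k : ℕ) (f : AdjoinVar x P) :
    coeff k ((MvPolynomial.X x ^ l : MvPolynomial (Fin n) ℂ) • f) =
      if l ≤ k then coeff (k - l) f else 0 := by
  induction f using induction_on with
  | add f g hf hg => rw [smul_add, map_add, map_add, hf, hg]; split_ifs <;> simp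
  | h i p =>
    rw [X_pow_smul_single, coeff_single, coeff_single]
    split_ifs <;> first | rfl | omega

section KoszulResolution

variable {Q Q' M : Type} [AddCommGroup Q] [Module (MvPolynomial (Fin n) ℂ) Q]
  [AddCommGroup Q'] [Module (MvPolynomial (Fin n) ℂ) Q']
  [AddCommGroup M] [Module (MvPolynomial (Fin n) ℂ) M]
  (u₁ u₂ : Q →ₗ[MvPolynomial (Fin n) ℂ] Q')

variable (x) in
/-- The additive map `q ↦ x ⊗ u₁ q - 1 ⊗ u₂ q`. -/
def diffAux : Q →+ AdjoinVar x Q' :=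
  (single x 1).comp u₁.toAddMonoidHom - (single x 0).comp u₂.toAddMonoidHom

lemma diffAux_apply (q : Q) : diffAux x u₁ u₂ q = single x 1 (u₁ q) - single x 0 (u₂ q) := rfl

lemma diffAux_C_smul (c : ℂ) (q : Q) :
    diffAux x u₁ u₂ ((MvPolynomial.C c : MvPolynomial (Fin n) ℂ) • q) =
      (MvPolynomial.C c : MvPolynomial (Fin n) ℂ) • diffAux x u₁ u₂ q := by
  rw [diffAux_apply, diffAux_apply, smul_sub, C_smul_single, C_smul_single, map_smul u₁, map_smul u₂]

lemma diffAux_X_smul (i : Fin n) (hi : i ≠ x) (q : Q) :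
    diffAux x u₁ u₂ ((MvPolynomial.X i : MvPolynomial (Fin n) ℂ) • q) =
      (MvPolynomial.X i : MvPolynomial (Fin n) ℂ) • diffAux x u₁ u₂ q := by
  rw [diffAux_apply, diffAux_apply, smul_sub, X_smul_single_of_ne hi, X_smul_single_of_ne hi,
    map_smul u₁, map_smul u₂]

variable (x) in
/-- The map `x ⊗ u₁ - 1 ⊗ u₂ : Q[x] → Q'[x]`. -/
def diff : AdjoinVar x Q →ₗ[MvPolynomial (Fin n) ℂ] AdjoinVar x Q' :=
  lift (diffAux x u₁ u₂) (diffAux_C_smul u₁ u₂) (diffAux_X_smul u₁ u₂)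

lemma diff_single (k : ℕ) (q : Q) :
    diff x u₁ u₂ (single x k q) = single x (k + 1) (u₁ q) - single x k (u₂ q) := by
  rw [diff, lift_single, diffAux_apply, smul_sub, X_pow_smul_single, X_pow_smul_single, zero_add,
    add_comm 1 k]

lemma coeff_succ_diff (f : AdjoinVar x Q) (k : ℕ) :
    coeff (k + 1) (diff x u₁ u₂ f) = u₁ (coeff k f) - u₂ (coeff (k + 1) f) := by
  induction f using induction_on with
  | add f g hf hg => rw [map_add, map_add, map_add, map_add, map_add, map_add, hf, hg]; abel
  | h l q =>
    rw [diff_single, map_sub, coeff_single, coeff_single, coeff_single, coeff_single]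
    simp only [add_left_inj]
    split_ifs <;> simp

/-- The leading coefficient shows that `x ⊗ u₁ - 1 ⊗ u₂` is injective if `u₁` is. -/
lemma diff_injective (h : Function.Injective u₁) : Function.Injective (diff x u₁ u₂) := by
  rw [injective_iff_map_eq_zero]
  intro f hf
  obtain ⟨N, hN⟩ := f.exists_coeff_eq_zero
  -- Descending induction on `k`, starting at the degree bound `N`.
  have key : ∀ m k, N ≤ k + m → coeff k f = 0 := by
    intro m
    induction m with
    | zero => exact hN
    | succ m ih =>
      intro k hk
      have := coeff_succ_diff u₁ u₂ f k
      rw [hf, ih (k + 1) (by omega), map_zero, map_zero, sub_zero] at this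
      exact h (this.symm.trans (map_zero _).symm)
  exact ext fun k => (key N k (by omega)).trans (map_zero _).symm

/-- The sequence `Q[x] → Q'[x] → M` is exact if the top coefficient of each element of the kernel
of `Q'[x] → M` comes from `Q`: one can lower the degree. -/
lemma diff_exact (j : Q' →+ M) (hC) (hX) (hj : Function.Injective j)
    (hu : ∀ q, (MvPolynomial.X x : MvPolynomial (Fin n) ℂ) • j (u₁ q) = j (u₂ q))
    (htop : ∀ (k : ℕ) (f : AdjoinVar x Q'), (∀ l, k < l → coeff l f = 0) →
      lift (x := x) j hC hX f = 0 → ∃ q, u₁ q = coeff k f) (f : AdjoinVar x Q') :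
    lift (x := x) j hC hX f = 0 ↔ ∃ g, diff x u₁ u₂ g = f := by
  have hcomp : ∀ g, lift (x := x) j hC hX (diff x u₁ u₂ g) = 0 := by
    intro g
    induction g using induction_on with
    | add f g hf hg => rw [map_add, map_add, hf, hg, add_zero]
    | h k q =>
      rw [diff_single, map_sub, lift_single, lift_single, pow_succ, mul_smul, hu, sub_self]
  refine ⟨fun hf => ?_, by rintro ⟨g, rfl⟩; exact hcomp g⟩
  obtain ⟨N, hN⟩ := f.exists_coeff_eq_zero
  have key : ∀ N (f : AdjoinVar x Q'), (∀ k, N < k → coeff k f = 0) →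
      lift (x := x) j hC hX f = 0 → ∃ g, diff x u₁ u₂ g = f := by
    intro N
    induction N with
    | zero =>
      intro f hN hf
      have h0 := f.eq_sum_single (N := 1) (fun k hk => hN k (by omega))
      rw [Finset.sum_range_one] at h0
      rw [h0, lift_single, pow_zero, one_smul] at hf
      rw [h0, hj (hf.trans (map_zero _).symm)]
      exact ⟨0, by rw [map_zero, map_zero]⟩
    | succ N ih =>
      intro f hN hf
      obtain ⟨q, hq⟩ := htop _ f hN hf
      -- Here `diff (q x^N) = u₁ q x^(N+1) - u₂ q x^N` has the same leading term as `f`.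
      obtain ⟨g, hg⟩ := ih (f - diff x u₁ u₂ (single x N q)) (fun k hk => by
          rw [map_sub, diff_single, map_sub, coeff_single, coeff_single_of_ne (by omega), sub_zero]
          split_ifs with h
          · rw [hq, h, sub_self]
          · rw [hN k (by omega), sub_zero])
        (by rw [map_sub, hf, hcomp, sub_zero])
      exact ⟨g + single x N q, by rw [map_add, hg, sub_add_cancel]⟩
  exact key N f (fun k hk => hN k hk.le) hf

end KoszulResolution

section Truncation

variable (x) in
/-- The polynomial of degree less than `N` with given coefficients. -/
def ofCoeffs (N : ℕ) : (Fin N → P) →+ AdjoinVar x P where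
  toFun v := ∑ k : Fin N, single x k (v k)
  map_zero' := Finset.sum_eq_zero fun _ _ => map_zero _
  map_add' v w := by simp only [Pi.add_apply, map_add, Finset.sum_add_distrib]

/-- The coefficients of `xᵏ` for `k < N`. -/
def coeffs (N : ℕ) : AdjoinVar x P →+ (Fin N → P) where
  toFun f k := coeff k f
  map_zero' := funext fun _ => map_zero _
  map_add' f g := funext fun _ => map_add _ f g

lemma ofCoeffs_smul (hP : ∀ p : P, (MvPolynomial.X x : MvPolynomial (Fin n) ℂ) • p = 0) (N : ℕ)
    (s : MvPolynomial (Fin n) ℂ) (v : Fin N → P) :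
    ofCoeffs x N (s • v) = killVar x s • ofCoeffs x N v := by
  change ∑ k : Fin N, single x (k : ℕ) (s • v k) = killVar x s • ∑ k : Fin N, single x (k : ℕ) (v k)
  rw [Finset.smul_sum]
  refine Finset.sum_congr rfl fun k _ => ?_
  rw [killVar_smul_single, killVar_smul x hP]

lemma coeffs_killVar_smul (hP : ∀ p : P, (MvPolynomial.X x : MvPolynomial (Fin n) ℂ) • p = 0)
    (N : ℕ) (s : MvPolynomial (Fin n) ℂ) (f : AdjoinVar x P) :
    coeffs N (killVar x s • f) = s • coeffs N f :=
  funext fun k => coeff_killVar_smul hP s f k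

lemma ofCoeffs_coeffs {N : ℕ} {f : AdjoinVar x P} (hf : ∀ k, N ≤ k → coeff k f = 0) :
    ofCoeffs x N (coeffs N f) = f := by
  conv_rhs => rw [f.eq_sum_single hf, ← Fin.sum_univ_eq_sum_range (fun k => single x k (coeff k f))]
  rfl

lemma coeff_ofCoeffs {N : ℕ} (v : Fin N → P) {k : ℕ} (hk : N ≤ k) :
    coeff k (ofCoeffs x N v) = 0 := by
  change coeff k (∑ k : Fin N, single x (k : ℕ) (v k)) = 0
  rw [map_sum]
  exact Finset.sum_eq_zero fun l _ => coeff_single_of_ne (by omega) _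

lemma coeffs_ofCoeffs {N : ℕ} (v : Fin N → P) : coeffs N (ofCoeffs x N v) = v := by
  funext k
  change coeff k (∑ k : Fin N, single x (k : ℕ) (v k)) = v k
  simp only [map_sum, coeff_single, Fin.val_inj, Finset.sum_ite_eq', Finset.mem_univ, if_true]

end Truncation

end AdjoinVar

namespace GrMod

variable {D : Type} [AddCommGroup D] {n : ℕ} {deg : Fin n → D} {x : Fin n}

lemma killedBy_adjoin {J : Finset (Fin n)} (hx : x ∉ J) {P : GrMod deg}
    (hP : KilledBy (linearPrime (insert x J)) P)
    (hP' : ∀ p : P, (MvPolynomial.X x : MvPolynomial (Fin n) ℂ) • p = 0) :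
    KilledBy (linearPrime J) (adjoin x P hP') := by
  rw [killedBy_linearPrime_iff] at hP ⊢
  intro i hi f
  have hix : i ≠ x := fun h => hx (h ▸ hi)
  refine AdjoinVar.ext (x := x) fun k => ?_
  have := AdjoinVar.coeff_killVar_smul hP' (MvPolynomial.X i) f k
  rw [killVar_X_of_ne x hix] at this
  exact this.trans ((hP i (Finset.mem_insert_of_mem hi) _).trans (map_zero (AdjoinVar.coeff k)).symm)

lemma X_smul_primeQuot_insert (J : Finset (Fin n)) (a : D) (p : primeQuot deg (insert x J) a) :
    (MvPolynomial.X x : MvPolynomial (Fin n) ℂ) • p = 0 :=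
  killedBy_linearPrime_iff.mp (killedBy_primeQuot _ a) x (Finset.mem_insert_self _ _) p

/-- If `A` is a polynomial ring, then `A ⊗ ℂ[x]` is a polynomial ring in one more variable. -/
lemma exists_bijective_primeQuot_adjoin {J : Finset (Fin n)} (hx : x ∉ J) (a : D) :
    ∃ φ : primeQuot deg J a ⟶ adjoin x (primeQuot deg (insert x J) a)
      (X_smul_primeQuot_insert J a), Function.Bijective φ.toLin := by
  have hm : (show adjoin x (primeQuot deg (insert x J) a) (X_smul_primeQuot_insert J a) from
      AdjoinVar.single x 0 (show primeQuot deg (insert x J) a from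
        (linearPrime (insert x J)).mkQ (1 : MvPolynomial (Fin n) ℂ))) ∈
      (adjoin x (primeQuot deg (insert x J) a) (X_smul_primeQuot_insert J a)).gr (-a) :=
    single_mem_adjoin_gr (by
      rw [zero_smul, sub_zero]; exact one_mem_primeQuot_gr _ _)
  have hsmul : ∀ s : MvPolynomial (Fin n) ℂ,
      s • (show primeQuot deg (insert x J) a from
        (linearPrime (insert x J)).mkQ (1 : MvPolynomial (Fin n) ℂ)) =
        (linearPrime (insert x J)).mkQ s := fun s => by
    change (linearPrime (insert x J)).mkQ (s * 1) = _
    rw [mul_one]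
  refine ⟨fromPrimeQuot J _ (killedBy_adjoin hx (killedBy_primeQuot _ a) _) a hm, ?_, ?_⟩
  · rw [injective_iff_map_eq_zero]
    intro s hs
    obtain ⟨s, rfl⟩ := (linearPrime J).mkQ_surjective s
    refine (Submodule.Quotient.mk_eq_zero (linearPrime J)).mpr
      (mem_linearPrime_of_coeff x fun k => ?_)
    have h := AdjoinVar.coeff_smul_single_zero (x := x) s k (show primeQuot deg (insert x J) a from
        (linearPrime (insert x J)).mkQ (1 : MvPolynomial (Fin n) ℂ))
    rw [hsmul] at h
    refine (Submodule.Quotient.mk_eq_zero (linearPrime (insert x J))).mp (h.symm.trans ?_)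
    refine Eq.trans ?_ (map_zero (AdjoinVar.coeff (x := x) k))
    exact congrArg _ hs
  · intro f
    rw [← LinearMap.mem_range]
    change AdjoinVar x (primeQuot deg (insert x J) a) at f
    induction f using AdjoinVar.induction_on with
    | add f g hf hg => exact add_mem hf hg
    | h k q =>
      obtain ⟨s, rfl⟩ := (linearPrime (insert x J)).mkQ_surjective q
      refine ⟨(linearPrime J).mkQ (MvPolynomial.X x ^ k * killVar x s), ?_⟩
      rw [fromPrimeQuot_mk, mul_smul]
      refine (congrArg _ (AdjoinVar.killVar_smul_single s 0 _)).trans ?_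
      refine (AdjoinVar.X_pow_smul_single k 0 _).trans ?_
      rw [killVar_smul x (X_smul_primeQuot_insert J a), zero_add, hsmul]

section Truncation

variable (P : GrMod deg) (hP : ∀ p : P, (MvPolynomial.X x : MvPolynomial (Fin n) ℂ) • p = 0)

variable (x) in
/-- The module of coefficients of polynomials in `x` of degree less than `N`. The twists make the
coefficient vector of a homogeneous polynomial homogeneous of the same degree. -/
def coeffModule (N : ℕ) : GrMod deg := pi fun k : Fin N => P.twist (-((k : ℕ) • deg x))

/-- The polynomial of degree less than `N` with given coefficients, as an element of the
multigraded module `P[x]`. -/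
def ofCoeffs (N : ℕ) : coeffModule x P N →+ adjoin x P hP :=
  (AdjoinVar.ofCoeffs x N : (Fin N → P) →+ AdjoinVar x P)

/-- The coefficients of `xᵏ` for `k < N`, as an element of a multigraded module. -/
def coeffs (N : ℕ) : adjoin x P hP →+ coeffModule x P N :=
  (AdjoinVar.coeffs N : AdjoinVar x P →+ (Fin N → P))

lemma ofCoeffs_mem_gr {N : ℕ} {a : D} {v : coeffModule x P N}
    (hv : v ∈ (coeffModule x P N).gr a) : ofCoeffs P hP N v ∈ (adjoin x P hP).gr a := by
  change (∑ k : Fin N, (show adjoin x P hP from AdjoinVar.single x k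
    ((show Fin N → P from v) k))) ∈ (adjoin x P hP).gr a
  refine sum_mem fun k _ => single_mem_adjoin_gr ?_
  rw [sub_eq_neg_add]
  exact hv k trivial

lemma coeffs_mem_gr {N : ℕ} {a : D} {f : adjoin x P hP} (hf : f ∈ (adjoin x P hP).gr a) :
    coeffs P hP N f ∈ (coeffModule x P N).gr a := by
  intro k _
  have := mem_adjoin_gr.mp hf k
  rw [sub_eq_neg_add] at this
  exact this

lemma ofCoeffs_smul (N : ℕ) (s : MvPolynomial (Fin n) ℂ) (v : coeffModule x P N) :
    ofCoeffs P hP N (s • v) = killVar x s • ofCoeffs P hP N v :=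
  AdjoinVar.ofCoeffs_smul hP N s v

lemma coeffs_killVar_smul (N : ℕ) (s : MvPolynomial (Fin n) ℂ) (f : adjoin x P hP) :
    coeffs P hP N (killVar x s • f) = s • coeffs P hP N f :=
  AdjoinVar.coeffs_killVar_smul hP N s f

lemma coeffs_ofCoeffs (N : ℕ) (v : coeffModule x P N) :
    coeffs P hP N (ofCoeffs P hP N v) = v :=
  AdjoinVar.coeffs_ofCoeffs (P := P) (x := x) (N := N) v

lemma ofCoeffs_injective (N : ℕ) : Function.Injective (ofCoeffs (x := x) P hP N) :=
  Function.LeftInverse.injective (coeffs_ofCoeffs P hP N)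

variable (W : Submodule (MvPolynomial (Fin n) ℂ) (adjoin x P hP))

/-- The elements of degree less than `N` in `x` of a submodule `W` of `P[x]`; the action of `x`
is zero. -/
def truncSubmodule (N : ℕ) : Submodule (MvPolynomial (Fin n) ℂ) (coeffModule x P N) where
  carrier := {v | ofCoeffs P hP N v ∈ W}
  zero_mem' := by
    change ofCoeffs P hP N 0 ∈ W
    rw [map_zero]
    exact zero_mem W
  add_mem' {v w} hv hw := by
    change ofCoeffs P hP N (v + w) ∈ W
    rw [map_add]
    exact add_mem hv hw
  smul_mem' s v hv := by
    change ofCoeffs P hP N (s • v) ∈ W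
    rw [ofCoeffs_smul]
    exact W.smul_mem _ hv

variable {W} (hW : (adjoin x P hP).IsHomog W)

include hW in
lemma isHomog_truncSubmodule (N : ℕ) :
    (coeffModule x P N).IsHomog (truncSubmodule P hP W N) := by
  intro f hf h a
  have := hW (f.mapRange (ofCoeffs P hP N) (map_zero _)) (fun a => by
    rw [Finsupp.mapRange_apply]
    exact ofCoeffs_mem_gr P hP (hf a)) (by
    rw [Finsupp.sum_mapRange_index (fun _ => rfl)]
    have h : ofCoeffs P hP N (f.sum fun _ m => m) ∈ W := h
    rwa [map_finsuppSum] at h) a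
  rw [Finsupp.mapRange_apply] at this
  exact this

/-- The elements of degree less than `N` in `x` of a homogeneous submodule `W` of `P[x]`. -/
def trunc (N : ℕ) : GrMod deg :=
  (coeffModule x P N).sub (truncSubmodule P hP W N) (isHomog_truncSubmodule P hP hW N)

/-- The inclusion of the elements of degree less than `N` into `W`. It is linear over the polynomial
ring in the variables other than `x`, but not over `S`. -/
def truncι (N : ℕ) : trunc P hP hW N →+ (adjoin x P hP).sub W hW :=
  ((ofCoeffs P hP N).comp (truncSubmodule P hP W N).subtype.toAddMonoidHom).codRestrict
    W.toAddSubgroup.toAddSubmonoid fun v => v.2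

lemma truncι_injective (N : ℕ) : Function.Injective (truncι P hP hW N) := fun _ _ h =>
  Subtype.ext (ofCoeffs_injective P hP N (congrArg Subtype.val h))

end Truncation

end GrMod

/-! ### Generation of the modules annihilated by a monomial prime -/

namespace GrMod

variable {D : Type} [AddCommGroup D] {n : ℕ} {deg : Fin n → D} {x : Fin n}

section Truncation

variable (P : GrMod deg) (hP : ∀ p : P, (MvPolynomial.X x : MvPolynomial (Fin n) ℂ) • p = 0)
  {W : Submodule (MvPolynomial (Fin n) ℂ) (adjoin x P hP)} (hW : (adjoin x P hP).IsHomog W)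

lemma ofCoeffs_coeffs {N : ℕ} {f : adjoin x P hP}
    (hf : ∀ k, N ≤ k → AdjoinVar.coeff (x := x) (P := P) k f = 0) :
    ofCoeffs P hP N (coeffs P hP N f) = f :=
  AdjoinVar.ofCoeffs_coeffs hf

lemma coeff_ofCoeffs {N : ℕ} (v : coeffModule x P N) {k : ℕ} (hk : N ≤ k) :
    AdjoinVar.coeff (x := x) (P := P) k (ofCoeffs P hP N v) = 0 :=
  AdjoinVar.coeff_ofCoeffs (P := P) (x := x) (N := N) v hk

lemma coeff_X_pow_smul (l k : ℕ) (f : adjoin x P hP) :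
    AdjoinVar.coeff (x := x) (P := P) k
        ((MvPolynomial.X x ^ l : MvPolynomial (Fin n) ℂ) • f : adjoin x P hP) =
      if l ≤ k then AdjoinVar.coeff (x := x) (P := P) (k - l) f else 0 :=
  AdjoinVar.coeff_X_pow_smul l k f

lemma ofCoeffs_coeffs_X_pow_smul (N : ℕ) {l : ℕ} (hl : l ≤ 1) (v : coeffModule x P N) :
    ofCoeffs P hP (N + 1) (coeffs P hP (N + 1)
      ((MvPolynomial.X x ^ l : MvPolynomial (Fin n) ℂ) • ofCoeffs P hP N v)) =
      (MvPolynomial.X x ^ l : MvPolynomial (Fin n) ℂ) • ofCoeffs P hP N v := by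
  refine ofCoeffs_coeffs P hP fun k hk => ?_
  rw [coeff_X_pow_smul, if_pos (by omega)]
  exact coeff_ofCoeffs P hP v (by omega)

/-- Multiplication by `1` or `x`, from elements of degree less than `N` to elements of degree
less than `N + 1`. -/
def truncMul (N : ℕ) {l : ℕ} (hl : l ≤ 1) :
    trunc P hP hW N →ₗ[MvPolynomial (Fin n) ℂ] trunc P hP hW (N + 1) where
  toFun v := ⟨coeffs P hP (N + 1)
    ((MvPolynomial.X x ^ l : MvPolynomial (Fin n) ℂ) • ofCoeffs P hP N v.1), by
      change ofCoeffs P hP (N + 1) _ ∈ W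
      rw [ofCoeffs_coeffs_X_pow_smul P hP N hl]
      exact W.smul_mem _ v.2⟩
  map_add' v w := Subtype.ext (by
    change coeffs P hP (N + 1) (_ • ofCoeffs P hP N (v.1 + w.1)) = _
    rw [map_add, smul_add, map_add]
    rfl)
  map_smul' s v := Subtype.ext (by
    change coeffs P hP (N + 1) (_ • ofCoeffs P hP N (s • v.1)) = _
    rw [ofCoeffs_smul, smul_comm, coeffs_killVar_smul]
    rfl)

lemma truncι_truncMul (N : ℕ) {l : ℕ} (hl : l ≤ 1) (v : trunc P hP hW N) :
    truncι P hP hW (N + 1) (truncMul P hP hW N hl v) =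
      (MvPolynomial.X x ^ l : MvPolynomial (Fin n) ℂ) • truncι P hP hW N v :=
  Subtype.ext (ofCoeffs_coeffs_X_pow_smul P hP N hl v.1)

lemma X_smul_truncι_truncMul (N : ℕ) (v : trunc P hP hW N) :
    (MvPolynomial.X x : MvPolynomial (Fin n) ℂ) •
        truncι P hP hW (N + 1) (truncMul P hP hW N zero_le_one v) =
      truncι P hP hW (N + 1) (truncMul P hP hW N le_rfl v) := by
  rw [truncι_truncMul, truncι_truncMul, pow_zero, one_smul, pow_one]

lemma truncMul_mem_gr (N : ℕ) {l : ℕ} (hl : l ≤ 1) {a : D} {v : trunc P hP hW N}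
    (hv : v ∈ (trunc P hP hW N).gr a) :
    truncMul P hP hW N hl v ∈ (trunc P hP hW (N + 1)).gr (l • deg x + a) :=
  coeffs_mem_gr P hP ((adjoin x P hP).X_pow_smul_mem_gr x l (ofCoeffs_mem_gr P hP hv))

lemma truncMul_injective (N : ℕ) : Function.Injective (truncMul P hP hW N zero_le_one) := by
  intro v w h
  have := congrArg (truncι P hP hW (N + 1)) h
  rw [truncι_truncMul, truncι_truncMul, pow_zero, one_smul, one_smul] at this
  exact truncι_injective P hP hW N this

lemma truncι_C_smul (N : ℕ) (c : ℂ) (v : trunc P hP hW N) :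
    truncι P hP hW N ((MvPolynomial.C c : MvPolynomial (Fin n) ℂ) • v) =
      (MvPolynomial.C c : MvPolynomial (Fin n) ℂ) • truncι P hP hW N v := by
  refine Subtype.ext ((ofCoeffs_smul P hP N _ v.1).trans ?_)
  rw [killVar_C]
  rfl

lemma truncι_X_smul (N : ℕ) (i : Fin n) (hi : i ≠ x) (v : trunc P hP hW N) :
    truncι P hP hW N ((MvPolynomial.X i : MvPolynomial (Fin n) ℂ) • v) =
      (MvPolynomial.X i : MvPolynomial (Fin n) ℂ) • truncι P hP hW N v := by
  refine Subtype.ext ((ofCoeffs_smul P hP N _ v.1).trans ?_)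
  rw [killVar_X_of_ne x hi]
  rfl

lemma killedBy_trunc {I : Ideal (MvPolynomial (Fin n) ℂ)} (hI : KilledBy I P) (N : ℕ) :
    KilledBy I (trunc P hP hW N) := fun s hs v =>
  Subtype.ext (funext fun k => hI s hs ((show Fin N → P from v.1) k))

lemma X_smul_trunc (N : ℕ) (v : trunc P hP hW N) :
    (MvPolynomial.X x : MvPolynomial (Fin n) ℂ) • v = 0 :=
  Subtype.ext (funext fun k => hP ((show Fin N → P from v.1) k))

/-- The map `x ⊗ v - 1 ⊗ x v` from `W_{<N}(-deg x)[x]` to `W_{<N+1}[x]`. -/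
def truncDiff (N : ℕ) :
    adjoin x ((trunc P hP hW N).twist (-deg x)) (X_smul_trunc P hP hW N) ⟶
      adjoin x (trunc P hP hW (N + 1)) (X_smul_trunc P hP hW (N + 1)) :=
  adjoinLift (P := (trunc P hP hW N).twist (-deg x)) _
    (AdjoinVar.diffAux x (truncMul P hP hW N zero_le_one) (truncMul P hP hW N le_rfl))
    (AdjoinVar.diffAux_C_smul _ _) (AdjoinVar.diffAux_X_smul _ _) (fun a v hv => by
      refine sub_mem (single_mem_adjoin_gr ?_) (single_mem_adjoin_gr ?_)
      · have := truncMul_mem_gr P hP hW N zero_le_one hv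
        rw [zero_smul, zero_add] at this
        rw [one_smul, sub_eq_neg_add]
        exact this
      · have := truncMul_mem_gr P hP hW N le_rfl hv
        rw [one_smul, add_neg_cancel_left] at this
        rw [zero_smul, sub_zero]
        exact this)

/-- The multiplication map from `W_{<N}[x]` to `W`. -/
def truncEv (N : ℕ) :
    adjoin x (trunc P hP hW N) (X_smul_trunc P hP hW N) ⟶ (adjoin x P hP).sub W hW :=
  adjoinLift _ (truncι P hP hW N) (truncι_C_smul P hP hW N) (truncι_X_smul P hP hW N)
    (fun _ _ hv => ofCoeffs_mem_gr P hP hv)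

lemma mem_range_truncEv {N : ℕ} {w : (adjoin x P hP).sub W hW}
    (hw : ∀ k, N ≤ k → AdjoinVar.coeff (x := x) (P := P) k w.1 = 0) :
    w ∈ LinearMap.range (truncEv P hP hW N).toLin := by
  have h := ofCoeffs_coeffs P hP hw
  refine ⟨AdjoinVar.single x 0 (show trunc P hP hW N from ⟨coeffs P hP N w.1, ?_⟩), ?_⟩
  · change ofCoeffs P hP N _ ∈ W
    rw [h]
    exact w.2
  · refine (AdjoinVar.lift_single _ (truncι_C_smul P hP hW N) (truncι_X_smul P hP hW N) 0 _).trans ?_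
    rw [pow_zero, one_smul]
    exact Subtype.ext h

/-- The submodule `W` is generated by its elements of low degree in `x`. -/
lemma exists_truncEv_surjective :
    ∃ N, Function.Surjective (truncEv P hP hW (N + 1)).toLin := by
  classical
  obtain ⟨T, hT⟩ := (Module.finite_def (R := MvPolynomial (Fin n) ℂ)
    (M := (adjoin x P hP).sub W hW)).mp inferInstance
  choose N hN using fun w : (adjoin x P hP).sub W hW =>
    AdjoinVar.exists_coeff_eq_zero (x := x) (P := P) w.1
  refine ⟨T.sup N, LinearMap.range_eq_top.mp (eq_top_iff.mpr ?_)⟩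
  rw [← hT, Submodule.span_le]
  intro w hw
  exact mem_range_truncEv P hP hW fun k hk => hN w k (by
    have := Finset.le_sup (f := N) hw
    omega)

/-- A relation `∑ xˡ vₗ = 0` between elements `vₗ` of degree at most `N` forces the top
coefficient `vₖ` to have degree less than `N`. -/
lemma exists_truncMul_eq_top_coeff (N k : ℕ) (f : AdjoinVar x (trunc P hP hW (N + 1)))
    (hf : ∀ l, k < l → AdjoinVar.coeff l f = 0) (h0 : (truncEv P hP hW (N + 1)).toLin f = 0) :
    ∃ q, truncMul P hP hW N zero_le_one q = AdjoinVar.coeff k f := by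
  have hsum := f.eq_sum_single (N := k + 1) (fun l hl => hf l (by omega))
  have h1 : (truncEv P hP hW (N + 1)).toLin f = ∑ l ∈ Finset.range (k + 1),
      (MvPolynomial.X x ^ l : MvPolynomial (Fin n) ℂ) •
        truncι P hP hW (N + 1) (AdjoinVar.coeff l f) := by
    conv_lhs => rw [hsum]
    refine (map_sum (truncEv P hP hW (N + 1)).toLin _ _).trans ?_
    exact Finset.sum_congr rfl fun l _ => AdjoinVar.lift_single _
      (truncι_C_smul P hP hW _) (truncι_X_smul P hP hW _) l _
  have h2 : ∑ l ∈ Finset.range (k + 1), (MvPolynomial.X x ^ l : MvPolynomial (Fin n) ℂ) •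
      ofCoeffs P hP (N + 1) (AdjoinVar.coeff l f).1 = 0 :=
    (map_sum W.subtype (fun l => (MvPolynomial.X x ^ l : MvPolynomial (Fin n) ℂ) •
      truncι P hP hW (N + 1) (AdjoinVar.coeff l f)) _).symm.trans
        (congrArg W.subtype (h1.symm.trans h0))
  -- In the coefficient of `x^(k+N)` only the coefficient of `x^N` in `vₖ` contributes.
  have h3 := congrArg (AdjoinVar.coeff (x := x) (P := P) (k + N)) h2
  have h4 : AdjoinVar.coeff (x := x) (P := P) N
      (ofCoeffs P hP (N + 1) (AdjoinVar.coeff k f).1) = 0 := by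
    refine Eq.trans ?_ (h3.trans (map_zero (AdjoinVar.coeff (x := x) (P := P) (k + N))))
    refine Eq.trans ?_ (map_sum (AdjoinVar.coeff (x := x) (P := P) (k + N)) _ _).symm
    rw [Finset.sum_range_succ, Finset.sum_eq_zero, zero_add]
    · refine Eq.trans ?_ (coeff_X_pow_smul P hP k (k + N) _).symm
      rw [if_pos (by omega), Nat.add_sub_cancel_left]
    · intro l hl
      rw [Finset.mem_range] at hl
      refine (coeff_X_pow_smul P hP l (k + N) _).trans ?_
      rw [if_pos (by omega)]
      exact coeff_ofCoeffs P hP _ (by omega)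
  have h5 : ∀ l, N ≤ l → AdjoinVar.coeff (x := x) (P := P) l
      (ofCoeffs P hP (N + 1) (AdjoinVar.coeff k f).1) = 0 := by
    intro l hl
    rcases Nat.eq_or_lt_of_le hl with rfl | hl
    · exact h4
    · exact coeff_ofCoeffs P hP _ hl
  have h6 := ofCoeffs_coeffs P hP h5
  refine ⟨⟨coeffs P hP N (ofCoeffs P hP (N + 1) (AdjoinVar.coeff k f).1), ?_⟩,
    truncι_injective P hP hW (N + 1) ?_⟩
  · change ofCoeffs P hP N _ ∈ W
    rw [h6]
    exact (AdjoinVar.coeff k f).2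
  · refine (truncι_truncMul P hP hW N zero_le_one _).trans ?_
    rw [pow_zero, one_smul]
    exact Subtype.ext h6

/-- A submodule `W` of `P[x]` has the resolution
`0 ⟶ W_{<N}(-deg x)[x] ⟶ W_{<N+1}[x] ⟶ W ⟶ 0` if `N` is large. -/
lemma isSES_truncDiff_truncEv {N : ℕ} (hN : Function.Surjective (truncEv P hP hW (N + 1)).toLin) :
    IsSES (truncDiff P hP hW N) (truncEv P hP hW (N + 1)) where
  injective := AdjoinVar.diff_injective _ _ (truncMul_injective P hP hW N)
  surjective := hN
  exact := AdjoinVar.diff_exact _ _ _ (truncι_C_smul P hP hW _)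
    (truncι_X_smul P hP hW _) (truncι_injective P hP hW (N + 1))
    (X_smul_truncι_truncMul P hP hW N)
    (exists_truncMul_eq_top_coeff P hP hW N)

end Truncation

/-- The class of the modules `P` for which `P[x]` lies in a class with the two-out-of-three property
has this property too, since `P ↦ P[x]` is exact. -/
lemma IsTwoOfThree.adjoin {J : Finset (Fin n)} (hx : x ∉ J) {𝒞 : GrMod deg → Prop}
    (h : IsTwoOfThree (linearPrime J) 𝒞) :
    IsTwoOfThree (linearPrime (insert x J)) fun P : GrMod deg =>
      ∀ hP : ∀ p : P, (MvPolynomial.X x : MvPolynomial (Fin n) ℂ) • p = 0, 𝒞 (adjoin x P hP) where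
  left hfg hI hB hC hA :=
    have hXB := killedBy_linearPrime_iff.mp hI x (Finset.mem_insert_self _ _)
    have hXC := killedBy_linearPrime_iff.mp (hI.of_surjective hfg.surjective) x
      (Finset.mem_insert_self _ _)
    h.left (hfg.adjoin hA hXB hXC) (killedBy_adjoin hx hI hXB) (hB hXB) (hC hXC)
  middle hfg hI hA hC hXB :=
    have hXA := killedBy_linearPrime_iff.mp (hI.of_injective hfg.injective) x
      (Finset.mem_insert_self _ _)
    have hXC := killedBy_linearPrime_iff.mp (hI.of_surjective hfg.surjective) x
      (Finset.mem_insert_self _ _)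
    h.middle (hfg.adjoin hXA hXB hXC) (killedBy_adjoin hx hI hXB) (hA hXA) (hC hXC)
  right hfg hI hA hB hXC :=
    have hXB := killedBy_linearPrime_iff.mp hI x (Finset.mem_insert_self _ _)
    have hXA := killedBy_linearPrime_iff.mp (hI.of_injective hfg.injective) x
      (Finset.mem_insert_self _ _)
    h.right (hfg.adjoin hXA hXB hXC) (killedBy_adjoin hx hI hXB) (hA hXA) (hB hXB)

lemma linearPrime_univ_isMaximal :
    (linearPrime (Finset.univ : Finset (Fin n))).IsMaximal := by
  have : linearPrime (Finset.univ : Finset (Fin n)) =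
      RingHom.ker (MvPolynomial.constantCoeff (R := ℂ) (σ := Fin n)) := by
    refine le_antisymm ?_ fun p hp => ?_
    · rw [linearPrime, Ideal.span_le]
      rintro _ ⟨i, -, rfl⟩
      exact MvPolynomial.constantCoeff_X (R := ℂ) i
    · refine MvPolynomial.mem_ideal_span_X_image.mpr fun m hm => ?_
      by_contra! hm0
      obtain rfl : m = 0 := Finsupp.ext fun i => hm0 i (by simp)
      exact MvPolynomial.mem_support_iff.mp hm hp
  rw [this]
  exact RingHom.ker_isMaximal_of_surjective _ fun c => ⟨MvPolynomial.C c, by simp⟩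

/-- A class of modules with the two-out-of-three property that contains all `(S/𝔪)(a)`, where
`𝔪 = (xᵢ : i ∈ J)`, contains all modules annihilated by `𝔪`. For `J = ∅` this is a form of the
syzygy theorem: all multigraded modules are generated by free modules of rank one. -/
theorem IsTwoOfThree.of_killedBy_linearPrime (J : Finset (Fin n)) {𝒞 : GrMod deg → Prop}
    (h : IsTwoOfThree (linearPrime J) 𝒞) (hJ : ∀ a, 𝒞 (primeQuot deg J a)) (M : GrMod deg)
    (hM : KilledBy (linearPrime J) M) : 𝒞 M := by
  obtain ⟨k, hk⟩ : ∃ k, Jᶜ.card = k := ⟨_, rfl⟩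
  induction k generalizing J 𝒞 M with
  | zero =>
    obtain rfl : J = Finset.univ := by
      rwa [Finset.card_eq_zero, Finset.compl_eq_empty_iff] at hk
    -- The module `S/𝔪` is simple.
    refine h.of_primeQuot hJ (fun a K φ hφ => ?_) M hM
    have := linearPrime_univ_isMaximal (n := n)
    have hsimple : IsSimpleModule (MvPolynomial (Fin n) ℂ)
      (MvPolynomial (Fin n) ℂ ⧸ linearPrime (Finset.univ : Finset (Fin n))) :=
      isSimpleModule_iff_isCoatom.mpr this.out
    rcases hsimple.eq_bot_or_eq_top (LinearMap.range φ.toLin) with h1 | h1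
    · refine h.of_subsingleton (killedBy_primeQuot _ a) (hJ a) ⟨fun p q => hφ ?_⟩
      rw [LinearMap.range_eq_bot.mp h1]
      rfl
    · exact h.of_bijective' φ ⟨hφ, LinearMap.range_eq_top.mp h1⟩ (killedBy_primeQuot _ a) (hJ a)
  | succ k ih =>
    -- Let `x` be a variable not in `J`. By induction the class contains `P[x]` whenever `P` is
    -- annihilated by `𝔪` and `x`, and a submodule of `(S/𝔪)(a) = (S/(𝔪 + x))(a)[x]` has a resolution
    -- by two such modules.
    obtain ⟨x, hx⟩ : Jᶜ.Nonempty := by rw [← Finset.card_pos]; omega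
    have hx' : x ∉ J := Finset.mem_compl.mp hx
    have hadj := ih (insert x J) (h.adjoin hx') (fun a hP => by
        obtain ⟨φ, hφ⟩ := exists_bijective_primeQuot_adjoin (deg := deg) hx' a
        exact h.of_bijective φ hφ (killedBy_adjoin hx' (killedBy_primeQuot _ a) _) (hJ a))
    have hcard : (insert x J)ᶜ.card = k := by
      rw [Finset.compl_insert, Finset.card_erase_of_mem hx, hk, Nat.add_sub_cancel]
    refine h.of_primeQuot hJ (fun a K φ hφ => ?_) M hM
    obtain ⟨θ, hθ⟩ := exists_bijective_primeQuot_adjoin (deg := deg) hx' a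
    have hP := X_smul_primeQuot_insert (deg := deg) (x := x) J a
    have hPI := killedBy_primeQuot (deg := deg) (insert x J) a
    have hψ : Function.Injective (φ ≫ θ).toLin := hθ.1.comp hφ
    have hW := isHomog_range (φ ≫ θ)
    have hI := killedBy_adjoin hx' hPI hP
    refine h.of_bijective' (subLift _ hW (φ ≫ θ) fun p => ⟨p, rfl⟩)
      ⟨fun p q hpq => hψ (congrArg Subtype.val hpq), by
        rintro ⟨_, p, rfl⟩
        exact ⟨p, rfl⟩⟩ (hI.of_injective (isSES_sub_quot _ _ hW).injective) ?_
    obtain ⟨N, hN⟩ := exists_truncEv_surjective _ hP hW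
    have hT := killedBy_trunc _ hP hW hPI
    exact h.right (isSES_truncDiff_truncEv _ hP hW hN) (killedBy_adjoin hx' (hT _) _)
      (hadj ((trunc _ hP hW N).twist (-deg x)) (hT N) hcard _) (hadj _ (hT (N + 1)) hcard _)

end GrMod

/-! ### The Koszul complex of functions on all index sets -/

namespace Koszul

open MvPolynomial

variable {n : ℕ}

local notation "S" => MvPolynomial (Fin n) ℂ

/-- The sign `(-1)^#{i ∈ I | i < j}` with which the index `j` enters in the Koszul differential at
`I`. -/
def sgn (I : Finset (Fin n)) (j : Fin n) : S := (-1) ^ (I.filter (· < j)).card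

lemma sgn_mul_self (I : Finset (Fin n)) (j : Fin n) : sgn I j * sgn I j = 1 := by
  rw [sgn, ← mul_pow, neg_one_mul, neg_neg, one_pow]

lemma sgn_erase_self (I : Finset (Fin n)) (j : Fin n) : sgn (I.erase j) j = sgn I j := by
  rw [sgn, sgn, Finset.filter_erase, Finset.erase_eq_of_notMem (by simp)]

lemma sgn_insert_self (I : Finset (Fin n)) (j : Fin n) : sgn (insert j I) j = sgn I j := by
  rw [sgn, sgn, Finset.filter_insert, if_neg (lt_irrefl j)]

/-- Inserting `j` and removing `k` anticommute. -/
lemma sgn_mul_sgn_insert {I : Finset (Fin n)} {j k : Fin n} (hj : j ∉ I) (hk : k ∈ I) :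
    sgn I j * sgn (insert j I) k = -(sgn I k * sgn (I.erase k) j) := by
  have hjk : j ≠ k := fun h => hj (h ▸ hk)
  obtain ⟨I, hkI, rfl⟩ : ∃ I', k ∉ I' ∧ insert k I' = I :=
    ⟨I.erase k, Finset.notMem_erase _ _, Finset.insert_erase hk⟩
  rw [Finset.mem_insert, not_or] at hj
  rw [Finset.insert_comm, sgn_insert_self, sgn_insert_self, Finset.erase_insert hkI]
  rcases lt_or_gt_of_ne hjk with h | h
  · have h1 : sgn (insert k I) j = sgn I j := by
      rw [sgn, sgn, Finset.filter_insert, if_neg h.not_gt]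
    have h2 : sgn (insert j I) k = -sgn I k := by
      rw [sgn, sgn, Finset.filter_insert, if_pos h,
        Finset.card_insert_of_notMem (by simp [hj.2]), pow_succ, mul_neg_one]
    rw [h1, h2]
    ring
  · have h1 : sgn (insert k I) j = -sgn I j := by
      rw [sgn, sgn, Finset.filter_insert, if_pos h,
        Finset.card_insert_of_notMem (by simp [hkI]), pow_succ, mul_neg_one]
    have h2 : sgn (insert j I) k = sgn I k := by
      rw [sgn, sgn, Finset.filter_insert, if_neg h.not_gt]
    rw [h1, h2]
    ring

/-- The Koszul differential of the variables `xⱼ`, `j ∈ J`, on functions on all sets of indices. A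
function `f` stands for the form `∑ f(I) dx_I`, and the differential is the contraction with the
Euler vector field of these variables. -/
def diff (J : Finset (Fin n)) (f : Finset (Fin n) → S) (I : Finset (Fin n)) : S :=
  ∑ j ∈ J \ I, sgn I j * X j * f (insert j I)

/-- The exterior derivative of the form `∑ f(I) dx_I`. -/
def extDeriv (f : Finset (Fin n) → S) (I : Finset (Fin n)) : S :=
  ∑ k ∈ I, sgn I k * pderiv k (f (I.erase k))

/-- The Euler operator `∑ xⱼ ∂/∂xⱼ` of the variables `xⱼ`, `j ∈ J`. -/
def euler (J : Finset (Fin n)) (p : S) : S := ∑ j ∈ J, X j * pderiv j p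

lemma pderiv_sgn_mul (I : Finset (Fin n)) (j k : Fin n) (p : S) :
    pderiv k (sgn I j * p) = sgn I j * pderiv k p := by
  rcases neg_one_pow_eq_or S (I.filter (· < j)).card with h | h <;> rw [sgn, h] <;> simp

lemma diff_extDeriv (J : Finset (Fin n)) (f : Finset (Fin n) → S) (I : Finset (Fin n)) :
    diff J (extDeriv f) I = (∑ j ∈ J \ I, X j * pderiv j (f I)) +
      ∑ j ∈ J \ I, ∑ k ∈ I,
        sgn I j * sgn (insert j I) k * (X j * pderiv k (f (insert j (I.erase k)))) := by
  rw [diff, ← Finset.sum_add_distrib]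
  refine Finset.sum_congr rfl fun j hj => ?_
  have hjI := (Finset.mem_sdiff.mp hj).2
  rw [extDeriv, Finset.sum_insert hjI, mul_add, Finset.mul_sum, Finset.erase_insert hjI,
    sgn_insert_self]
  refine congrArg₂ _ ?_ (Finset.sum_congr rfl fun k hk => ?_)
  · rw [mul_mul_mul_comm, mul_comm (sgn I j), mul_assoc, mul_left_comm (sgn I j),
      ← mul_assoc (sgn I j), sgn_mul_self, one_mul]
  · have hjk : j ≠ k := fun h => hjI (h ▸ hk)
    rw [Finset.erase_insert_of_ne hjk]
    exact mul_mul_mul_comm _ _ _ _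

lemma extDeriv_diff {J I : Finset (Fin n)} (hI : I ⊆ J) (f : Finset (Fin n) → S) :
    extDeriv (diff J f) I = (∑ k ∈ I, (f I + X k * pderiv k (f I))) +
      ∑ k ∈ I, ∑ j ∈ J \ I,
        sgn I k * sgn (I.erase k) j * (X j * pderiv k (f (insert j (I.erase k)))) := by
  rw [extDeriv, ← Finset.sum_add_distrib]
  refine Finset.sum_congr rfl fun k hk => ?_
  have hJ : J \ I.erase k = insert k (J \ I) := Finset.sdiff_erase (hI hk)
  rw [diff, hJ, Finset.sum_insert (by simp [hk]), Finset.insert_erase hk, map_add, mul_add,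
    map_sum, Finset.mul_sum, sgn_erase_self, mul_assoc, pderiv_sgn_mul, Derivation.leibniz,
    pderiv_X_self, ← mul_assoc, sgn_mul_self, one_mul, smul_eq_mul, smul_eq_mul, mul_one]
  refine congrArg₂ _ (add_comm _ _) (Finset.sum_congr rfl fun j hj => ?_)
  have hjk : j ≠ k := fun h => (Finset.mem_sdiff.mp hj).2 (h ▸ hk)
  rw [mul_assoc, pderiv_sgn_mul, Derivation.leibniz, pderiv_X_of_ne hjk, smul_zero, add_zero,
    smul_eq_mul, ← mul_assoc (sgn I k)]

/-- Cartan's formula for the Lie derivative along the Euler vector field: on the coefficient of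
`dx_I` it is the Euler operator plus the number of elements of `I`. -/
lemma diff_extDeriv_add_extDeriv_diff {J : Finset (Fin n)} (f : Finset (Fin n) → S)
    {I : Finset (Fin n)} (hI : I ⊆ J) :
    diff J (extDeriv f) I + extDeriv (diff J f) I = euler J (f I) + (I.card : S) * f I := by
  have h3 : (∑ j ∈ J \ I, ∑ k ∈ I,
        sgn I j * sgn (insert j I) k * (X j * pderiv k (f (insert j (I.erase k))))) +
      ∑ k ∈ I, ∑ j ∈ J \ I,
        sgn I k * sgn (I.erase k) j * (X j * pderiv k (f (insert j (I.erase k)))) = 0 := by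
    rw [Finset.sum_comm, ← Finset.sum_add_distrib]
    refine Finset.sum_eq_zero fun k hk => ?_
    rw [← Finset.sum_add_distrib]
    refine Finset.sum_eq_zero fun j hj => ?_
    rw [sgn_mul_sgn_insert (Finset.mem_sdiff.mp hj).2 hk, neg_mul, neg_add_cancel]
  have h4 : euler J (f I) = (∑ j ∈ J \ I, X j * pderiv j (f I)) +
      ∑ k ∈ I, X k * pderiv k (f I) := (Finset.sum_sdiff hI).symm
  rw [diff_extDeriv, extDeriv_diff hI, add_add_add_comm, h3, add_zero, h4,
    Finset.sum_add_distrib, Finset.sum_const, nsmul_eq_mul]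
  abel

/-- The inverse of the operator `euler J + c`: it divides each monomial by the sum of `c` and its
degree in the variables `xⱼ`, `j ∈ J`. -/
def eulerInv (J : Finset (Fin n)) (c : ℕ) : S →ₗ[ℂ] S :=
  (basisMonomials (Fin n) ℂ).constr ℂ fun m => monomial m ((∑ j ∈ J, m j + c : ℕ) : ℂ)⁻¹

lemma eulerInv_monomial (J : Finset (Fin n)) (c : ℕ) (m : Fin n →₀ ℕ) (a : ℂ) :
    eulerInv J c (monomial m a) = monomial m (a * ((∑ j ∈ J, m j + c : ℕ) : ℂ)⁻¹) := by
  have h : monomial m a = a • basisMonomials (Fin n) ℂ m := by simp [smul_monomial]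
  rw [h, map_smul, eulerInv, Module.Basis.constr_basis, smul_monomial, smul_eq_mul]

/-- Multiplication by `xⱼ` raises the degree by one, which the constant `c` makes up for. -/
lemma X_mul_eulerInv {J : Finset (Fin n)} {j : Fin n} (hj : j ∈ J) (c : ℕ) (p : S) :
    X j * eulerInv J (c + 1) p = eulerInv J c (X j * p) := by
  induction p using MvPolynomial.induction_on' with
  | monomial m a =>
    rw [eulerInv_monomial, X, monomial_mul, monomial_mul, eulerInv_monomial, one_mul, one_mul]
    congr 4
    simp only [Finsupp.add_apply, Finset.sum_add_distrib]
    rw [Finset.sum_eq_single_of_mem j hj fun b _ hb => Finsupp.single_eq_of_ne hb,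
      Finsupp.single_eq_same]
    ring
  | add p q hp hq => rw [map_add, mul_add, hp, hq, mul_add, map_add]

lemma euler_add (J : Finset (Fin n)) (p q : S) : euler J (p + q) = euler J p + euler J q := by
  simp only [euler, map_add, mul_add, Finset.sum_add_distrib]

lemma euler_monomial (J : Finset (Fin n)) (m : Fin n →₀ ℕ) (a : ℂ) :
    euler J (monomial m a) = ((∑ j ∈ J, m j : ℕ) : S) * monomial m a := by
  simp only [euler, X_mul_pderiv_monomial, nsmul_eq_mul, Nat.cast_sum, Finset.sum_mul]

lemma euler_eulerInv (J : Finset (Fin n)) {c : ℕ} (hc : c ≠ 0) (p : S) :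
    euler J (eulerInv J c p) + (c : S) * eulerInv J c p = p := by
  induction p using MvPolynomial.induction_on' with
  | monomial m a =>
    have h : ((∑ j ∈ J, m j + c : ℕ) : ℂ) ≠ 0 := Nat.cast_ne_zero.mpr (by omega)
    rw [eulerInv_monomial, euler_monomial, ← add_mul, ← Nat.cast_add, ← nsmul_eq_mul,
      smul_monomial, nsmul_eq_mul]
    congr 1
    field_simp
  | add p q hp hq =>
    rw [map_add, euler_add, mul_add]
    linear_combination hp + hq

/-- The complex of all functions is exact at the sets with `c ≠ 0` elements: a cycle is the
differential of the exterior derivative of its image under the inverse of `euler J + c`. -/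
lemma diff_extDeriv_eulerInv {J : Finset (Fin n)} {c : ℕ} (hc : c ≠ 0)
    {f : Finset (Fin n) → S} (hf : ∀ I ⊆ J, I.card + 1 = c → diff J f I = 0)
    {I : Finset (Fin n)} (hI : I ⊆ J) (hIc : I.card = c) :
    diff J (extDeriv fun K => eulerInv J c (f K)) I = f I := by
  have h := diff_extDeriv_add_extDeriv_diff (fun K => eulerInv J c (f K)) hI
  rw [hIc, euler_eulerInv J hc] at h
  rw [← h, left_eq_add]
  refine Finset.sum_eq_zero fun k hk => ?_
  obtain ⟨c, rfl⟩ := Nat.exists_eq_succ_of_ne_zero hc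
  -- The inverse of the Euler operator is compatible with the differential, so it preserves cycles.
  have h1 : diff J (fun K => eulerInv J (c + 1) (f K)) (I.erase k) =
      eulerInv J c (diff J f (I.erase k)) := by
    rw [diff, diff, map_sum]
    refine Finset.sum_congr rfl fun j hj => ?_
    rw [mul_assoc, mul_assoc, X_mul_eulerInv (Finset.mem_sdiff.mp hj).1]
    rcases neg_one_pow_eq_or S ((I.erase k).filter (· < j)).card with h | h <;>
      rw [sgn, h] <;> simp
  rw [Nat.succ_eq_add_one, h1, hf _ ((Finset.erase_subset _ _).trans hI), map_zero, map_zero,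
    mul_zero]
  rw [Finset.card_erase_of_mem hk]
  omega

end Koszul

/-! ### The Koszul resolution -/

namespace Koszul

variable {n : ℕ} {J : Finset (Fin n)}

open scoped Classical in
/-- The extension by zero of a function on the subsets of `J` with `-q` elements. -/
def extend {q : ℤ} (f : GrMod.KoszulIndex J q → MvPolynomial (Fin n) ℂ) (I : Finset (Fin n)) :
    MvPolynomial (Fin n) ℂ :=
  if h : I ⊆ J ∧ (I.card : ℤ) = -q then f ⟨I, h⟩ else 0

lemma koszulLin_eq_diff {p q : ℤ} (f : GrMod.KoszulIndex J p → MvPolynomial (Fin n) ℂ)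
    (I : GrMod.KoszulIndex J q) : GrMod.koszulLin J p q f I = diff J (extend f) I.1 := by
  rw [GrMod.koszulLin_apply, diff]
  symm
  refine Finset.sum_subset_zero_on_sdiff (Finset.subset_univ _) (fun j hj => dif_neg fun h => ?_)
    (fun j hj => ?_)
  · rw [Finset.mem_sdiff, Finset.mem_sdiff, not_and_not_right] at hj
    exact h.1 (hj.2 (h.2.1 (Finset.mem_insert_self _ _)))
  · have hjI := (Finset.mem_sdiff.mp hj).2
    rw [extend]
    by_cases h : insert j I.1 ⊆ J ∧ ((insert j I.1).card : ℤ) = -p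
    · rw [dif_pos h, dif_pos ⟨hjI, h⟩]
      rfl
    · rw [dif_neg h, dif_neg fun h' => h h'.2, mul_zero]

/-- The Koszul complex is exact in negative degrees. -/
lemma exists_koszulLin_eq {p q r : ℤ} (hp : p + 1 = q) (hr : q + 1 = r) (hq : q < 0)
    (f : GrMod.KoszulIndex J q → MvPolynomial (Fin n) ℂ) (hf : GrMod.koszulLin J q r f = 0) :
    ∃ g, GrMod.koszulLin J p q g = f := by
  obtain ⟨c, hc⟩ : ∃ c : ℕ, (c : ℤ) = -q := ⟨(-q).toNat, Int.toNat_of_nonneg (by omega)⟩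
  refine ⟨fun I => extDeriv (fun K => eulerInv J c (extend f K)) I.1, funext fun I => ?_⟩
  have h0 : ∀ I ⊆ J, I.card + 1 = c → diff J (extend f) I = 0 := fun I hI hIc =>
    (koszulLin_eq_diff f ⟨I, hI, by omega⟩).symm.trans (congrFun hf _)
  have h1 := diff_extDeriv_eulerInv (by omega) h0 I.2.1 (by have := I.2.2; omega)
  rw [koszulLin_eq_diff]
  refine Eq.trans (Finset.sum_congr rfl fun j hj => ?_) (h1.trans (dif_pos I.2))
  refine congrArg _ (dif_pos ⟨Finset.insert_subset (Finset.mem_sdiff.mp hj).1 I.2.1, ?_⟩)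
  rw [Finset.card_insert_of_notMem (Finset.mem_sdiff.mp hj).2, Nat.cast_add, I.2.2]
  push_cast
  omega

/-- The empty set of indices. -/
def emptyIndex (J : Finset (Fin n)) : GrMod.KoszulIndex J 0 := ⟨∅, Finset.empty_subset _, by simp⟩

lemma eq_emptyIndex (I : GrMod.KoszulIndex J 0) : I = emptyIndex J :=
  Subtype.ext (Finset.card_eq_zero.mp (by have := I.2.2; omega))

/-- The image of the last differential is contained in `𝔪`. -/
lemma koszulLin_emptyIndex_mem {p : ℤ} (f : GrMod.KoszulIndex J p → MvPolynomial (Fin n) ℂ) :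
    GrMod.koszulLin J p 0 f (emptyIndex J) ∈ linearPrime J := by
  rw [koszulLin_eq_diff]
  refine Ideal.sum_mem _ fun j hj => Ideal.mul_mem_right _ _ (Ideal.mul_mem_left _ _ ?_)
  exact Ideal.subset_span ⟨j, (Finset.mem_sdiff.mp hj).1, rfl⟩

lemma diff_empty (f : Finset (Fin n) → MvPolynomial (Fin n) ℂ) :
    diff J f ∅ = ∑ j ∈ J, MvPolynomial.X j * f {j} := by
  rw [diff, Finset.sdiff_empty]
  refine Finset.sum_congr rfl fun j _ => ?_
  rw [sgn, Finset.filter_empty, Finset.card_empty, pow_zero, one_mul, insert_empty_eq]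

/-- The image of the last differential contains `𝔪`. -/
lemma exists_koszulLin_emptyIndex_eq {s : MvPolynomial (Fin n) ℂ} (hs : s ∈ linearPrime J) :
    ∃ f, GrMod.koszulLin J (-1) 0 f (emptyIndex J) = s := by
  have h : linearPrime J ≤ LinearMap.range
      (LinearMap.proj (emptyIndex J) ∘ₗ GrMod.koszulLin J (-1) 0) := by
    rw [linearPrime, Ideal.span, Submodule.span_le]
    rintro _ ⟨j, hj, rfl⟩
    refine ⟨fun I => if I.1 = {j} then 1 else 0, ?_⟩
    rw [LinearMap.comp_apply, LinearMap.proj_apply, koszulLin_eq_diff]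
    refine (diff_empty _).trans ?_
    rw [Finset.sum_eq_single_of_mem j hj]
    · rw [extend, dif_pos ⟨Finset.singleton_subset_iff.mpr hj, by simp⟩, if_pos rfl, mul_one]
    · intro k _ hk
      have : ({k} : Finset (Fin n)) ≠ {j} := fun h => hk (Finset.singleton_injective h)
      rw [extend]
      split_ifs <;> exact mul_zero _
  exact h hs

end Koszul

namespace GrMod

open Koszul

variable {D : Type} [AddCommGroup D] {n : ℕ} (deg : Fin n → D)

/-- The projection of the last term of the Koszul complex to `(S/𝔪)(α)`. -/
def koszulAugmentation (J : Finset (Fin n)) (α : D) : koszulX deg J α 0 ⟶ primeQuot deg J α where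
  toLin := (linearPrime J).mkQ ∘ₗ (LinearMap.proj (emptyIndex J) :
    (KoszulIndex J 0 → MvPolynomial (Fin n) ℂ) →ₗ[MvPolynomial (Fin n) ℂ] MvPolynomial (Fin n) ℂ)
  map_gr a (f : KoszulIndex J 0 → MvPolynomial (Fin n) ℂ) hf := by
    refine ⟨f (emptyIndex J), ?_, rfl⟩
    have h := hf (emptyIndex J) trivial
    change f (emptyIndex J) ∈
      MvPolynomial.weightedHomogeneousSubmodule ℂ deg (α - ∑ i ∈ (∅ : Finset (Fin n)), deg i + a) at h
    rw [Finset.sum_empty, sub_zero] at h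
    exact h

lemma koszulAugmentation_surjective (J : Finset (Fin n)) (α : D) :
    Function.Surjective (koszulAugmentation deg J α).toLin := fun y => by
  obtain ⟨s, rfl⟩ := (linearPrime J).mkQ_surjective y
  exact ⟨fun _ => s, rfl⟩

lemma koszulD_comp_koszulAugmentation (J : Finset (Fin n)) (α : D) (p : ℤ) :
    koszulD deg J α p 0 ≫ koszulAugmentation deg J α = 0 := by
  ext f
  exact (Submodule.Quotient.mk_eq_zero _).mpr (koszulLin_emptyIndex_mem f)

/-- The augmentation of the Koszul complex, as a map to `(S/𝔪)(α)` in degree `0`. -/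
def koszulε (J : Finset (Fin n)) (α : D) :
    koszul deg J α ⟶ (CochainComplex.singleFunctor (GrMod deg) 0).obj (primeQuot deg J α) :=
  HomologicalComplex.mkHomToSingle (koszulAugmentation deg J α) fun _ _ =>
    koszulD_comp_koszulAugmentation deg J α _

lemma isZero_koszulX (J : Finset (Fin n)) (α : D) {q : ℤ} (hq : 0 < q) :
    IsZero (koszulX deg J α q) := by
  rw [IsZero.iff_id_eq_zero]
  ext (f : KoszulIndex J q → MvPolynomial (Fin n) ℂ)
  exact funext fun I => absurd I.2.2 (by omega)

/-- The Koszul complex on the variables `xⱼ`, `j ∈ J`, is a resolution of `(S/𝔪)(α)`. -/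
instance quasiIso_koszulε (J : Finset (Fin n)) (α : D) : QuasiIso (koszulε deg J α) where
  quasiIsoAt q := by
    by_cases hq : q = 0
    · subst hq
      rw [quasiIsoAt_iff' _ (-1) 0 1 (by simp) (by simp),
        ShortComplex.quasiIso_iff_of_zeros' _ ((isZero_koszulX deg J α one_pos).eq_of_tgt _ _)
          rfl rfl]
      have h : (koszulε deg J α).f 0 = koszulAugmentation deg J α ≫
          (HomologicalComplex.singleObjXSelf (ComplexShape.up ℤ) 0 (primeQuot deg J α)).inv :=
        HomologicalComplex.mkHomToSingle_f _ _
      have hepi := epi_of_surjective (koszulAugmentation deg J α)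
        (koszulAugmentation_surjective deg J α)
      have hepi' : Epi (HomologicalComplex.singleObjXSelf (ComplexShape.up ℤ) 0
        (primeQuot deg J α)).inv := inferInstance
      constructor
      · let T := ShortComplex.mk (koszulD deg J α (-1) 0) (koszulAugmentation deg J α)
          (koszulD_comp_koszulAugmentation deg J α _)
        have hT : T.Exact := by
          rw [shortComplex_exact_iff]
          intro f hf
          obtain ⟨g, hg⟩ := exists_koszulLin_emptyIndex_eq
            ((Submodule.Quotient.mk_eq_zero _).mp hf)
          exact ⟨g, funext fun I => by rw [eq_emptyIndex I]; exact hg⟩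
        refine ShortComplex.exact_of_iso (ShortComplex.isoMk (Iso.refl _) (Iso.refl _)
          (HomologicalComplex.singleObjXSelf (ComplexShape.up ℤ) 0 (primeQuot deg J α)).symm
          ?_ ?_) hT
        · exact (Category.id_comp _).trans (Category.comp_id _).symm
        · exact (Category.id_comp _).trans h
      · change Epi ((koszulε deg J α).f 0)
        rw [h]
        exact @epi_comp _ _ _ _ _ _ hepi _ hepi'
    · refine (quasiIsoAt_iff_exactAt' _ _ (HomologicalComplex.exactAt_single_obj _ _ _ _ hq)).mpr ?_
      rcases lt_or_gt_of_ne hq with hq | hq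
      · rw [HomologicalComplex.exactAt_iff' _ (q - 1) q (q + 1) (by simp) (by simp),
          shortComplex_exact_iff]
        exact exists_koszulLin_eq (by omega) rfl hq
      · exact ShortComplex.exact_of_isZero_X₂ _ (isZero_koszulX deg J α hq)

end GrMod

/-! ### Generation of bounded objects by their homology -/

namespace DerivedCategory

open Pretriangulated TStructure

variable {C : Type*} [Category* C] [Abelian C] [HasDerivedCategory.{w} C]

/-- In the triangle `X ⟶ A ⟶ Y` of truncations, the object `X` has the homology of `A` in degrees
at most `m`. -/
lemma isIso_homologyMap_mor₁ {T : Triangle (DerivedCategory C)} (hT : T ∈ distTriang _) {m : ℤ}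
    (hY : T.obj₃.IsGE (m + 1)) {i : ℤ} (hi : i ≤ m) : IsIso ((homologyFunctor C i).map T.mor₁) := by
  have h1 := (HomologySequence.mono_homologyMap_mor₁_iff T hT (i - 1) i (by omega)).mpr
    ((isZero_of_isGE T.obj₃ (m + 1) (i - 1) (by omega)).eq_of_src _ _)
  have h2 := (HomologySequence.epi_homologyMap_mor₁_iff T hT i).mpr
    ((isZero_of_isGE T.obj₃ (m + 1) i (by omega)).eq_of_tgt _ _)
  exact isIso_of_mono_of_epi _

/-- In the triangle `X ⟶ A ⟶ Y` of truncations, the object `Y` has the homology of `A` in degrees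
greater than `m`. -/
lemma isIso_homologyMap_mor₂ {T : Triangle (DerivedCategory C)} (hT : T ∈ distTriang _) {m : ℤ}
    (hX : T.obj₁.IsLE m) {i : ℤ} (hi : m < i) : IsIso ((homologyFunctor C i).map T.mor₂) := by
  have h1 := (HomologySequence.mono_homologyMap_mor₂_iff T hT i).mpr
    ((isZero_of_isLE T.obj₁ m i hi).eq_of_src _ _)
  have h2 := (HomologySequence.epi_homologyMap_mor₂_iff T hT i (i + 1) rfl).mpr
    ((isZero_of_isLE T.obj₁ m (i + 1) (by omega)).eq_of_tgt _ _)
  exact isIso_of_mono_of_epi _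

lemma prop_singleFunctor_obj_iff (P : ObjectProperty (DerivedCategory C)) [P.IsTriangulated]
    [P.IsClosedUnderIsomorphisms] (Y : C) (n : ℤ) :
    P ((singleFunctor C n).obj Y) ↔ P ((singleFunctor C 0).obj Y) := by
  rw [← P.prop_shift_iff_of_isStableUnderShift ((singleFunctor C n).obj Y) n]
  exact P.prop_iff_of_iso (((singleFunctors C).shiftIso n 0 n (add_zero n)).app Y)

/-- A bounded object of the derived category lies in every triangulated subcategory that contains
its homology objects. -/
theorem prop_of_prop_homology (P : ObjectProperty (DerivedCategory C)) [P.IsTriangulated]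
    [P.IsClosedUnderIsomorphisms] (k : ℕ) (a : ℤ) (X : DerivedCategory C) (hGE : X.IsGE a)
    (hLE : X.IsLE (a + k))
    (hX : ∀ i, P ((singleFunctor C 0).obj ((homologyFunctor C i).obj X))) : P X := by
  induction k generalizing a X with
  | zero =>
    rw [Nat.cast_zero, add_zero] at hLE
    obtain ⟨Y, ⟨e⟩⟩ := exists_iso_singleFunctor_obj_of_isGE_of_isLE X a
    have e' : (homologyFunctor C a).obj X ≅ Y :=
      (homologyFunctor C a).mapIso e ≪≫ (singleFunctorCompHomologyFunctorIso C a).app Y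
    refine P.prop_of_iso e.symm ((prop_singleFunctor_obj_iff P Y a).mpr ?_)
    exact P.prop_of_iso ((singleFunctor C 0).mapIso e') (hX a)
  | succ k ih =>
    -- Split off the homology in the top degree `a + k + 1`.
    obtain ⟨X₁, X₃, h₁, h₃, f, g, h, hT⟩ := t.exists_triangle X (a + k) (a + k + 1) rfl
    replace h₁ : X₁.IsLE (a + k) := ⟨h₁⟩
    replace h₃ : X₃.IsGE (a + k + 1) := ⟨h₃⟩
    have iso₁ : ∀ i ≤ a + k, IsIso ((homologyFunctor C i).map f) := fun i hi =>
      isIso_homologyMap_mor₁ hT h₃ hi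
    have iso₃ : ∀ i, a + k < i → IsIso ((homologyFunctor C i).map g) := fun i hi =>
      isIso_homologyMap_mor₂ hT h₁ hi
    have zero₁ : ∀ i, a + k < i → IsZero ((homologyFunctor C i).obj X₁) := fun i hi =>
      isZero_of_isLE X₁ (a + k) i hi
    have zero₃ : ∀ i ≤ a + k, IsZero ((homologyFunctor C i).obj X₃) := fun i hi =>
      isZero_of_isGE X₃ (a + k + 1) i (by omega)
    have hz : ∀ Y : C, IsZero Y → P ((singleFunctor C 0).obj Y) := fun Y hY =>
      P.prop_of_isZero ((singleFunctor C 0).map_isZero hY)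
    refine P.ext_of_isTriangulatedClosed₂ _ hT (ih a X₁ ?_ h₁ fun i => ?_) ?_
    · rw [isGE_iff]
      intro i hi
      have := iso₁ i (by omega)
      exact (isZero_of_isGE X a i hi).of_iso (asIso ((homologyFunctor C i).map f))
    · rcases le_or_gt i (a + k) with hi | hi
      · have := iso₁ i hi
        exact P.prop_of_iso ((singleFunctor C 0).mapIso
          (asIso ((homologyFunctor C i).map f)).symm) (hX i)
      · exact hz _ (zero₁ i hi)
    · have hLE₃ : X₃.IsLE (a + k + 1) := by
        rw [isLE_iff]
        intro i hi
        have := iso₃ i (by omega)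
        exact (isZero_of_isLE X (a + (k + 1 : ℕ)) i (by push_cast; omega)).of_iso
          (asIso ((homologyFunctor C i).map g)).symm
      obtain ⟨Y, ⟨e⟩⟩ := exists_iso_singleFunctor_obj_of_isGE_of_isLE X₃ (a + k + 1)
      have := iso₃ (a + k + 1) (by omega)
      have e' : (homologyFunctor C (a + k + 1)).obj X ≅ Y :=
        asIso ((homologyFunctor C (a + k + 1)).map g) ≪≫ (homologyFunctor C _).mapIso e ≪≫
          (singleFunctorCompHomologyFunctorIso C _).app Y
      refine P.prop_of_iso e.symm ((prop_singleFunctor_obj_iff P Y _).mpr ?_)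
      exact P.prop_of_iso ((singleFunctor C 0).mapIso e') (hX _)

end DerivedCategory

/-! ### Triangulated subcategories and classes of modules -/

namespace GrMod

open Pretriangulated DerivedCategory

variable {D : Type} [AddCommGroup D] {n : ℕ} {deg : Fin n → D}

section Powers

variable {I : Ideal (MvPolynomial (Fin n) ℂ)}

lemma killedBy_top {M : GrMod deg} (hM : KilledBy ⊤ M) : Subsingleton M :=
  ⟨fun x y => by
    rw [← one_smul (MvPolynomial (Fin n) ℂ) x, ← one_smul (MvPolynomial (Fin n) ℂ) y,
      hM 1 trivial, hM 1 trivial]⟩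

/-- Multiplication `⨁_{j ∈ J} M(-deg j) ⟶ M` by the variables `xⱼ`. -/
def mulVars (M : GrMod deg) (J : Finset (Fin n)) : pi (fun j : J => M.twist (-deg j)) ⟶ M where
  toLin :=
    { toFun := fun f => ∑ j : J, (MvPolynomial.X j.1 : MvPolynomial (Fin n) ℂ) • (show M from f j)
      map_add' := fun f g => by
        rw [← Finset.sum_add_distrib]
        exact Finset.sum_congr rfl fun j _ => smul_add _ _ _
      map_smul' := fun s f => by
        rw [RingHom.id_apply, Finset.smul_sum]
        exact Finset.sum_congr rfl fun j _ => smul_comm (M := MvPolynomial (Fin n) ℂ)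
          (N := MvPolynomial (Fin n) ℂ) (α := M) _ _ _ }
  map_gr a f hf := by
    refine sum_mem fun j _ => ?_
    have h := M.X_smul_mem_gr j.1 (hf j trivial)
    rwa [add_neg_cancel_left] at h

/-- If a class contains the modules annihilated by `I` and those annihilated by `𝔪`, where
`𝔪 = (xᵢ : i ∈ J)`, then it contains those annihilated by `𝔪 I`: for such a module `M`, use the
sequence `0 ⟶ 𝔪 M ⟶ M ⟶ M / 𝔪 M ⟶ 0`. -/
lemma IsTwoOfThree.of_killedBy_mul {𝒞 : GrMod deg → Prop} (h : IsTwoOfThree ⊥ 𝒞)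
    (J : Finset (Fin n)) (hJ : ∀ M, KilledBy (linearPrime J) M → 𝒞 M)
    (hI : ∀ M, KilledBy I M → 𝒞 M) (M : GrMod deg) (hM : KilledBy (linearPrime J * I) M) :
    𝒞 M := by
  have hW := isHomog_range (mulVars M J)
  refine h.middle (isSES_sub_quot M _ hW) (fun s hs m => ?_) (hI _ ?_) (hJ _ ?_)
  · rw [Ideal.mem_bot.mp hs, zero_smul]
  · rintro s hs ⟨_, f, rfl⟩
    refine Subtype.ext ?_
    change s • ∑ j : J, (MvPolynomial.X j.1 : MvPolynomial (Fin n) ℂ) • (show M from f j) = 0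
    rw [Finset.smul_sum]
    refine Finset.sum_eq_zero fun j _ => ?_
    rw [smul_smul, mul_comm]
    exact hM _ (Ideal.mul_mem_mul (Ideal.subset_span ⟨j.1, j.2, rfl⟩) hs) _
  · rw [killedBy_linearPrime_iff]
    intro j hj m
    obtain ⟨m, rfl⟩ := Submodule.mkQ_surjective _ m
    classical
    refine (Submodule.Quotient.mk_eq_zero _).mpr ⟨Pi.single (M := fun _ : J => (M : Type)) ⟨j, hj⟩ m, ?_⟩
    refine (Finset.sum_eq_single_of_mem (⟨j, hj⟩ : J) (Finset.mem_univ _) fun k _ hk => ?_).trans ?_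
    · exact (congrArg _ (Pi.single_eq_of_ne (M := fun _ : J => (M : Type)) hk m)).trans (smul_zero _)
    · exact congrArg _ (Pi.single_eq_same (M := fun _ : J => (M : Type)) (⟨j, hj⟩ : J) m)

/-- A class that contains the modules annihilated by one of the ideals `(xᵢ : i ∈ Jₖ)` contains the
modules annihilated by a power of the product of these ideals. -/
lemma IsTwoOfThree.of_killedBy_prod_pow {𝒞 : GrMod deg → Prop} (h : IsTwoOfThree ⊥ 𝒞)
    (h0 : ∀ Z : GrMod deg, Subsingleton Z → 𝒞 Z) {t : ℕ} (J : Fin t → Finset (Fin n))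
    (hJ : ∀ k M, KilledBy (linearPrime (J k)) M → 𝒞 M) (N : ℕ) (M : GrMod deg)
    (hM : KilledBy ((∏ k, linearPrime (J k)) ^ N) M) : 𝒞 M := by
  have key : ∀ (s : Finset (Fin t)) (I : Ideal (MvPolynomial (Fin n) ℂ)),
      (∀ M, KilledBy I M → 𝒞 M) → ∀ M, KilledBy ((∏ k ∈ s, linearPrime (J k)) * I) M → 𝒞 M := by
    intro s
    induction s using Finset.cons_induction with
    | empty =>
      intro I hI M hM
      rw [Finset.prod_empty, one_mul] at hM
      exact hI M hM
    | cons k s hk ih =>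
      intro I hI M hM
      rw [Finset.prod_cons, mul_assoc] at hM
      exact h.of_killedBy_mul (J k) (hJ k) (ih I hI) M hM
  induction N generalizing M with
  | zero =>
    rw [pow_zero, Ideal.one_eq_top] at hM
    exact h0 M (killedBy_top hM)
  | succ N ih =>
    rw [pow_succ'] at hM
    exact key _ _ ih M hM

end Powers

lemma isZero_of_subsingleton {M : GrMod deg} (hM : Subsingleton M) : IsZero M := by
  rw [IsZero.iff_id_eq_zero]
  ext x
  exact Subsingleton.elim _ _

section Derived

variable [HasDerivedCategory.{w} (GrMod deg)]

/-- A class of bounded objects and its image in the unbounded derived category. -/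
lemma prop_map_ι_iff (Q : ObjectProperty (Db deg)) [Q.IsClosedUnderIsomorphisms] (X : Db deg) :
    Q.map (Bounded.ι) X.obj ↔ Q X := by
  refine ⟨?_, fun h => Q.prop_map_obj (Bounded.ι) h⟩
  rintro ⟨Y, hY, ⟨e⟩⟩
  exact Q.prop_of_iso ((ObjectProperty.fullyFaithfulι _).preimageIso e) hY

lemma prop_single_iff (Q : ObjectProperty (Db deg)) [Q.IsClosedUnderIsomorphisms] (M : GrMod deg) :
    Q (single M) ↔ Q.map Bounded.ι ((singleFunctor (GrMod deg) 0).obj M) :=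
  (prop_map_ι_iff Q (single M)).symm

variable (Q : ObjectProperty (Db deg)) [Q.IsTriangulated] [Q.IsClosedUnderIsomorphisms]

lemma prop_single_of_isZero {M : GrMod deg} (hM : IsZero M) : Q (single M) :=
  (prop_single_iff Q M).mpr
    ((Q.map Bounded.ι).prop_of_isZero ((singleFunctor (GrMod deg) 0).map_isZero hM))

/-- A short exact sequence of modules gives a distinguished triangle. -/
lemma isTwoOfThree_single (I : Ideal (MvPolynomial (Fin n) ℂ)) :
    IsTwoOfThree (deg := deg) I fun M => Q (single M) where
  left h _ hB hC := (prop_single_iff Q _).mpr <|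
    (Q.map Bounded.ι).ext_of_isTriangulatedClosed₁ _ h.shortExact.singleTriangle_distinguished
      ((prop_single_iff Q _).mp hB) ((prop_single_iff Q _).mp hC)
  middle h _ hA hC := (prop_single_iff Q _).mpr <|
    (Q.map Bounded.ι).ext_of_isTriangulatedClosed₂ _ h.shortExact.singleTriangle_distinguished
      ((prop_single_iff Q _).mp hA) ((prop_single_iff Q _).mp hC)
  right h _ hA hB := (prop_single_iff Q _).mpr <|
    (Q.map Bounded.ι).ext_of_isTriangulatedClosed₃ _ h.shortExact.singleTriangle_distinguished
      ((prop_single_iff Q _).mp hA) ((prop_single_iff Q _).mp hB)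

/-- The homology modules of an object of the bounded derived category. -/
abbrev homology (X : Db deg) (i : ℤ) : GrMod deg := (homologyFunctor (GrMod deg) i).obj X.obj

/-- A triangulated subcategory of the bounded derived category contains every object whose homology
modules it contains. -/
lemma prop_of_prop_single_homology (X : Db deg) (h : ∀ i, Q (single (homology X i))) : Q X := by
  obtain ⟨⟨a, ha⟩, ⟨b, hb⟩⟩ := X.property
  rw [← prop_map_ι_iff Q]
  have hb' : X.obj.IsLE (a + (b - a).toNat) := TStructure.t.isLE_of_le X.obj b _ (by omega)
  exact prop_of_prop_homology _ _ a X.obj ha hb' fun i => (prop_single_iff Q _).mp (h i)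

end Derived

end GrMod

/-! ### The torsion subcategory -/

namespace GrMod

open Pretriangulated DerivedCategory ZeroObject

variable {D : Type} [AddCommGroup D] {n : ℕ} {deg : Fin n → D}

section PowTorsion

variable {B : Ideal (MvPolynomial (Fin n) ℂ)}

lemma KilledBy.of_exact {T : ShortComplex (GrMod deg)} (hT : T.Exact) {N N' : ℕ}
    (h₁ : KilledBy (B ^ N) T.X₁) (h₃ : KilledBy (B ^ N') T.X₃) : KilledBy (B ^ (N + N')) T.X₂ := by
  intro s hs m
  rw [pow_add] at hs
  induction hs using Submodule.mul_induction_on' with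
  | mem_mul_mem a ha b hb =>
    obtain ⟨y, hy⟩ := (shortComplex_exact_iff T).mp hT (b • m) (by rw [map_smul, h₃ b hb])
    rw [mul_smul, ← hy, ← map_smul, h₁ a ha, map_zero]
  | add a _ b _ ha hb => rw [add_smul, ha, hb, add_zero]

variable (B) in
/-- The modules annihilated by a power of `B`. -/
def IsPowTorsion (M : GrMod deg) : Prop := ∃ N : ℕ, KilledBy (B ^ N) M

lemma IsPowTorsion.of_exact {T : ShortComplex (GrMod deg)} (hT : T.Exact)
    (h₁ : IsPowTorsion B T.X₁) (h₃ : IsPowTorsion B T.X₃) : IsPowTorsion B T.X₂ := by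
  obtain ⟨N, h₁⟩ := h₁
  obtain ⟨N', h₃⟩ := h₃
  exact ⟨N + N', h₁.of_exact hT h₃⟩

lemma IsPowTorsion.of_epi {M N : GrMod deg} (f : M ⟶ N) [Epi f] (h : IsPowTorsion B M) :
    IsPowTorsion B N := by
  obtain ⟨k, hk⟩ := h
  exact ⟨k, hk.of_surjective (surjective_of_epi f)⟩

lemma IsPowTorsion.of_iso {M N : GrMod deg} (e : M ≅ N) (h : IsPowTorsion B M) :
    IsPowTorsion B N :=
  h.of_epi e.hom

lemma IsPowTorsion.of_isZero {M : GrMod deg} (h : IsZero M) : IsPowTorsion B M :=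
  ⟨0, fun s _ m => by
    have : m = 0 := LinearMap.congr_fun (congrArg Hom.toLin (h.eq_of_src (𝟙 M) 0)) m
    rw [this, smul_zero]⟩

end PowTorsion

variable [HasDerivedCategory.{w} (GrMod deg)]

instance (B : Ideal (MvPolynomial (Fin n) ℂ)) : (torsion deg B).IsTriangulated := by
  unfold torsion; infer_instance

instance (B : Ideal (MvPolynomial (Fin n) ℂ)) : (torsion deg B).IsClosedUnderIsomorphisms := by
  unfold torsion; infer_instance

instance {t : ℕ} (J : Fin t → Finset (Fin n)) : (koszulRelations deg J).IsTriangulated := by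
  unfold koszulRelations; infer_instance

instance {t : ℕ} (J : Fin t → Finset (Fin n)) :
    (koszulRelations deg J).IsClosedUnderIsomorphisms := by
  unfold koszulRelations; infer_instance

instance : (lineComplexes deg).IsClosedUnderIsomorphisms := by
  unfold lineComplexes; infer_instance

lemma le_triangulatedHull {C : Type*} [Category* C] [HasZeroObject C] [HasShift C ℤ]
    [Preadditive C] [∀ k : ℤ, (shiftFunctor C k).Additive] [Pretriangulated C]
    (P : ObjectProperty C) : P ≤ triangulatedHull P :=
  fun _ hX _ _ _ h => h _ hX

lemma torsion_single {B : Ideal (MvPolynomial (Fin n) ℂ)} {N : ℕ} {M : GrMod deg}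
    (hM : KilledBy (B ^ N) M) : torsion deg B (single M) :=
  le_triangulatedHull _ _ ⟨M, ⟨N, hM⟩, rfl⟩

section Generators

variable {B : Ideal (MvPolynomial (Fin n) ℂ)} {t : ℕ} {J : Fin t → Finset (Fin n)}

lemma torsion_single_primeQuot (hB : B = ⨅ k, linearPrime (J k)) (k : Fin t) (α : D) :
    torsion deg B (single (primeQuot deg (J k) α)) :=
  torsion_single (N := 1) fun s hs m => by
    rw [pow_one, hB] at hs
    exact killedBy_primeQuot (J k) α s ((iInf_le (fun k => linearPrime (J k)) k) hs) m

/-- A module annihilated by a power of `B = ⋂ 𝔪ₖ` is annihilated by the same power of `∏ 𝔪ₖ ⊆ B`, so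
it is generated by modules annihilated by one of the `𝔪ₖ`, hence by the `(S/𝔪ₖ)(α)`. -/
theorem torsion_eq_triangulatedHull_primeQuotients (hB : B = ⨅ k, linearPrime (J k)) :
    torsion deg B = triangulatedHull (primeQuotients deg J) := by
  apply le_antisymm
  · refine fun X hX Q hQ hQ' h => hX Q hQ hQ' ?_
    rintro _ ⟨M, ⟨N, hM⟩, rfl⟩
    have hle : ∏ k, linearPrime (J k) ≤ B := by
      rw [hB]
      exact Ideal.prod_le_inf.trans (Finset.inf_univ_eq_iInf _).le
    refine (isTwoOfThree_single Q ⊥).of_killedBy_prod_pow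
      (fun Z hZ => prop_single_of_isZero Q (isZero_of_subsingleton hZ)) J (fun k M hM =>
        (isTwoOfThree_single Q _).of_killedBy_linearPrime (J k) (fun α => h _ ⟨k, α, rfl⟩) M hM)
      N M fun s hs m => hM s (Ideal.pow_right_mono hle N hs) m
  · refine fun X hX => hX _ inferInstance inferInstance ?_
    rintro _ ⟨k, α, rfl⟩
    exact torsion_single_primeQuot hB k α

end Generators

section Homology

variable {B : Ideal (MvPolynomial (Fin n) ℂ)}

variable (deg B) in
/-- The objects of the derived category whose homology modules are annihilated by powers of `B`. -/
def powTorsionHomology : ObjectProperty (DerivedCategory (GrMod deg)) :=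
  fun X => ∀ i, IsPowTorsion B ((homologyFunctor (GrMod deg) i).obj X)

instance : (powTorsionHomology deg B).IsClosedUnderIsomorphisms where
  of_iso e h i := (h i).of_iso ((homologyFunctor (GrMod deg) i).mapIso e)

instance : (powTorsionHomology deg B).IsTriangulated where
  exists_zero := ⟨0, isZero_zero _, fun i =>
    .of_isZero ((homologyFunctor (GrMod deg) i).map_isZero (isZero_zero _))⟩
  isStableUnderShiftBy a := ⟨fun X hX i => (hX (a + i)).of_iso
    (((homologyFunctor (GrMod deg) 0).shiftIso a i (a + i) rfl).app X).symm⟩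
  toIsTriangulatedClosed₂ := .mk' fun T hT h₁ h₃ i =>
    .of_exact (HomologySequence.exact₂ T hT i) (h₁ i) (h₃ i)

/-- An object belongs to the subcategory generated by the modules annihilated by powers of `B` if
and only if its homology modules are annihilated by powers of `B`. -/
theorem torsion_iff_isPowTorsion_homology (X : Db deg) :
    torsion deg B X ↔ ∀ i, IsPowTorsion B (homology X i) := by
  refine ⟨fun hX => hX ((powTorsionHomology deg B).inverseImage Bounded.ι) inferInstance
    inferInstance ?_, fun h => prop_of_prop_single_homology _ X fun i => ?_⟩
  · rintro _ ⟨M, hM, rfl⟩ i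
    by_cases hi : i = 0
    · subst hi
      exact IsPowTorsion.of_iso ((singleFunctorCompHomologyFunctorIso (GrMod deg) 0).app M).symm hM
    · refine .of_isZero ?_
      rcases lt_or_gt_of_ne hi with hi | hi
      · exact isZero_of_isGE ((singleFunctor (GrMod deg) 0).obj M) 0 i hi
      · exact isZero_of_isLE ((singleFunctor (GrMod deg) 0).obj M) 0 i hi
  · obtain ⟨N, hN⟩ := h i
    exact torsion_single hN

/-- The objects that vanish in the quotient category are those of the subcategory. In general these
are the direct summands of its objects; the description by homology shows that the subcategory is
closed under direct summands. -/
theorem isZero_toDX_obj_iff (Y : Db deg) : IsZero ((toDX deg B).obj Y) ↔ torsion deg B Y := by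
  constructor
  · intro hY
    -- The identity of `Y` becomes zero after composition with a morphism `s` whose cone `W` lies in
    -- the subcategory; thus `s = 0`, and the homology of `W` maps onto that of `Y[1]`.
    obtain ⟨Z, s, hs, h0⟩ := (MorphismProperty.map_eq_iff_postcomp (toDX deg B) (torsion deg B).trW
      (𝟙 Y) 0).mp (hY.eq_of_src _ _)
    rw [Category.id_comp, zero_comp] at h0
    subst h0
    obtain ⟨W, g, h, hT, hW⟩ := hs
    have hT' := Bounded.ι.map_distinguished _ hT
    rw [torsion_iff_isPowTorsion_homology] at hW ⊢
    intro i
    have hepi : Epi (HomologySequence.δ (Bounded.ι.mapTriangle.obj (Triangle.mk 0 g h))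
        (i - 1) i (by omega)) :=
      (HomologySequence.exact₁ _ hT' (i - 1) i (by omega)).epi_f
        (Functor.map_zero (homologyFunctor (GrMod deg) i) Y.obj Z.obj)
    exact @IsPowTorsion.of_epi _ _ _ _ _ (homology W (i - 1)) (homology Y i) _ hepi (hW (i - 1))
  · intro hY
    have h : (torsion deg B).trW (0 : 0 ⟶ Y) :=
      ⟨_, _, _, contractible_distinguished₁ Y, hY⟩
    have := Localization.inverts (toDX deg B) (torsion deg B).trW _ h
    exact ((toDX deg B).map_isZero (isZero_zero _)).of_iso (asIso ((toDX deg B).map (0 : 0 ⟶ Y))).symm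

end Homology

end GrMod

/-! ### Complexes of line bundles -/

namespace GrMod

open Pretriangulated DerivedCategory ZeroObject

variable {D : Type} [AddCommGroup D] {n : ℕ} {deg : Fin n → D}

variable (deg) in
/-- The complexes without nonzero maps to acyclic complexes, in the homotopy category. Maps from such
a complex are the same in the homotopy category and in the derived category. -/
abbrev leftOrthogonalAcyclic :
    ObjectProperty (HomotopyCategory (GrMod deg) (ComplexShape.up ℤ)) :=
  (HomotopyCategory.subcategoryAcyclic (GrMod deg)).leftOrthogonal

lemma leftOrthogonalAcyclic_of_projective (K : CochainComplex (GrMod deg) ℤ)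
    (hK : ∀ q, Projective (K.X q)) (h0 : ∀ q, 0 < q → IsZero (K.X q)) :
    leftOrthogonalAcyclic deg ((HomotopyCategory.quotient _ _).obj K) := by
  have : K.IsStrictlyLE 0 := by
    rw [CochainComplex.isStrictlyLE_iff]
    exact h0
  have := CochainComplex.isKProjective_of_projective K 0
  exact CochainComplex.IsKProjective.leftOrthogonal K

/-- A triangulated subcategory that contains the projective modules `S(α)` contains all complexes of
line bundles. -/
lemma lineComplexes_le : lineComplexes deg ≤ leftOrthogonalAcyclic deg := by
  intro X hX
  refine hX _ inferInstance inferInstance ?_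
  rintro _ ⟨α, rfl⟩
  refine leftOrthogonalAcyclic_of_projective ((CochainComplex.singleFunctor _ 0).obj (line deg α))
    (fun q => ?_) (fun q hq => HomologicalComplex.isZero_single_obj_X _ _ _ _ hq.ne')
  by_cases hq : q = 0
  · subst hq
    exact Projective.of_iso (HomologicalComplex.singleObjXSelf _ 0 (line deg α)).symm inferInstance
  · exact (HomologicalComplex.isZero_single_obj_X (ComplexShape.up ℤ) 0 (line deg α) q hq).projective

lemma leftOrthogonalAcyclic_koszul (J : Finset (Fin n)) (α : D) :
    leftOrthogonalAcyclic deg ((HomotopyCategory.quotient _ _).obj (koszul deg J α)) :=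
  leftOrthogonalAcyclic_of_projective _
    (fun q => inferInstanceAs (Projective (pi fun _ : KoszulIndex J q => _)))
    (fun _ hq => isZero_koszulX deg J α hq)

variable [HasDerivedCategory.{w} (GrMod deg)]

lemma Qh_map_bijective {X : HomotopyCategory (GrMod deg) (ComplexShape.up ℤ)}
    (hX : leftOrthogonalAcyclic deg X) (Y : HomotopyCategory (GrMod deg) (ComplexShape.up ℤ)) :
    Function.Bijective (Qh.map : (X ⟶ Y) → _) :=
  hX.map_bijective_of_isTriangulated Qh Y

instance : ((leftOrthogonalAcyclic deg).ι ⋙ Qh).Full where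
  map_surjective f := by
    obtain ⟨g, rfl⟩ := (Qh_map_bijective (ObjectProperty.FullSubcategory.property _) _).2 f
    exact ⟨ObjectProperty.homMk g, rfl⟩

instance : ((leftOrthogonalAcyclic deg).ι ⋙ Qh).Faithful where
  map_injective {X _ _ _} h := ObjectProperty.hom_ext _ ((Qh_map_bijective X.property _).1 h)

lemma nonempty_iso_of_Qh {X Y : HomotopyCategory (GrMod deg) (ComplexShape.up ℤ)}
    (hX : leftOrthogonalAcyclic deg X) (hY : leftOrthogonalAcyclic deg Y)
    (e : Qh.obj X ≅ Qh.obj Y) : Nonempty (X ≅ Y) :=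
  ⟨(leftOrthogonalAcyclic deg).ι.mapIso
    (((leftOrthogonalAcyclic deg).ι ⋙ Qh).preimageIso (X := ⟨X, hX⟩) (Y := ⟨Y, hY⟩) e)⟩

variable (deg) in
/-- The functor from the triangulated category generated by the `S(α)` in the homotopy category to
`D(gr-S)`. -/
def lineComplexesToDb : (lineComplexes deg).FullSubcategory ⥤ Db deg :=
  (DerivedCategory.TStructure.t (C := GrMod deg)).bounded.lift
    ((lineComplexes deg).ι ⋙ DerivedCategory.Qh)
    (fun X => bounded_of_lineComplexes deg X.obj X.property)

instance : (lineComplexesToDb deg).CommShift ℤ := by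
  unfold lineComplexesToDb; infer_instance

instance : (lineComplexesToDb deg).IsTriangulated := by
  unfold lineComplexesToDb; infer_instance

instance : (lineComplexesToDb deg).Full where
  map_surjective {X _} f := by
    obtain ⟨g, hg⟩ := (Qh_map_bijective (lineComplexes_le _ X.property) _).2 f.hom
    exact ⟨ObjectProperty.homMk g, ObjectProperty.hom_ext _ hg⟩

instance : (lineComplexesToDb deg).Faithful where
  map_injective {X _ _ _} h := ObjectProperty.hom_ext _
    ((Qh_map_bijective (lineComplexes_le _ X.property) _).1 (congrArg (·.hom) h))

/-- The essential image is triangulated and contains the modules `S(a) = (S/𝔪)(a)` for the ideal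
`𝔪 = 0` generated by the empty set of variables, so it contains all modules. -/
instance : (lineComplexesToDb deg).EssSurj where
  mem_essImage X := by
    have hJ : ∀ a, (lineComplexesToDb deg).essImage (single (primeQuot deg ∅ a)) := fun a => by
      let φ : line deg a ⟶ primeQuot deg ∅ a :=
        ⟨(linearPrime ∅).mkQ, fun b x hx => ⟨x, hx, rfl⟩⟩
      have hφ : Function.Bijective φ.toLin := by
        refine ⟨LinearMap.ker_eq_bot.mp ?_, (linearPrime ∅).mkQ_surjective⟩
        refine (Submodule.ker_mkQ _).trans ?_
        simp only [linearPrime, Finset.coe_empty, Set.image_empty, Ideal.span_empty]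
        rfl
      exact (isTwoOfThree_single _ ⊥).of_bijective φ hφ
        (fun s hs m => by rw [Ideal.mem_bot.mp hs, zero_smul])
        ⟨⟨_, le_triangulatedHull _ _ ⟨a, rfl⟩⟩, ⟨Iso.refl _⟩⟩
    refine prop_of_prop_single_homology _ X fun i => ?_
    refine (isTwoOfThree_single _ _).of_killedBy_linearPrime ∅ hJ _ ?_
    rw [killedBy_linearPrime_iff]
    simp

instance : (lineComplexesToDb deg).IsEquivalence where

section Relations

variable {t : ℕ} (J : Fin t → Finset (Fin n))

/-- In the derived category, the Koszul complex is isomorphic to `(S/𝔪)(α)`. -/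
def QhKoszulIso (J : Finset (Fin n)) (α : D) :
    Qh.obj ((HomotopyCategory.quotient _ _).obj (koszul deg J α)) ≅
      (singleFunctor (GrMod deg) 0).obj (primeQuot deg J α) :=
  (quotientCompQhIso (GrMod deg)).app (koszul deg J α) ≪≫ asIso (Q.map (koszulε deg J α)) ≪≫
    (singleFunctorIsoCompQ (GrMod deg) 0).symm.app _

/-- A complex of line bundles that becomes isomorphic to `(S/𝔪)(α)` in the derived category is
homotopy equivalent to the Koszul complex, since both consist of projective modules. -/
lemma lineComplexes_koszul (J : Finset (Fin n)) (α : D) :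
    lineComplexes deg ((HomotopyCategory.quotient _ _).obj (koszul deg J α)) := by
  let e := (lineComplexesToDb deg).objObjPreimageIso (single (primeQuot deg J α))
  let Y := (lineComplexesToDb deg).objPreimage (single (primeQuot deg J α))
  obtain ⟨e'⟩ := nonempty_iso_of_Qh (lineComplexes_le _ Y.property) (leftOrthogonalAcyclic_koszul J α)
    (Bounded.ι.mapIso e ≪≫ (QhKoszulIso J α).symm)
  exact (lineComplexes deg).prop_of_iso e' Y.property

theorem koszulRelations_le_lineComplexes : koszulRelations deg J ≤ lineComplexes deg := by
  intro X hX
  refine hX _ inferInstance inferInstance ?_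
  rintro _ ⟨k, α, rfl⟩
  exact lineComplexes_koszul (J k) α

variable {J} {B : Ideal (MvPolynomial (Fin n) ℂ)}

/-- Under the equivalence `lineComplexesToDb`, the Koszul complexes correspond to the modules
`(S/𝔪ₖ)(α)`, so the subcategories which they generate correspond to each other. -/
theorem torsion_lineComplexesToDb_iff (hB : B = ⨅ k, linearPrime (J k))
    (X : (lineComplexes deg).FullSubcategory) :
    torsion deg B ((lineComplexesToDb deg).obj X) ↔ koszulRelations deg J X.obj := by
  constructor
  · intro hX
    let R := ((koszulRelations deg J).inverseImage (lineComplexes deg).ι).map (lineComplexesToDb deg)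
    have hR : R ((lineComplexesToDb deg).obj X) := by
      rw [torsion_eq_triangulatedHull_primeQuotients hB] at hX
      refine hX R inferInstance inferInstance ?_
      rintro _ ⟨k, α, rfl⟩
      refine ⟨⟨_, lineComplexes_koszul (J k) α⟩, le_triangulatedHull _ _ ⟨k, α, rfl⟩, ⟨?_⟩⟩
      exact (ObjectProperty.fullyFaithfulι _).preimageIso (QhKoszulIso (J k) α)
    obtain ⟨Y, hY, ⟨e⟩⟩ := hR
    exact (koszulRelations deg J).prop_of_iso
      ((lineComplexes deg).ι.mapIso ((lineComplexesToDb deg).preimageIso e)) hY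
  · intro hX
    rw [← prop_map_ι_iff (torsion deg B)]
    refine hX (((torsion deg B).map Bounded.ι).inverseImage Qh) inferInstance inferInstance ?_
    rintro _ ⟨k, α, rfl⟩
    exact ((torsion deg B).map Bounded.ι).prop_of_iso (QhKoszulIso (J k) α).symm
      ((prop_single_iff _ _).mp (torsion_single_primeQuot hB k α))

theorem isZero_lineComplexesToDX_obj_iff (hB : B = ⨅ k, linearPrime (J k))
    (X : (lineComplexes deg).FullSubcategory) :
    IsZero ((lineComplexesToDX deg B).obj X) ↔ koszulRelations deg J X.obj :=
  (isZero_toDX_obj_iff _).trans (torsion_lineComplexesToDb_iff hB X)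

theorem isLocalization_lineComplexesToDX (hB : B = ⨅ k, linearPrime (J k)) :
    (lineComplexesToDX deg B).IsLocalization
      ((koszulRelations deg J).inverseImage (lineComplexes deg).ι).trW := by
  have h : (koszulRelations deg J).inverseImage (lineComplexes deg).ι =
      (torsion deg B).inverseImage (lineComplexesToDb deg) := by
    ext X
    exact (torsion_lineComplexesToDb_iff hB X).symm
  rw [h]
  -- A localization functor composed with an equivalence is a localization functor; it remains to
  -- compare the morphisms that are inverted.
  let E := (lineComplexesToDb deg).asEquivalence
  refine Functor.IsLocalization.of_equivalence_source (toDX deg B) (torsion deg B).trW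
    (lineComplexesToDX deg B) _ E.symm (fun X Y f hf => ?_)
    ((torsion deg B).inverseImage_trW_isInverted (lineComplexesToDb deg) (toDX deg B))
    ((Functor.associator _ _ _).symm ≪≫ Functor.isoWhiskerRight E.counitIso (toDX deg B) ≪≫
      Functor.leftUnitor _)
  refine MorphismProperty.le_isoClosure _ _ ?_
  rw [ObjectProperty.inverseImage_trW_iff]
  exact ((torsion deg B).trW.arrow_mk_iso_iff
    (((Functor.mapArrowFunctor _ _).mapIso E.counitIso).app (Arrow.mk f))).mpr hf

end Relations

end GrMod

/-! ### The Cox ideal as an intersection of monomial primes -/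

section CoxIdeal

variable {n : ℕ} (Sig : Finset (Finset (Fin n)))

lemma prod_X_eq_monomial (s : Finset (Fin n)) :
    ∏ i ∈ s, (MvPolynomial.X i : MvPolynomial (Fin n) ℂ) =
      MvPolynomial.monomial (∑ i ∈ s, Finsupp.single i 1) 1 :=
  (MvPolynomial.monomial_sum_one s _).symm

lemma sum_single_le {s : Finset (Fin n)} {m : Fin n →₀ ℕ} (h : ∀ i ∈ s, m i ≠ 0) :
    ∑ i ∈ s, Finsupp.single i 1 ≤ m := by
  intro i
  rw [Finsupp.finsetSum_apply]
  by_cases hi : i ∈ s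
  · rw [Finset.sum_eq_single_of_mem i hi fun j _ hj => Finsupp.single_eq_of_ne' hj,
      Finsupp.single_eq_same]
    exact Nat.one_le_iff_ne_zero.mpr (h i hi)
  · rw [Finset.sum_eq_zero fun j hj => Finsupp.single_eq_of_ne' (ne_of_mem_of_not_mem hj hi)]
    exact Nat.zero_le _

lemma coxIdeal_le_linearPrime {J : Finset (Fin n)} (hJ : ∀ σ ∈ Sig, ∃ j ∈ J, j ∉ σ) :
    coxIdeal Sig ≤ linearPrime J := by
  rw [coxIdeal, Ideal.span_le]
  rintro _ ⟨σ, hσ, rfl⟩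
  obtain ⟨j, hj, hjσ⟩ := hJ σ hσ
  exact Ideal.mem_of_dvd _ (Finset.dvd_prod_of_mem _ (Finset.mem_compl.mpr hjσ))
    (Ideal.subset_span ⟨j, hj, rfl⟩)

/-- A polynomial lies in the Cox ideal if it lies in all ideals `(xⱼ : j ∈ J)` for the sets `J`
that meet the complements of all simplices. -/
lemma mem_coxIdeal_of_forall {p : MvPolynomial (Fin n) ℂ}
    (hp : ∀ J : Finset (Fin n), (∀ σ ∈ Sig, ∃ j ∈ J, j ∉ σ) → p ∈ linearPrime J) :
    p ∈ coxIdeal Sig := by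
  have h : coxIdeal Sig = Ideal.span ((fun m => MvPolynomial.monomial m (1 : ℂ)) ''
      ((fun σ : Finset (Fin n) => ∑ i ∈ σᶜ, Finsupp.single i 1) '' (Sig : Set (Finset (Fin n))))) := by
    rw [coxIdeal, Set.image_image]
    simp only [prod_X_eq_monomial]
  rw [h, MvPolynomial.mem_ideal_span_monomial_image]
  intro m hm
  by_contra! hlt
  -- The variables not dividing the monomial generate an ideal that does not contain it.
  have hJ := hp {i | m i = 0} fun σ hσ => by
    by_contra! hσ'
    refine hlt _ ⟨σ, hσ, rfl⟩ (sum_single_le fun i hi h0 => ?_)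
    exact Finset.mem_compl.mp hi (hσ' i (by simpa using h0))
  obtain ⟨i, hi, h0⟩ := MvPolynomial.mem_ideal_span_X_image.mp hJ m hm
  exact h0 (by simpa using hi)

/-- The Cox ideal is the intersection of the ideals `(xⱼ : j ∈ J)` for all sets `J` that meet the
complement of every simplex. -/
theorem exists_coxIdeal_eq_iInf_linearPrime :
    ∃ (t : ℕ) (J : Fin t → Finset (Fin n)), coxIdeal Sig = ⨅ k, linearPrime (J k) := by
  let T : Finset (Finset (Fin n)) := {J | ∀ σ ∈ Sig, ∃ j ∈ J, j ∉ σ}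
  refine ⟨T.card, fun k => (T.equivFin.symm k).1, le_antisymm (le_iInf fun k => ?_) fun p hp => ?_⟩
  · exact coxIdeal_le_linearPrime Sig (Finset.mem_filter_univ _ |>.mp (T.equivFin.symm k).2)
  · refine mem_coxIdeal_of_forall Sig fun J hJ => ?_
    have h := Ideal.mem_iInf.mp hp (T.equivFin ⟨J, Finset.mem_filter_univ _ |>.mpr hJ⟩)
    dsimp only at h
    rwa [Equiv.symm_apply_apply] at h

end CoxIdeal

end

theorem mainTheorem4 {d n : ℕ} [NeZero d] (A : PointConfiguration d n)
    (Sig : Finset (Finset (Fin n))) (hSig : A.IsRegularTriangulation Sig)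
    [HasDerivedCategory.{w} (GrMod A.deg)] :
    (∃ (t : ℕ) (J : Fin t → Finset (Fin n)), coxIdeal Sig = ⨅ k, linearPrime (J k)) ∧
    ∀ (t : ℕ) (J : Fin t → Finset (Fin n)), coxIdeal Sig = ⨅ k, linearPrime (J k) →
      -- `T_Σ` is generated by the `(S/𝔪ₖ)(α)`
      GrMod.torsion A.deg (coxIdeal Sig) = triangulatedHull (GrMod.primeQuotients A.deg J) ∧
      -- the Koszul complexes are resolutions of the `(S/𝔪ₖ)(α)`
      (∀ (k : Fin t) (α : A.DegGroup),
        ∃ ε : GrMod.koszul A.deg (J k) α ⟶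
            (CochainComplex.singleFunctor (GrMod A.deg) 0).obj (GrMod.primeQuot A.deg (J k) α),
          QuasiIso ε) ∧
      -- the Koszul complexes are complexes of sums of line bundles, and a complex of sums of line
      -- bundles vanishes in `D(X_Σ)` if and only if it is generated by Koszul complexes
      GrMod.koszulRelations A.deg J ≤ GrMod.lineComplexes A.deg ∧
      (∀ X : (GrMod.lineComplexes A.deg).FullSubcategory,
        IsZero ((GrMod.lineComplexesToDX A.deg (coxIdeal Sig)).obj X) ↔
          GrMod.koszulRelations A.deg J X.obj) ∧
      -- `D(X_Σ)` is the quotient of the bounded homotopy category of sums of line bundles by the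
      -- subcategory generated by Koszul complexes
      (GrMod.lineComplexesToDX A.deg (coxIdeal Sig)).IsLocalization
        ((GrMod.koszulRelations A.deg J).inverseImage (GrMod.lineComplexes A.deg).ι).trW :=
  ⟨exists_coxIdeal_eq_iInf_linearPrime Sig, fun _ J hJ =>
    ⟨GrMod.torsion_eq_triangulatedHull_primeQuotients hJ,
      fun k α => ⟨GrMod.koszulε A.deg (J k) α, inferInstance⟩,
      GrMod.koszulRelations_le_lineComplexes J,
      GrMod.isZero_lineComplexesToDX_obj_iff hJ,
      GrMod.isLocalization_lineComplexesToDX hJ⟩⟩
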